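/- Let $k$ be a field and let $\mathcal{C}$ be a pretannakian category over $k$: an essentially small $k$-linear symmetric monoidal category $(\mathcal{C},\otimes,\mathbb{1})$ (with $k$-bilinear tensor product) which is abelian and rigid, such that $k\to\mathrm{End}(\mathbb{1})$ is an isomorphism and every object has finite length. **Conditions on $\mathcal{C}$.** For $X\in\mathcal{C}$, $\mathrm{Sym}^nX$ denotes the coinvariants of the symmetric group $S_n$ on $X^{\otimes n}$, and we identify $\mathrm{Sym}^n\mathbb{1}=\mathbb{1}$. * (GR): for every non-zero morphism $\beta:X\to\mathbb{1}$ in $\mathcal{C}$ there is $n>0$ such that $\mathrm{Sym}^n\beta:\mathrm{Sym}^nX\to\mathbb{1}$ is a split epimorphism. * (MN1): for every simple object $L\not\simeq\mathbb{1}$ of $\mathcal{C}$ there is $n\in\mathbb{N}$ with $\mathrm{Sym}^nL=0$. * (MN2): for every monomorphism $\alpha:\mathbb{1}\to X$ in $\mathcal{C}$ that is not split there is $n\in\mathbb{N}$ such that $\alpha^n:=\mathrm{Sym}^n\alpha:\mathbb{1}\to\mathrm{Sym}^nX$ is zero. * (MN): both (MN1) and (MN2) hold. **Algebras and spectra.**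 Let $\mathsf{Alg}\,\mathcal{C}$ be the category of commutative algebras in the symmetric monoidal category $\mathrm{Ind}\,\mathcal{C}$. For $A\in\mathsf{Alg}\,\mathcal{C}$, an ideal of $A$ is a subobject $I\subset A$ with $AI\subset I$. A prime ideal is a proper ideal $P$ such that, for all subobjects $X,Y\subset A$ with $X,Y\in\mathcal{C}$, $XY\subset P$ implies $X\subset P$ or $Y\subset P$. The set $\mathrm{Spec}\,A$ of prime ideals carries the topology with closed sets $V(J)=\{P\mid J\subset P\}$, for $J$ an ideal of $A$; an algebra morphism induces a map of spectra by taking preimages. Put * $A^0=\mathrm{Hom}(\mathbb{1},A)$, a commutative $k$-algebra, with its usual prime spectrum; * $\widetilde{A}=\bigcap_{f\in\mathrm{Hom}(A,\mathbb{1})}\ker f\subset A$, the intersection over all morphisms $f:A\to\mathbb 1$ in $\mathrm{Ind}\,\mathcal{C}$, the ideal $R(A)=A\widetilde{A}$ it generates, and $A_0=A/R(A)\in\mathsf{Alg}\,\mathcal{C}$; * $A^0_0$, the image of the ring homomorphism $A^0\to(A_0)^0$, with its usual prime spectrum. For every $B\in\mathsf{Alg}\,\mathcal{C}$ there is the map $\rho_B:\mathrm{Spec}\,B\to\mathrm{Spec}\,B^0$,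 $P\mapsto P\cap B^0$. Composing $\rho_{A_0}$ with the maps induced by $A^0\to (A_0)^0$ and by $A^0_0\subset (A_0)^0$ gives maps $\mathrm{Spec}\,A_0\to\mathrm{Spec}\,A^0$ and $\mathrm{Spec}\,A_0\to\mathrm{Spec}\,A^0_0$. The surjections $A\to A_0$ and $A^0\to A^0_0$ induce maps $\mathrm{Spec}\,A_0\to\mathrm{Spec}\,A$ and $\mathrm{Spec}\,A^0_0\to\mathrm{Spec}\,A^0$. **Theorem.** For every $A\in\mathsf{Alg}\,\mathcal{C}$ the maps $\mathrm{Spec}\,A_0\to\mathrm{Spec}\,A$ and $\mathrm{Spec}\,A^0_0\to\mathrm{Spec}\,A^0$ are closed embeddings, so that we may regard $\mathrm{Spec}\,A_0\subset\mathrm{Spec}\,A$ and $\mathrm{Spec}\,A^0_0\subset\mathrm{Spec}\,A^0$ as closed subspaces. Moreover: 1. $\mathcal{C}$ satisfies (MN) if and only if $\mathrm{Spec}\,A_0=\mathrm{Spec}\,A$ for every $A\in\mathsf{Alg}\,\mathcal{C}$. 2. If $\mathcal{C}$ satisfies (MN), then $\mathrm{Spec}\,A^0_0=\mathrm{Spec}\,A^0$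 for every $A\in\mathsf{Alg}\,\mathcal{C}$. 3. If $\mathrm{Spec}\,A^0_0=\mathrm{Spec}\,A^0$ for every $A\in\mathsf{Alg}\,\mathcal{C}$, then $\mathcal{C}$ satisfies (MN2). 4. The following conditions are equivalent: (a) the map $\mathrm{Spec}\,A_0\to\mathrm{Spec}\,A^0$ is injective for every $A\in\mathsf{Alg}\,\mathcal{C}$; (b) the map $\mathrm{Spec}\,A_0\to\mathrm{Spec}\,A^0_0$ is a homeomorphism for every $A\in\mathsf{Alg}\,\mathcal{C}$; (c) $\mathcal{C}$ satisfies (GR). -/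

import Mathlib

open CategoryTheory Limits MonoidalCategory Opposite Topology
open scoped ExternalProduct
universe v u w

noncomputable section

/-! ## The symmetric monoidal structure on ind-objects -/

namespace IndTensor

section
variable {D : Type v} [SmallCategory D]

/-- A functor between presheaf categories preserving filtered colimits
and sending representables to ind-objects preserves ind-objects. -/
lemma isIndObject_obj_of_yoneda (T : (Dᵒᵖ ⥤ Type v) ⥤ (Dᵒᵖ ⥤ Type v))
    [∀ (J : Type v) [SmallCategory J], PreservesColimitsOfShape J T]
    (h : ∀ X, IsIndObject (T.obj (yoneda.obj X))) {F : Dᵒᵖ ⥤ Type v} (hF : IsIndObject F) :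
    IsIndObject (T.obj F) := by
  obtain ⟨P⟩ := hF.nonempty_presentation
  have := P.hI
  have i : T.obj F ≅ colimit ((P.F ⋙ yoneda) ⋙ T) :=
    (isColimitOfPreserves T P.isColimit).coconePointUniqueUpToIso (colimit.isColimit _)
  exact ObjectProperty.prop_of_iso IsIndObject i.symm (isIndObject_colimit _ _ fun j => h _)

lemma essImage_of_isIndObject {F : Dᵒᵖ ⥤ Type v} (h : IsIndObject F) :
    (Ind.inclusion D).essImage F :=
  ⟨(Ind.equivalence D).inverse.obj ⟨F, h⟩,
    ⟨(ObjectProperty.ι _).mapIso ((Ind.equivalence D).counitIso.app ⟨F, h⟩)⟩⟩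

/-- A morphism from an ind-object to a presheaf which is an ind-object. -/
def homIndEquiv {P : Dᵒᵖ ⥤ Type v} (hP : IsIndObject P) (H : Ind D) :
    ((Ind.inclusion D).obj H ⟶ P) ≃ (H ⟶ (Ind.equivalence D).inverse.obj ⟨P, hP⟩) :=
  (ObjectProperty.fullyFaithfulι IsIndObject).homEquiv.symm.trans
    ((Ind.equivalence D).toAdjunction.homEquiv H ⟨P, hP⟩)

lemma homIndEquiv_naturality {P : Dᵒᵖ ⥤ Type v} (hP : IsIndObject P) {H H' : Ind D}
    (f : H' ⟶ H) (β : (Ind.inclusion D).obj H ⟶ P) :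
    homIndEquiv hP H' ((Ind.inclusion D).map f ≫ β) = f ≫ homIndEquiv hP H β := by
  have h := (Ind.equivalence D).toAdjunction.homEquiv_naturality_left f
    ((ObjectProperty.fullyFaithfulι IsIndObject).homEquiv.symm β :
      (Ind.equivalence D).functor.obj H ⟶ ⟨P, hP⟩)
  exact h

end

section
variable {D : Type v} [SmallCategory D] [MonoidalCategory D]

/-- Day convolution of two representables is representable. -/
def repUnit (X Y : D) :
    (yoneda.obj X ⊠ yoneda.obj Y : Dᵒᵖ × Dᵒᵖ ⥤ Type v) ⟶
      tensor Dᵒᵖ ⋙ yoneda.obj (X ⊗ Y) where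
  app P := TypeCat.ofHom fun q => q.1 ⊗ₘ q.2
  naturality P Q f := by
    ext q
    change (f.1.unop ≫ q.1) ⊗ₘ (f.2.unop ≫ q.2) = (f.1.unop ⊗ₘ f.2.unop) ≫ (q.1 ⊗ₘ q.2)
    simp

instance (X Y : D) : (yoneda.obj (X ⊗ Y)).IsLeftKanExtension (repUnit X Y) where
  nonempty_isUniversal := ⟨by
    refine IsInitial.ofUniqueHom (fun Z => StructuredArrow.homMk
        (yonedaEquiv.symm (Z.hom.app (op X, op Y) (𝟙 X, 𝟙 Y))) ?_) ?_
    · ext ⟨P, Q⟩ ⟨a, b⟩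
      have := congr($(Z.hom.naturality (X := (op X, op Y)) (Y := (P, Q))
        (Prod.mkHom a.op b.op)) ((𝟙 X, 𝟙 Y) : (X ⟶ X) × (Y ⟶ Y)))
      change Z.right.map (a ⊗ₘ b).op (Z.hom.app (op X, op Y) (𝟙 X, 𝟙 Y)) = _
      refine this.symm.trans ?_
      change Z.hom.app (P, Q) ((a ≫ 𝟙 X, b ≫ 𝟙 Y) : (P.unop ⟶ X) × (Q.unop ⟶ Y)) = _
      rw [Category.comp_id, Category.comp_id]
      rfl
    · intro Z m
      ext1
      apply yonedaEquiv.injective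
      have := congr(($(StructuredArrow.w m).app (op X, op Y)) ((𝟙 X, 𝟙 Y) : (X ⟶ X) × (Y ⟶ Y)))
      refine Eq.trans ?_ (this.trans (Equiv.apply_symm_apply _ _).symm)
      change m.right.app (op (X ⊗ Y)) (𝟙 (X ⊗ Y)) = m.right.app (op (X ⊗ Y)) (𝟙 X ⊗ₘ 𝟙 Y)
      rw [id_tensorHom_id]⟩

/-- The external product with a fixed presheaf on the right preserves filtered colimits. -/
instance (G : Dᵒᵖ ⥤ Type v) (J : Type v) [SmallCategory J] : PreservesColimitsOfShape J
    ((externalProductBifunctorCurried Dᵒᵖ Dᵒᵖ (Type v)).flip.obj G ⋙ Functor.uncurry) := by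
  apply preservesColimitsOfShape_of_evaluation
  rintro ⟨P, Q⟩
  exact inferInstanceAs (PreservesColimitsOfShape J
    ((evaluation Dᵒᵖ (Type v)).obj P ⋙ tensorRight (G.obj Q)))

instance (F : Dᵒᵖ ⥤ Type v) (J : Type v) [SmallCategory J] : PreservesColimitsOfShape J
    ((externalProductBifunctorCurried Dᵒᵖ Dᵒᵖ (Type v)).obj F ⋙ Functor.uncurry) := by
  apply preservesColimitsOfShape_of_evaluation
  rintro ⟨P, Q⟩
  exact inferInstanceAs (PreservesColimitsOfShape J
    ((evaluation Dᵒᵖ (Type v)).obj Q ⋙ tensorLeft (F.obj P)))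

lemma isIndObject_lan {F G : Dᵒᵖ ⥤ Type v} (hF : IsIndObject F) (hG : IsIndObject G) :
    IsIndObject ((tensor Dᵒᵖ).lan.obj (F ⊠ G)) := by
  have : PreservesColimitsOfSize.{v, v} ((tensor Dᵒᵖ).lan (H := Type v)) :=
    ((tensor Dᵒᵖ).lanAdjunction (Type v)).leftAdjoint_preservesColimits
  refine isIndObject_obj_of_yoneda (((externalProductBifunctorCurried Dᵒᵖ Dᵒᵖ (Type v)).flip.obj G ⋙ Functor.uncurry) ⋙ (tensor Dᵒᵖ).lan) (fun X => ?_) hF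
  refine isIndObject_obj_of_yoneda (((externalProductBifunctorCurried Dᵒᵖ Dᵒᵖ (Type v)).obj (yoneda.obj X) ⋙ Functor.uncurry) ⋙ (tensor Dᵒᵖ).lan) (fun Y => ?_) hG
  have : ((tensor Dᵒᵖ).lan.obj (yoneda.obj X ⊠ yoneda.obj Y)).IsLeftKanExtension
    ((tensor Dᵒᵖ).lanUnit.app (yoneda.obj X ⊠ yoneda.obj Y)) := inferInstance
  exact ObjectProperty.prop_of_iso IsIndObject
    (Functor.leftKanExtensionUnique _ (repUnit X Y)
      ((tensor Dᵒᵖ).lan.obj (yoneda.obj X ⊠ yoneda.obj Y)) ((tensor Dᵒᵖ).lanUnit.app (yoneda.obj X ⊠ yoneda.obj Y))) (isIndObject_yoneda (X ⊗ Y))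


lemma essImage_tensor (F G : Ind D) : (Ind.inclusion D).essImage
    ((tensor Dᵒᵖ).pointwiseLeftKanExtension
      ((Ind.inclusion D).obj F ⊠ (Ind.inclusion D).obj G)) := by
  have h := isIndObject_lan (Ind.isIndObject_inclusion_obj F) (Ind.isIndObject_inclusion_obj G)
  have i := Functor.leftKanExtensionUnique _
    ((tensor Dᵒᵖ).lanUnit.app ((Ind.inclusion D).obj F ⊠ (Ind.inclusion D).obj G)) _
    ((tensor Dᵒᵖ).pointwiseLeftKanExtensionUnit
      ((Ind.inclusion D).obj F ⊠ (Ind.inclusion D).obj G))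
  exact essImage_of_isIndObject (ObjectProperty.prop_of_iso IsIndObject i h)

/-- The element `𝟙` of `yoneda.obj (𝟙_ D)`. -/
def repOne (D : Type v) [SmallCategory D] [MonoidalCategory D] : (Functor.fromPUnit.{0} (𝟙_ (Type v))) ⟶
    (Functor.fromPUnit.{0} (𝟙_ Dᵒᵖ)) ⋙ yoneda.obj (𝟙_ D) where
  app _ := TypeCat.ofHom fun _ => 𝟙 (𝟙_ D)

instance : (yoneda.obj (𝟙_ D)).IsLeftKanExtension (repOne D) where
  nonempty_isUniversal := ⟨by
    refine IsInitial.ofUniqueHom (fun Z => StructuredArrow.homMk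
        (yonedaEquiv.symm (Z.hom.app ⟨⟨⟩⟩ PUnit.unit)) ?_) ?_
    · ext ⟨⟨⟩⟩ ⟨⟩
      change Z.right.map (𝟙 (𝟙_ D)).op (Z.hom.app ⟨⟨⟩⟩ PUnit.unit) = Z.hom.app ⟨⟨⟩⟩ PUnit.unit
      simp
    · intro Z m
      ext1
      apply yonedaEquiv.injective
      have := congr(($(StructuredArrow.w m).app ⟨⟨⟩⟩) PUnit.unit)
      exact this.trans (Equiv.apply_symm_apply _ _).symm⟩

lemma essImage_unit : (Ind.inclusion D).essImage
    ((Functor.fromPUnit.{0} <| 𝟙_ Dᵒᵖ).pointwiseLeftKanExtension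
      (Functor.fromPUnit.{0} <| 𝟙_ (Type v))) := by
  have i := Functor.leftKanExtensionUnique _ (repOne D) _
    ((Functor.fromPUnit.{0} <| 𝟙_ Dᵒᵖ).pointwiseLeftKanExtensionUnit
      (Functor.fromPUnit.{0} <| 𝟙_ (Type v)))
  exact essImage_of_isIndObject (ObjectProperty.prop_of_iso IsIndObject i
    (isIndObject_yoneda (𝟙_ D)))

/-- The tensor product of ind-objects: Day convolution of presheaves, which preserves ind-objects. -/
instance : MonoidalCategory (Ind D) :=
  monoidalOfHasDayConvolutions (Ind.inclusion D) (Ind.inclusion.fullyFaithful)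
    essImage_tensor essImage_unit

instance : LawfulDayConvolutionMonoidalCategoryStruct Dᵒᵖ (Type v) (Ind D) :=
  lawfulDayConvolutionMonoidalCategoryStructOfHasDayConvolutions
    (Ind.inclusion D) (Ind.inclusion.fullyFaithful) essImage_tensor essImage_unit


/-- The embedding of ind-objects into presheaves. -/
abbrev indι : Ind D ⥤ Dᵒᵖ ⥤ Type v := LawfulDayConvolutionMonoidalCategoryStruct.ι Dᵒᵖ (Type v) (Ind D)

instance : (indι (D := D)).Full := inferInstanceAs (Ind.inclusion D).Full

end

section
variable {D : Type v} [SmallCategory D] [MonoidalCategory D] [SymmetricCategory D]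
open LawfulDayConvolutionMonoidalCategoryStruct

attribute [local instance] convolution convolution₂ convolution₂' convolutionUnit

/-- The braiding of ind-objects, given by the braiding of Day convolution. -/
def indBraiding (F G : Ind D) : F ⊗ G ≅ G ⊗ F :=
  (Functor.FullyFaithful.ofFullyFaithful indι).preimageIso (DayConvolution.braiding (indι.obj F) (indι.obj G))

lemma indι_map_indBraiding (F G : Ind D) :
    indι.map (indBraiding F G).hom =
      (DayConvolution.braiding (indι.obj F) (indι.obj G)).hom :=
  (Functor.FullyFaithful.ofFullyFaithful indι).map_preimage _

lemma indι_map_whiskerLeft (F : Ind D) {G H : Ind D} (f : G ⟶ H) :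
    indι.map (F ◁ f) = DayConvolution.map (𝟙 (indι.obj F)) (indι.map f) := by
  rw [← id_tensorHom, ι_map_tensorHom_hom_eq_tensorHom, CategoryTheory.Functor.map_id]

lemma indι_map_whiskerRight (F : Ind D) {G H : Ind D} (f : G ⟶ H) :
    indι.map (f ▷ F) = DayConvolution.map (indι.map f) (𝟙 (indι.obj F)) := by
  rw [← tensorHom_id, ι_map_tensorHom_hom_eq_tensorHom, CategoryTheory.Functor.map_id]

lemma indι_map_associator_inv (F G H : Ind D) :
    indι.map (α_ F G H).inv =
      (DayConvolution.associator (indι.obj F) (indι.obj G) (indι.obj H)).inv := by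
  have h := ι_map_associator_hom_eq_associator_hom Dᵒᵖ (Type v) (Ind D) F G H
  rw [← cancel_epi (indι.map (α_ F G H).hom), ← Functor.map_comp, Iso.hom_inv_id, h]
  rw [CategoryTheory.Functor.map_id, Iso.hom_inv_id]

instance : BraidedCategory (Ind D) where
  braiding := indBraiding
  braiding_naturality_right F G H f := by
    apply indι.map_injective
    rw [Functor.map_comp, Functor.map_comp, indι_map_whiskerLeft, indι_map_whiskerRight,
      indι_map_indBraiding, indι_map_indBraiding]
    exact DayConvolution.braiding_naturality_right _ _
  braiding_naturality_left f H := by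
    apply indι.map_injective
    rw [Functor.map_comp, Functor.map_comp, indι_map_whiskerLeft, indι_map_whiskerRight,
      indι_map_indBraiding, indι_map_indBraiding]
    exact DayConvolution.braiding_naturality_left _ _
  hexagon_forward F G H := by
    apply indι.map_injective
    simp only [Functor.map_comp, indι_map_whiskerLeft, indι_map_whiskerRight,
      indι_map_indBraiding, ι_map_associator_hom_eq_associator_hom]
    exact DayConvolution.hexagon_forward (indι.obj F) (indι.obj G) (indι.obj H)
  hexagon_reverse F G H := by
    apply indι.map_injective
    simp only [Functor.map_comp, indι_map_whiskerLeft, indι_map_whiskerRight,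
      indι_map_indBraiding, indι_map_associator_inv]
    exact DayConvolution.hexagon_reverse (indι.obj F) (indι.obj G) (indι.obj H)

instance : SymmetricCategory (Ind D) where
  symmetry F G := by
    apply indι.map_injective
    change indι.map ((indBraiding F G).hom ≫ (indBraiding G F).hom) = _
    rw [Functor.map_comp, indι_map_indBraiding, indι_map_indBraiding]
    let : SymmetricCategory Dᵒᵖ :=
      { symmetry := fun X Y => Quiver.Hom.unop_inj (SymmetricCategory.symmetry X.unop Y.unop) }
    exact (DayConvolution.symmetry (indι.obj F) (indι.obj G)).trans
      (CategoryTheory.Functor.map_id _ _).symm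

end

section
variable {D : Type v} [SmallCategory D] [MonoidalCategory D]
open LawfulDayConvolutionMonoidalCategoryStruct
attribute [local instance] convolution convolution₂ convolution₂' convolutionUnit

/-- The ind-object represented by the unit is the unit object of the ind-category. -/
def yonedaUnitIso (D : Type v) [SmallCategory D] [MonoidalCategory D] :
    Ind.yoneda.obj (𝟙_ D) ≅ 𝟙_ (Ind D) :=
  have : (indι.obj (𝟙_ (Ind D))).IsLeftKanExtension
      (DayConvolutionUnit.φ (indι.obj (𝟙_ (Ind D)))) :=
    (DayConvolutionUnit.isPointwiseLeftKanExtensionCan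
      (F := indι.obj (𝟙_ (Ind D)))).isLeftKanExtension
  Ind.inclusion.fullyFaithful.preimageIso (Ind.yonedaCompInclusion.app (𝟙_ D) ≪≫
    Functor.leftKanExtensionUnique _ (repOne D) (indι.obj (𝟙_ (Ind D)))
      (DayConvolutionUnit.φ (indι.obj (𝟙_ (Ind D)))))

/-- The presheaf `Z ↦ Hom (F, G (- ⊗ Z))`. -/
def ihomPresheaf (F G : Dᵒᵖ ⥤ Type v) : Dᵒᵖ ⥤ Type v :=
  (curriedTensor Dᵒᵖ).flip ⋙ (Functor.whiskeringRight _ _ _).obj G ⋙ coyoneda.obj (op F)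

lemma isIndObject_ihomPresheaf [HasFiniteColimits D]
    [∀ X : D, PreservesFiniteColimits (tensorLeft X)]
    (F : Dᵒᵖ ⥤ Type v) {G : Dᵒᵖ ⥤ Type v} (hG : IsIndObject G) :
    IsIndObject (ihomPresheaf F G) := by
  rw [isIndObject_iff_preservesFiniteLimits] at hG ⊢
  have : PreservesFiniteLimits
      ((curriedTensor Dᵒᵖ).flip ⋙ (Functor.whiskeringRight _ _ _).obj G) := by
    constructor
    intro J _ _
    apply preservesLimitsOfShape_of_evaluation
    intro X
    have : PreservesFiniteLimits (tensorLeft X.unop).op :=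
      preservesFiniteLimits_op _
    exact inferInstanceAs (PreservesLimitsOfShape J ((tensorLeft X.unop).op ⋙ G))
  exact comp_preservesFiniteLimits ((curriedTensor Dᵒᵖ).flip ⋙ (Functor.whiskeringRight _ _ _).obj G)
    (coyoneda.obj (op F))

lemma ext_nat {F H G : Dᵒᵖ ⥤ Type v} (α : F ⊠ H ⟶ tensor Dᵒᵖ ⋙ G) {X X' Z Z' : Dᵒᵖ}
    (f : X ⟶ X') (g : Z ⟶ Z') (x : F.obj X) (h : H.obj Z) :
    α.app (X', Z') ((F.map f x, H.map g h) : F.obj X' × H.obj Z') =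
      G.map (f ⊗ₘ g) (α.app (X, Z) ((x, h) : F.obj X × H.obj Z)) :=
  congr($(α.naturality (X := (X, Z)) (Y := (X', Z')) (Prod.mkHom f g))
    ((x, h) : F.obj X × H.obj Z))

/-- Currying for natural transformations out of an external product. -/
def ihomCurry (F H G : Dᵒᵖ ⥤ Type v) : (F ⊠ H ⟶ tensor Dᵒᵖ ⋙ G) ≃ (H ⟶ ihomPresheaf F G) where
  toFun α :=
    { app Z := TypeCat.ofHom fun h =>
        { app X := TypeCat.ofHom fun x => α.app (X, Z) (x, h)
          naturality := fun X Y f => by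
            ext x
            have := ext_nat α f (𝟙 Z) x h
            rw [CategoryTheory.Functor.map_id, tensorHom_id] at this
            exact this }
      naturality := fun Z Z' g => by
        ext h
        refine NatTrans.ext (funext fun X => ?_)
        ext x
        have := ext_nat α (𝟙 X) g x h
        rw [CategoryTheory.Functor.map_id, id_tensorHom] at this
        exact this }
  invFun β :=
    { app P := TypeCat.ofHom fun q => ((β.app P.2 q.2 : F ⟶ tensorRight P.2 ⋙ G)).app P.1 q.1
      naturality := fun P Q f => by
        ext q
        have h1 := congr($(β.naturality f.2) q.2)
        have h2 := congr(($h1 : F ⟶ tensorRight Q.2 ⋙ G).app Q.1 (F.map f.1 q.1))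
        have h3 := congr($((β.app P.2 q.2 : F ⟶ tensorRight P.2 ⋙ G).naturality f.1) q.1)
        refine h2.trans ((congr(G.map (Q.1 ◁ f.2) $h3)).trans ?_)
        change G.map (Q.1 ◁ f.2) (G.map (f.1 ▷ P.2) _) = G.map (f.1 ⊗ₘ f.2) _
        rw [MonoidalCategory.tensorHom_def, Functor.map_comp]
        rfl }
  left_inv α := by ext; rfl
  right_inv β := by ext; rfl

lemma ihomCurry_naturality {F H H' G : Dᵒᵖ ⥤ Type v} (φ : H' ⟶ H)
    (α : F ⊠ H ⟶ tensor Dᵒᵖ ⋙ G) :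
    ihomCurry F H' G ((externalProductBifunctor Dᵒᵖ Dᵒᵖ (Type v)).map (Prod.mkHom (𝟙 F) φ) ≫ α) =
      φ ≫ ihomCurry F H G α := by
  ext; rfl

lemma homEquiv_whiskerLeft (F : Ind D) {H H' G : Ind D} (f : H' ⟶ H) (g : F ⊗ H ⟶ G) :
    (DayConvolution.corepresentableBy (indι.obj F) (indι.obj H')).homEquiv
        (indι.map (F ◁ f ≫ g)) =
      (externalProductBifunctor Dᵒᵖ Dᵒᵖ (Type v)).map (Prod.mkHom (𝟙 _) (indι.map f)) ≫
        (DayConvolution.corepresentableBy (indι.obj F) (indι.obj H)).homEquiv (indι.map g) := by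
  refine NatTrans.ext (funext fun ⟨x, y⟩ => ?_)
  have h := convolutionExtensionUnit_comp_ι_map_whiskerLeft_app (Type v) F f x y
  change (convolutionExtensionUnit Dᵒᵖ (Type v) F H').app (x, y) ≫
      (indι.map (F ◁ f ≫ g)).app (x ⊗ y) =
    ((𝟙 ((indι.obj F).obj x)) ⊗ₘ (indι.map f).app y) ≫
      (convolutionExtensionUnit Dᵒᵖ (Type v) F H).app (x, y) ≫ (indι.map g).app (x ⊗ y)
  rw [Functor.map_comp, NatTrans.comp_app, reassoc_of% h, id_tensorHom]

/-- The adjunction equivalence for the internal hom of ind-objects. -/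
def ihomEquiv [HasFiniteColimits D]
    [∀ X : D, PreservesFiniteColimits (tensorLeft X)] (F H G : Ind D) :
    (F ⊗ H ⟶ G) ≃ (H ⟶ (Ind.equivalence D).inverse.obj
      ⟨_, isIndObject_ihomPresheaf (indι.obj F) (Ind.isIndObject_inclusion_obj G)⟩) :=
  (Functor.FullyFaithful.ofFullyFaithful indι).homEquiv.trans
    (((DayConvolution.corepresentableBy (indι.obj F) (indι.obj H)).homEquiv
      (Y := indι.obj G)).trans ((ihomCurry _ _ _).trans (homIndEquiv _ H)))

instance [HasFiniteColimits D]
    [∀ X : D, PreservesFiniteColimits (tensorLeft X)] (F : Ind D) :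
    (tensorLeft F).IsLeftAdjoint :=
  ⟨_, ⟨Adjunction.adjunctionOfEquivRight (F := tensorLeft F) (fun H G => ihomEquiv F H G) (by
    intro H' H G f g
    simp only [ihomEquiv, Equiv.trans_apply]
    refine Eq.trans ?_ (homIndEquiv_naturality _ f _)
    refine congrArg _ (Eq.trans ?_ (ihomCurry_naturality _ _))
    exact congrArg _ (homEquiv_whiskerLeft F f g))⟩⟩

end

section
variable {D : Type v} [SmallCategory D] [MonoidalCategory D] [SymmetricCategory D]
  [Abelian D] [∀ X : D, PreservesFiniteColimits (tensorLeft X)]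

instance (F : Ind D) : PreservesFiniteColimits (tensorLeft F) :=
  inferInstance

instance (F : Ind D) : PreservesFiniteColimits (tensorRight F) :=
  preservesFiniteColimits_of_natIso (BraidedCategory.tensorLeftIsoTensorRight F)

lemma additive_of_rightExact (T : Ind D ⥤ Ind D) [PreservesFiniteColimits T] : T.Additive := by
  have h0 : T.PreservesZeroMorphisms := Functor.preservesZeroMorphisms_of_map_zero_object
    ((IsInitial.isInitialObj T _ (isZero_zero _).isInitial).uniqueUpToIso
      (isZero_zero _).isInitial)
  have := preservesBinaryBiproducts_of_preservesBinaryCoproducts T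
  exact Functor.additive_of_preservesBinaryBiproducts T

instance : MonoidalPreadditive (Ind D) := by
  have hl (F : Ind D) : (tensorLeft F).Additive := additive_of_rightExact _
  have hr (F : Ind D) : (tensorRight F).Additive := additive_of_rightExact _
  exact
    { whiskerLeft_zero := fun {X _ _} => (tensorLeft X).map_zero _ _
      zero_whiskerRight := fun {X _ _} => (tensorRight X).map_zero _ _
      whiskerLeft_add := fun {X _ _} _ _ => (tensorLeft X).map_add
      add_whiskerRight := fun {X _ _} _ _ => (tensorRight X).map_add }

end

section
variable (C : Type u) [Category.{v} C] [EssentiallySmall.{v} C]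

/-- The small symmetric monoidal category equivalent to `C`. -/
abbrev Small := Monoidal.Transported (equivSmallModel.{v} C)

/-- The equivalence between `C` and its small model. -/
abbrev toSmall : C ≌ Small C := equivSmallModel.{v} C

instance [Preadditive C] : Preadditive (Small C) :=
  .ofFullyFaithful (toSmall C).fullyFaithfulInverse

instance [Preadditive C] : (toSmall C).inverse.Additive :=
  (toSmall C).fullyFaithfulInverse.additive_ofFullyFaithful

instance [Abelian C] : Abelian (Small C) := 
  have : HasFiniteProducts (Small C) := ⟨fun _ => Adjunction.hasLimitsOfShape_of_equivalence (toSmall C).inverse⟩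
  abelianOfEquivalence (toSmall C).inverse

instance [MonoidalCategory C] [RigidCategory C] (X : Small C) : PreservesFiniteColimits (tensorLeft X) := by
  let : RigidCategory (Small C) := rigidCategoryOfEquivalence (Monoidal.equivalenceTransported (equivSmallModel.{v} C)).symm.toAdjunction
  have : (tensorLeft X).IsLeftAdjoint := ⟨_, ⟨tensorLeftAdjunction (ᘁX) X⟩⟩
  infer_instance
end

end IndTensor

/-! ## Symmetric powers, algebras and spectra -/

namespace TensorAlg

section SymmetricPowers
variable {C : Type u} [Category.{v} C] [MonoidalCategory C]

/-- The tensor power `X^{⊗ n}`. -/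
def tpow (X : C) : ℕ → C
  | 0 => 𝟙_ C
  | n + 1 => tpow X n ⊗ X

/-- The morphism `f^{⊗ n}`. -/
def tpowMap {X Y : C} (f : X ⟶ Y) : ∀ n : ℕ, tpow X n ⟶ tpow Y n
  | 0 => 𝟙 (𝟙_ C)
  | n + 1 => tpowMap f n ⊗ₘ f

/-- The adjacent transpositions acting on `X^{⊗ n}`: `adjSwap X n i` is the braiding of the two
tensor factors with `i` factors to their right (and the identity if there are no such factors). -/
def adjSwap [SymmetricCategory C] (X : C) : ∀ n : ℕ, ℕ → (tpow X n ⟶ tpow X n)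
  | 0, _ => 𝟙 _
  | 1, _ => 𝟙 _
  | n + 2, 0 => (α_ (tpow X n) X X).hom ≫ tpow X n ◁ (β_ X X).hom ≫ (α_ (tpow X n) X X).inv
  | n + 2, i + 1 => adjSwap X (n + 1) i ▷ X

variable [SymmetricCategory C]

lemma swap_natural {P Q X Y : C} (p : P ⟶ Q) (f : X ⟶ Y) :
    ((α_ P X X).hom ≫ P ◁ (β_ X X).hom ≫ (α_ P X X).inv) ≫ ((p ⊗ₘ f) ⊗ₘ f) =
      ((p ⊗ₘ f) ⊗ₘ f) ≫ (α_ Q Y Y).hom ≫ Q ◁ (β_ Y Y).hom ≫ (α_ Q Y Y).inv := by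
  have h : P ◁ (β_ X X).hom ≫ (p ⊗ₘ (f ⊗ₘ f)) = (p ⊗ₘ (f ⊗ₘ f)) ≫ Q ◁ (β_ Y Y).hom := by
    rw [← id_tensorHom, ← id_tensorHom, tensorHom_comp_tensorHom, tensorHom_comp_tensorHom,
      BraidedCategory.braiding_naturality, Category.id_comp, Category.comp_id]
  rw [associator_naturality_assoc, Category.assoc, Category.assoc,
    ← associator_inv_naturality, reassoc_of% h]

lemma whisker_natural {P Q X Y : C} (p : P ⟶ Q) (f : X ⟶ Y) (s : P ⟶ P) (t : Q ⟶ Q)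
    (h : s ≫ p = p ≫ t) : (s ▷ X) ≫ (p ⊗ₘ f) = (p ⊗ₘ f) ≫ (t ▷ Y) := by
  rw [← tensorHom_id, ← tensorHom_id, tensorHom_comp_tensorHom, tensorHom_comp_tensorHom, h,
    Category.id_comp, Category.comp_id]

lemma adjSwap_naturality {X Y : C} (f : X ⟶ Y) (n i : ℕ) :
    adjSwap X n i ≫ tpowMap f n = tpowMap f n ≫ adjSwap Y n i := by
  induction n generalizing i with
  | zero => simp [adjSwap]
  | succ n ih =>
    cases n with
    | zero => simp [adjSwap]
    | succ n =>
      cases i with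
      | zero => exact swap_natural (tpowMap f n) f
      | succ i => exact whisker_natural (tpowMap f (n + 1)) f _ _ (ih i)

/-- The tensor powers of the unit object are the unit object. -/
def tpowUnitIso : ∀ n : ℕ, tpow (𝟙_ C) n ≅ 𝟙_ C
  | 0 => Iso.refl _
  | n + 1 => ρ_ (tpow (𝟙_ C) n) ≪≫ tpowUnitIso n

lemma adjSwap_unit (n i : ℕ) : adjSwap (𝟙_ C) n i = 𝟙 _ := by
  have h : (β_ (𝟙_ C) (𝟙_ C)).hom = 𝟙 _ := by
    rw [braiding_tensorUnit_left, unitors_equal, Iso.hom_inv_id]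
  induction n generalizing i with
  | zero => simp [adjSwap]
  | succ n ih =>
    cases n with
    | zero => simp [adjSwap]
    | succ n =>
      cases i with
      | zero => simp [adjSwap, h, tpow]
      | succ i => simp [adjSwap, ih, tpow]

variable [Abelian C]

/-- The symmetric power `Sym^n X`: the coinvariants of the symmetric group on `X^{⊗ n}`, that is,
the quotient by the images of `s - 1` for the adjacent transpositions `s`. -/
def symPow (X : C) (n : ℕ) : C :=
  cokernel (Sigma.desc fun i : Fin n => adjSwap X n i - 𝟙 (tpow X n))

/-- The quotient map `X^{⊗ n} ⟶ Sym^n X`. -/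
def symProj (X : C) (n : ℕ) : tpow X n ⟶ symPow X n :=
  cokernel.π _

/-- The morphism `f^n : Sym^n X ⟶ Sym^n Y` induced by `f : X ⟶ Y`. -/
def symMap {X Y : C} (f : X ⟶ Y) (n : ℕ) : symPow X n ⟶ symPow Y n :=
  cokernel.desc _ (tpowMap f n ≫ symProj Y n) (by
    apply Sigma.hom_ext
    intro i
    have h : (adjSwap Y n i - 𝟙 (tpow Y n)) ≫ symProj Y n = 0 := by
      have h := (Sigma.ι _ i) ≫= cokernel.condition
        (Sigma.desc fun i : Fin n => adjSwap Y n i - 𝟙 (tpow Y n))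
      rwa [Sigma.ι_desc_assoc, comp_zero] at h
    have h' : (adjSwap X n i - 𝟙 (tpow X n)) ≫ tpowMap f n =
        tpowMap f n ≫ (adjSwap Y n i - 𝟙 (tpow Y n)) := by
      rw [Preadditive.sub_comp, Preadditive.comp_sub, adjSwap_naturality, Category.id_comp,
        Category.comp_id]
    rw [Sigma.ι_desc_assoc, comp_zero, reassoc_of% h', h, comp_zero])

/-- The canonical isomorphism `Sym^n 𝟙 ≅ 𝟙`. -/
def symUnitIso (n : ℕ) : symPow (𝟙_ C) n ≅ 𝟙_ C :=
  cokernelIsoOfEq (g := 0) (by ext i; simp [adjSwap_unit]) ≪≫ cokernelZeroIsoTarget ≪≫ tpowUnitIso n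

/-- For `α : 𝟙 ⟶ X`, the morphism `α^n : 𝟙 = Sym^n 𝟙 ⟶ Sym^n X`. -/
def powFromUnit {X : C} (α : 𝟙_ C ⟶ X) (n : ℕ) : 𝟙_ C ⟶ symPow X n :=
  (symUnitIso n).inv ≫ symMap α n

/-- For `β : X ⟶ 𝟙`, the morphism `β^n : Sym^n X ⟶ Sym^n 𝟙 = 𝟙`. -/
def powToUnit {X : C} (β : X ⟶ 𝟙_ C) (n : ℕ) : symPow X n ⟶ 𝟙_ C :=
  symMap β n ≫ (symUnitIso n).hom

variable (C)

/-- Condition (GR), geometric reductivity: for every non-zero `β : X ⟶ 𝟙` there is `n > 0` such that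
`β^n : Sym^n X ⟶ 𝟙` is split. -/
def IsGR : Prop :=
  ∀ (X : C) (β : X ⟶ 𝟙_ C), β ≠ 0 → ∃ n : ℕ, 0 < n ∧ IsSplitEpi (powToUnit β n)

/-- Condition (MN1): for every simple `L` not isomorphic to `𝟙`, the algebra `Sym L` is finite, that
is, `Sym^n L = 0` for some `n`. -/
def IsMN1 : Prop :=
  ∀ L : C, Simple L → IsEmpty (L ≅ 𝟙_ C) → ∃ n : ℕ, IsZero (symPow L n)

/-- Condition (MN2): for every non-split monomorphism `α : 𝟙 ⟶ X` there is `n` such that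
`α^n : 𝟙 ⟶ Sym^n X` is zero. -/
def IsMN2 : Prop :=
  ∀ (X : C) (α : 𝟙_ C ⟶ X), Mono α → ¬ IsSplitMono α → ∃ n : ℕ, powFromUnit α n = 0

/-- Maximal nilpotency: (MN1) and (MN2). -/
def IsMN : Prop := IsMN1 C ∧ IsMN2 C

end SymmetricPowers

section Ideals
variable {E : Type u} [Category.{v} E] [Abelian E] [MonoidalCategory E] [SymmetricCategory E]

open scoped MonObj

lemma factors_iff_comp_cokernel {X Y : E} (P : Subobject X) (f : Y ⟶ X) :
    P.Factors f ↔ f ≫ cokernel.π P.arrow = 0 := by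
  constructor
  · intro h
    rw [← P.factorThru_arrow f h, Category.assoc, cokernel.condition, comp_zero]
  · intro h
    rw [← Abelian.monoLift_comp P.arrow f h]
    exact Subobject.factors_comp_arrow _

lemma factors_of_epi {X Y Z : E} (P : Subobject X) (e : Z ⟶ Y) [Epi e] (f : Y ⟶ X)
    (h : P.Factors (e ≫ f)) : P.Factors f := by
  rw [factors_iff_comp_cokernel] at h ⊢
  rw [← cancel_epi e, comp_zero, ← Category.assoc, h]

/-- The morphism in `E` underlying a morphism of algebras. -/
def und {A B : CommMon E} (f : A ⟶ B) : A.X ⟶ B.X := f.hom.hom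

lemma und_one {A B : CommMon E} (f : A ⟶ B) : η ≫ und f = η :=
  IsMonHom.one_hom f.hom.hom

lemma und_mul {A B : CommMon E} (f : A ⟶ B) : μ ≫ und f = (und f ⊗ₘ und f) ≫ μ :=
  IsMonHom.mul_hom f.hom.hom

/-- An ideal of a commutative algebra `A`: a subobject `I` of `A` with `A I ⊆ I`. -/
@[ext]
structure AlgIdeal (A : CommMon E) where
  carrier : Subobject A.X
  mul_mem : carrier.Factors (A.X ◁ carrier.arrow ≫ μ)

namespace AlgIdeal
variable {A B : CommMon E}

lemma factors_mul (I : AlgIdeal A) {X Y : E} (x : X ⟶ A.X) (y : Y ⟶ A.X)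
    (h : I.carrier.Factors y) : I.carrier.Factors ((x ⊗ₘ y) ≫ μ) := by
  have e : (x ⊗ₘ y) ≫ μ = (x ⊗ₘ I.carrier.factorThru y h) ≫ (A.X ◁ I.carrier.arrow ≫ μ) := by
    rw [← id_tensorHom, tensorHom_comp_tensorHom_assoc, Category.comp_id,
      Subobject.factorThru_arrow]
  rw [e]
  exact Subobject.factors_of_factors_right _ I.mul_mem

/-- The preimage of an ideal under an algebra morphism. -/
def comap (f : A ⟶ B) (J : AlgIdeal B) : AlgIdeal A where
  carrier := (Subobject.pullback (und f)).obj J.carrier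
  mul_mem := by
    rw [pullback_factors_iff, Category.assoc, und_mul, ← id_tensorHom,
      tensorHom_comp_tensorHom_assoc]
    apply factors_mul
    rw [← pullback_factors_iff]
    exact Subobject.factors_self _

lemma comap_factors_iff (f : A ⟶ B) (J : AlgIdeal B) {X : E} (x : X ⟶ A.X) :
    (J.comap f).carrier.Factors x ↔ J.carrier.Factors (x ≫ und f) :=
  pullback_factors_iff _ _ _

end AlgIdeal

lemma AlgIdeal.eq_top_of_one {A : CommMon E} (I : AlgIdeal A)
    (h : I.carrier.Factors (η : 𝟙_ E ⟶ A.X)) : I.carrier = ⊤ := by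
  have h2 := I.factors_mul (𝟙 A.X) _ h
  rw [id_tensorHom, MonObj.mul_one] at h2
  rw [← Subobject.isIso_arrow_iff_eq_top]
  have : IsSplitEpi I.carrier.arrow := ⟨⟨⟨(ρ_ A.X).inv ≫ I.carrier.factorThru _ h2, by
    rw [Category.assoc, Subobject.factorThru_arrow, Iso.inv_hom_id]⟩⟩⟩
  exact isIso_of_mono_of_isSplitEpi _

/-! ### Quotients by ideals -/

section Quotient
variable [MonoidalPreadditive E] [∀ X : E, PreservesFiniteColimits (tensorLeft X)]

instance (X : E) : PreservesFiniteColimits (tensorRight X) :=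
  preservesFiniteColimits_of_natIso (BraidedCategory.tensorLeftIsoTensorRight X)

instance epi_whiskerLeft' (X : E) {Y Z : E} (f : Y ⟶ Z) [Epi f] : Epi (X ◁ f) :=
  inferInstanceAs (Epi ((tensorLeft X).map f))

instance epi_whiskerRight' (X : E) {Y Z : E} (f : Y ⟶ Z) [Epi f] : Epi (f ▷ X) :=
  inferInstanceAs (Epi ((tensorRight X).map f))

instance epi_tensorHom' {X X' Y Z : E} (g : X ⟶ X') (f : Y ⟶ Z) [Epi g] [Epi f] :
    Epi (g ⊗ₘ f) := by
  rw [MonoidalCategory.tensorHom_def]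
  infer_instance

/-- A morphism out of `T Y` which vanishes on `T X` descends to `T (Y / X)` for right exact `T`. -/
def descThrough (T : E ⥤ E) [PreservesFiniteColimits T] [T.Additive] {X Y Z : E} (f : X ⟶ Y)
    (g : T.obj Y ⟶ Z) (h : T.map f ≫ g = 0) : T.obj (cokernel f) ⟶ Z :=
  (PreservesCokernel.iso T f).hom ≫ cokernel.desc (T.map f) g h

lemma map_π_descThrough (T : E ⥤ E) [PreservesFiniteColimits T] [T.Additive] {X Y Z : E}
    (f : X ⟶ Y) (g : T.obj Y ⟶ Z) (h : T.map f ≫ g = 0) :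
    T.map (cokernel.π f) ≫ descThrough T f g h = g := by
  rw [descThrough, PreservesCokernel.π_iso_hom_assoc, cokernel.π_desc]

variable {A : CommMon E} (I : AlgIdeal A)

namespace AlgIdeal

/-- The underlying object of `A / I`. -/
def quotObj : E := cokernel I.carrier.arrow

/-- The projection `A ⟶ A / I`. -/
def proj : A.X ⟶ I.quotObj := cokernel.π I.carrier.arrow

instance : Epi I.proj := inferInstanceAs (Epi (cokernel.π _))

/-- The action `A ⊗ A / I ⟶ A / I`. -/
def quotAct : A.X ⊗ I.quotObj ⟶ I.quotObj :=
  descThrough (tensorLeft A.X) I.carrier.arrow (μ ≫ I.proj) (by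
    have h := (factors_iff_comp_cokernel _ _).1 I.mul_mem
    rwa [Category.assoc] at h)

lemma proj_quotAct : A.X ◁ I.proj ≫ I.quotAct = μ ≫ I.proj :=
  map_π_descThrough (tensorLeft A.X) _ _ _

/-- The multiplication of `A / I`. -/
def quotMul : I.quotObj ⊗ I.quotObj ⟶ I.quotObj :=
  descThrough (tensorRight I.quotObj) I.carrier.arrow I.quotAct (by
    have e : Epi ((I.carrier : E) ◁ I.proj) := epi_whiskerLeft' _ _
    rw [← cancel_epi ((I.carrier : E) ◁ I.proj), comp_zero]
    change (I.carrier : E) ◁ I.proj ≫ I.carrier.arrow ▷ I.quotObj ≫ I.quotAct = 0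
    have h := (factors_iff_comp_cokernel _ _).1 I.mul_mem
    rw [whisker_exchange_assoc, proj_quotAct]
    have h2 : I.carrier.arrow ▷ A.X ≫ μ =
        (β_ _ _).hom ≫ A.X ◁ I.carrier.arrow ≫ μ := by
      rw [← BraidedCategory.braiding_naturality_left_assoc, IsCommMonObj.mul_comm]
    rw [reassoc_of% h2]
    rw [Category.assoc] at h
    change (β_ _ _).hom ≫ A.X ◁ I.carrier.arrow ≫ μ ≫ cokernel.π _ = 0
    rw [h, comp_zero])

lemma proj_quotMul : (I.proj ⊗ₘ I.proj) ≫ I.quotMul = μ ≫ I.proj := by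
  have h : I.proj ▷ I.quotObj ≫ I.quotMul = I.quotAct :=
    map_π_descThrough (tensorRight I.quotObj) _ _ _
  rw [tensorHom_def', Category.assoc, h, proj_quotAct]

instance : MonObj I.quotObj where
  one := η ≫ I.proj
  mul := I.quotMul
  one_mul := by
    have h : 𝟙_ E ◁ I.proj ≫ (η ≫ I.proj) ▷ I.quotObj = η ▷ A.X ≫ (I.proj ⊗ₘ I.proj) := by
      rw [← id_tensorHom, ← tensorHom_id, ← tensorHom_id, tensorHom_comp_tensorHom,
        tensorHom_comp_tensorHom, Category.id_comp, Category.id_comp, Category.comp_id]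
    rw [← cancel_epi (𝟙_ E ◁ I.proj), reassoc_of% h, proj_quotMul, MonObj.one_mul_assoc,
      leftUnitor_naturality]
  mul_one := by
    have h : I.proj ▷ 𝟙_ E ≫ I.quotObj ◁ (η ≫ I.proj) = A.X ◁ η ≫ (I.proj ⊗ₘ I.proj) := by
      rw [← id_tensorHom, ← tensorHom_id, ← id_tensorHom, tensorHom_comp_tensorHom,
        tensorHom_comp_tensorHom, Category.id_comp, Category.id_comp, Category.comp_id]
    rw [← cancel_epi (I.proj ▷ 𝟙_ E), reassoc_of% h, proj_quotMul, MonObj.mul_one_assoc,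
      rightUnitor_naturality]
  mul_assoc := by
    have h1 : ((I.proj ⊗ₘ I.proj) ⊗ₘ I.proj) ≫ I.quotMul ▷ I.quotObj =
        μ ▷ A.X ≫ (I.proj ⊗ₘ I.proj) := by
      rw [← tensorHom_id, ← tensorHom_id, tensorHom_comp_tensorHom, tensorHom_comp_tensorHom,
        proj_quotMul, Category.id_comp, Category.comp_id]
    have h2 : (I.proj ⊗ₘ (I.proj ⊗ₘ I.proj)) ≫ I.quotObj ◁ I.quotMul =
        A.X ◁ μ ≫ (I.proj ⊗ₘ I.proj) := by
      rw [← id_tensorHom, ← id_tensorHom, tensorHom_comp_tensorHom, tensorHom_comp_tensorHom,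
        proj_quotMul, Category.id_comp, Category.comp_id]
    rw [← cancel_epi ((I.proj ⊗ₘ I.proj) ⊗ₘ I.proj), reassoc_of% h1, proj_quotMul,
      associator_naturality_assoc, reassoc_of% h2, proj_quotMul, MonObj.mul_assoc_assoc]

instance : IsCommMonObj I.quotObj where
  mul_comm := by
    rw [← cancel_epi (I.proj ⊗ₘ I.proj)]
    change _ ≫ _ ≫ I.quotMul = _ ≫ I.quotMul
    rw [BraidedCategory.braiding_naturality_assoc, proj_quotMul, IsCommMonObj.mul_comm_assoc]

/-- The quotient algebra `A / I`. -/
def quot : CommMon E := ⟨I.quotObj⟩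

/-- The projection `A ⟶ A / I` as a morphism of algebras. -/
def toQuot : A ⟶ I.quot :=
  CommMon.homMk
    { hom := I.proj
      isMonHom_hom := { one_hom := rfl, mul_hom := I.proj_quotMul.symm } }

end AlgIdeal
end Quotient

/-! ### Invariants -/

section Invariants
variable [MonoidalPreadditive E]

/-- The commutative ring `A^0 = Hom(𝟙, A)`. -/
def H0 (A : CommMon E) : Type v := 𝟙_ E ⟶ A.X

namespace H0
variable (A B : CommMon E)

instance : AddCommGroup (H0 A) := inferInstanceAs (AddCommGroup (𝟙_ E ⟶ A.X))

/-- The product of `a` and `b` in `A^0`. -/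
def mul (a b : 𝟙_ E ⟶ A.X) : 𝟙_ E ⟶ A.X := (λ_ (𝟙_ E)).inv ≫ (a ⊗ₘ b) ≫ μ

lemma mul_comm' (a b : 𝟙_ E ⟶ A.X) : mul A a b = mul A b a := by
  have h : (β_ (𝟙_ E) (𝟙_ E)).hom = 𝟙 _ := by
    rw [braiding_tensorUnit_left, unitors_equal, Iso.hom_inv_id]
  have h2 := BraidedCategory.braiding_naturality_assoc b a (μ : A.X ⊗ A.X ⟶ A.X)
  rw [IsCommMonObj.mul_comm, h, Category.id_comp] at h2
  rw [mul, mul, h2]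

lemma one_mul' (a : 𝟙_ E ⟶ A.X) : mul A η a = a := by
  rw [mul, tensorHom_def'_assoc, MonObj.one_mul, leftUnitor_naturality, Iso.inv_hom_id_assoc]

lemma mul_assoc' (a b c : 𝟙_ E ⟶ A.X) : mul A (mul A a b) c = mul A a (mul A b c) := by
  have h1 : mul A (mul A a b) c = (λ_ (𝟙_ E)).inv ≫ (λ_ (𝟙_ E)).inv ▷ 𝟙_ E ≫
      ((a ⊗ₘ b) ⊗ₘ c) ≫ μ ▷ A.X ≫ μ := by
    rw [mul, mul, ← tensorHom_id, ← tensorHom_id, tensorHom_comp_tensorHom_assoc,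
      tensorHom_comp_tensorHom_assoc, Category.comp_id, Category.id_comp, Category.assoc]
  have h2 : mul A a (mul A b c) = (λ_ (𝟙_ E)).inv ≫ 𝟙_ E ◁ (λ_ (𝟙_ E)).inv ≫
      (a ⊗ₘ (b ⊗ₘ c)) ≫ A.X ◁ μ ≫ μ := by
    rw [mul, mul, ← id_tensorHom, ← id_tensorHom, tensorHom_comp_tensorHom_assoc,
      tensorHom_comp_tensorHom_assoc, Category.comp_id, Category.id_comp, Category.assoc]
  rw [h1, h2, MonObj.mul_assoc, associator_naturality_assoc]
  have h3 : (λ_ (𝟙_ E)).inv ▷ 𝟙_ E ≫ (α_ _ _ _).hom = 𝟙_ E ◁ (λ_ (𝟙_ E)).inv := by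
    monoidal
  rw [reassoc_of% h3]

lemma zero_mul' (a : 𝟙_ E ⟶ A.X) : mul A 0 a = 0 := by
  simp [mul]

lemma add_mul' (a b c : 𝟙_ E ⟶ A.X) : mul A (a + b) c = mul A a c + mul A b c := by
  simp [mul, MonoidalPreadditive.add_tensor]

instance : CommRing (H0 A) :=
  { (inferInstance : AddCommGroup (H0 A)) with
    mul := mul A
    one := (η : 𝟙_ E ⟶ A.X)
    mul_assoc := mul_assoc' A
    mul_comm := mul_comm' A
    one_mul := one_mul' A
    mul_one := fun a => (mul_comm' A _ _).trans (one_mul' A a)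
    zero_mul := zero_mul' A
    mul_zero := fun a => (mul_comm' A _ _).trans (zero_mul' A a)
    left_distrib := fun a b c => (mul_comm' A _ _).trans ((add_mul' A b c a).trans
      (congrArg₂ (fun x y : 𝟙_ E ⟶ A.X => x + y) (mul_comm' A _ _) (mul_comm' A _ _)))
    right_distrib := add_mul' A }

variable {A B}

lemma mul_comp {A B : CommMon E} (f : A ⟶ B) (a b : 𝟙_ E ⟶ A.X) :
    mul A a b ≫ und f = mul B (a ≫ und f) (b ≫ und f) := by
  rw [mul, mul, Category.assoc, Category.assoc, und_mul, tensorHom_comp_tensorHom_assoc]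

/-- The ring homomorphism `A^0 → B^0` induced by an algebra morphism `A ⟶ B`. -/
def map {A B : CommMon E} (f : A ⟶ B) : H0 A →+* H0 B where
  toFun a := (a : 𝟙_ E ⟶ A.X) ≫ und f
  map_one' := und_one f
  map_mul' := mul_comp f
  map_zero' := zero_comp
  map_add' _ _ := Preadditive.add_comp _ _ _ _ _ _

end H0
end Invariants

/-! ### The spectrum -/

section Spectrum
variable {C : Type*} [Category C] (inc : C ⥤ E)

/-- Prime ideals of `A`: proper ideals `P` such that for all objects `X`, `Y` of the category `C`
with `X Y ⊆ P` one has `X ⊆ P` or `Y ⊆ P`. Here `X` and `Y` come with arbitrary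
morphisms to `A`; replacing `X` and `Y` by their images in `A` does not change the condition. -/
structure AlgIdeal.IsPrime {A : CommMon E} (P : AlgIdeal A) : Prop where
  ne_top : P.carrier ≠ ⊤
  mem_or_mem {X Y : C} (x : inc.obj X ⟶ A.X) (y : inc.obj Y ⟶ A.X) :
    P.carrier.Factors ((x ⊗ₘ y) ≫ μ) → P.carrier.Factors x ∨ P.carrier.Factors y

/-- The spectrum of `A`: the set of prime ideals. -/
@[ext]
structure Spec (A : CommMon E) where
  ideal : AlgIdeal A
  isPrime : ideal.IsPrime inc

namespace Spec
variable {inc} {A B : CommMon E}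

/-- The closed set `V(J)` of prime ideals containing the ideal `J`. -/
def zeroLocus (J : AlgIdeal A) : Set (Spec inc A) := {P | J.carrier ≤ P.ideal.carrier}

/-- The Zariski topology: the closed sets are the sets `V(J)` for the ideals `J` of `A` (these are
stable under intersections and finite unions). -/
instance : TopologicalSpace (Spec inc A) :=
  TopologicalSpace.generateFrom {U | ∃ J : AlgIdeal A, U = (zeroLocus J)ᶜ}

lemma comap_isPrime (f : A ⟶ B) (P : Spec inc B) : (P.ideal.comap f).IsPrime inc where
  ne_top h := by
    apply P.isPrime.ne_top
    have h1 : (P.ideal.comap f).carrier.Factors (η : 𝟙_ E ⟶ A.X) := by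
      rw [h]
      exact Subobject.top_factors _
    rw [AlgIdeal.comap_factors_iff, und_one] at h1
    exact P.ideal.eq_top_of_one h1
  mem_or_mem x y h := by
    rw [AlgIdeal.comap_factors_iff, Category.assoc, und_mul,
      tensorHom_comp_tensorHom_assoc] at h
    rw [AlgIdeal.comap_factors_iff, AlgIdeal.comap_factors_iff]
    exact P.isPrime.mem_or_mem _ _ h

/-- The map `Spec B → Spec A` induced by an algebra morphism `A ⟶ B`. -/
def map (f : A ⟶ B) (P : Spec inc B) : Spec inc A := ⟨P.ideal.comap f, comap_isPrime f P⟩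

end Spec

section Rho
variable {inc} [MonoidalPreadditive E] [MonoidalCategory C]

/-- The prime ideal `P ∩ A^0` of `A^0`, for a prime ideal `P` of `A`. -/
def Spec.contract {A : CommMon E} (P : Spec inc A) :
    Ideal (H0 A) where
  carrier := {a | P.ideal.carrier.Factors (a : 𝟙_ E ⟶ A.X)}
  add_mem' {a b} ha hb := Subobject.factors_add (a : 𝟙_ E ⟶ A.X) b ha hb
  zero_mem' := Subobject.factors_zero
  smul_mem' a b hb :=
    Subobject.factors_of_factors_right (λ_ (𝟙_ E)).inv (P.ideal.factors_mul (a : 𝟙_ E ⟶ A.X) b hb)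

lemma Spec.unit_mem_or_mem (u : inc.obj (𝟙_ C) ≅ 𝟙_ E) {A : CommMon E} (P : Spec inc A)
    (a b : 𝟙_ E ⟶ A.X) (h : P.ideal.carrier.Factors ((λ_ (𝟙_ E)).inv ≫ (a ⊗ₘ b) ≫ μ)) :
    P.ideal.carrier.Factors a ∨ P.ideal.carrier.Factors b := by
  have h2 := factors_of_epi _ _ _ h
  have h3 := P.isPrime.mem_or_mem (u.hom ≫ a) (u.hom ≫ b) (by
    rw [← tensorHom_comp_tensorHom, Category.assoc]
    exact Subobject.factors_of_factors_right _ h2)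
  exact h3.imp (factors_of_epi _ _ _) (factors_of_epi _ _ _)

/-- The map `ρ_A : Spec A → Spec A^0`, sending `P` to `P ∩ A^0`. -/
def rho (u : inc.obj (𝟙_ C) ≅ 𝟙_ E) (A : CommMon E) (P : Spec inc A) :
    PrimeSpectrum (H0 A) where
  asIdeal := P.contract
  isPrime :=
    { ne_top' := fun h => P.isPrime.ne_top (P.ideal.eq_top_of_one ((Ideal.eq_top_iff_one _).1 h))
      mem_or_mem' := fun {a b} h => P.unit_mem_or_mem u a b h }

end Rho
end Spectrum

/-! ### The algebras `A_0` and `A^0_0` -/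

section Coinvariants
variable [WellPowered.{v} E] [HasWidePullbacks.{v} E]

/-- The intersection of the kernels of all morphisms from `X` to the unit object. -/
def tilde (X : E) : Subobject X :=
  sInf (Set.range fun f : X ⟶ 𝟙_ E => kernelSubobject f)

variable [MonoidalPreadditive E] [∀ X : E, PreservesFiniteColimits (tensorLeft X)]

/-- The ideal generated by a subobject `X` of `A`, which is the image of `A ⊗ X ⟶ A`. -/
def spanIdeal (A : CommMon E) (X : Subobject A.X) : AlgIdeal A where
  carrier := imageSubobject (A.X ◁ X.arrow ≫ μ)
  mul_mem := by
    have : Epi (factorThruImageSubobject (A.X ◁ X.arrow ≫ μ)) := inferInstance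
    refine factors_of_epi _ (A.X ◁ factorThruImageSubobject (A.X ◁ X.arrow ≫ (μ : A.X ⊗ A.X ⟶ A.X))) _ ?_
    rw [← MonoidalCategory.whiskerLeft_comp_assoc, imageSubobject_arrow_comp,
      MonoidalCategory.whiskerLeft_comp_assoc]
    have h : A.X ◁ A.X ◁ X.arrow ≫ A.X ◁ μ ≫ μ =
        ((α_ _ _ _).inv ≫ μ ▷ (X : E)) ≫ A.X ◁ X.arrow ≫ μ := by
      rw [Category.assoc, ← whisker_exchange_assoc, MonObj.mul_assoc]
      simp
    rw [h]
    apply Subobject.factors_of_factors_right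
    have h2 := Subobject.factors_comp_arrow (P := imageSubobject (A.X ◁ X.arrow ≫ μ))
      (factorThruImageSubobject (A.X ◁ X.arrow ≫ μ))
    rwa [imageSubobject_arrow_comp] at h2

/-- The ideal `R(A)` of `A` generated by `tilde A`. -/
def idealR (A : CommMon E) : AlgIdeal A := spanIdeal A (tilde A.X)

/-- The algebra `A_0 = A / R(A)`. -/
def A0 (A : CommMon E) : CommMon E := (idealR A).quot

/-- The projection `A ⟶ A_0`. -/
def toA0 (A : CommMon E) : A ⟶ A0 A := (idealR A).toQuot

/-- The ring `A^0_0`: the image of `A^0 → (A_0)^0`. -/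
def A00 (A : CommMon E) : Subring (H0 (A0 A)) := (H0.map (toA0 A)).range

/-- The surjection `A^0 → A^0_0`. -/
def toA00 (A : CommMon E) : H0 A →+* A00 A := (H0.map (toA0 A)).rangeRestrict

/-- The inclusion of `A^0_0` into `(A_0)^0`. -/
def inclA00 (A : CommMon E) : A00 A →+* H0 (A0 A) := (A00 A).subtype

end Coinvariants
end Ideals

/-! ### Pretannakian categories and algebras in their ind-completion -/

section Pretannakian
variable (k : Type w) [Field k] (C : Type u) [Category.{v} C] [Abelian C] [Linear k C]
  [MonoidalCategory C]

/-- The two conditions which make an (essentially small) `k`-linear symmetric monoidal rigid abelian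
category pretannakian: `k → End(𝟙)` is an isomorphism and every object has finite length
(that is, it is both noetherian and artinian). -/
structure IsPretannakian : Prop where
  bijective_smul_id : Function.Bijective fun a : k => a • 𝟙 (𝟙_ C)
  noetherian (X : C) : IsNoetherianObject X
  artinian (X : C) : IsArtinianObject X

end Pretannakian

section IndCategory
variable (C : Type u) [Category.{v} C] [EssentiallySmall.{v} C]

/-- The ind-completion of an essentially small category `C`. -/
abbrev IndCat : Type (v + 1) := Ind (IndTensor.Small C)

/-- The canonical functor from `C` to its ind-completion. -/
def incl : C ⥤ IndCat C := (IndTensor.toSmall C).functor ⋙ Ind.yoneda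

/-- The unit object of the ind-completion is the image of the unit object of `C`. -/
def inclUnit [MonoidalCategory C] : (incl C).obj (𝟙_ C) ≅ 𝟙_ (IndCat C) :=
  IndTensor.yonedaUnitIso (IndTensor.Small C)

variable [Abelian C] [MonoidalCategory C] [SymmetricCategory C] [MonoidalPreadditive C]
  [RigidCategory C]

/-- The category of commutative algebras in the ind-completion of `C`. -/
abbrev Alg : Type (v + 1) := CommMon (IndCat C)

variable {C}

/-- The inclusion `Spec A_0 → Spec A` induced by `A → A_0`. -/
def specA0ToSpec (A : Alg C) : Spec (incl C) (A0 A) → Spec (incl C) A :=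
  Spec.map (toA0 A)

/-- The inclusion `Spec A^0_0 → Spec A^0` induced by `A^0 → A^0_0`. -/
def specA00ToSpecH0 (A : Alg C) : PrimeSpectrum (A00 A) → PrimeSpectrum (H0 A) :=
  PrimeSpectrum.comap (toA00 A)

/-- The map `Spec A_0 → Spec A^0_0` induced by `A^0_0 → A_0`. -/
def specA0ToSpecA00 (A : Alg C) : Spec (incl C) (A0 A) → PrimeSpectrum (A00 A) :=
  PrimeSpectrum.comap (inclA00 A) ∘ rho (inclUnit C) (A0 A)

/-- The map `Spec A_0 → Spec A^0` induced by `A^0 → A_0`. -/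
def specA0ToSpecH0 (A : Alg C) : Spec (incl C) (A0 A) → PrimeSpectrum (H0 A) :=
  PrimeSpectrum.comap (H0.map (toA0 A)) ∘ rho (inclUnit C) (A0 A)

end IndCategory

end TensorAlg

end

set_option linter.unusedSectionVars false

noncomputable section

/-! ## The embedding into the ind-category is braided -/

namespace IndTensor

section
variable {D : Type v} [SmallCategory D]

/-! An element of an algebra `A` is a morphism `x : X ⟶ A` with `X` in `C`. Commutative algebra with
such elements works because objects of `C` are compact in the ind-completion, every ind-object is a
filtered colimit of them, and tensoring has a right adjoint, so that colon ideals `(P : x)` exist.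
Krull's argument then gives prime ideals avoiding any multiplicative family (`exists_prime`). In
particular `x` lies in every prime exactly when some power `x^n : X^{⊗ n} ⟶ A` vanishes. As `A` is
commutative, `x^n` factors through `Sym^n X`, and this is where (MN) and (GR) enter. For the
converses, the test algebras are the symmetric algebras of objects of `C`.

The spectrum of `A / I` is `V(I)`, so `Spec A_0 = Spec A` says that every prime `P` contains all
elements killed by every morphism `A ⟶ 𝟙`. Suppose (MN) holds and such an `x` is nonzero in the
domain `A / P`. A simple subobject of its image is not nilpotent, hence is a copy of `𝟙` by (MN1),
and by (MN2) this copy splits off from every object of `C` over `A / P` through which it factors.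
The spaces `Hom(X, 𝟙)` are finite-dimensional, so by linear compactness these splittings yield one
morphism `A / P ⟶ 𝟙` nonzero on it (`exists_comp_unit_ne_zero`), a contradiction. Conversely, a
simple `L` other than `𝟙`, or a non-split `α : 𝟙 ⟶ X`, gives a degree-one element of a symmetric
algebra killed by all morphisms to `𝟙`. If it is nilpotent, then `Sym^n L = 0`, respectively `α^n =
0`. For `A^0` the condition is that the kernel of the surjection `A^0 → A^0_0` is nil; this follows
from (MN), and testing it on degree-one elements with domain `𝟙` gives (MN2).

Under (GR), a nonzero `β : X ⟶ 𝟙` lets one replace an element `x` of `A` by an invariant: a section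
of `Sym^n β` followed by `Sym^n X ⟶ A`. If `x` agrees modulo a prime with `b ∘ β`, the new invariant
agrees with `b^n`. This shows that primes containing `R(A)` are controlled by their invariants
(`le_of_contract_le`) and that each prime of `A^0_0` is attained (`exists_prime_over`), which
together give the homeomorphism. Conversely, if no `Sym^n β` with `n > 0` splits, the two algebra
morphisms `Sym X ⟶ 𝟙` induced by `β` and by `0` have different kernels which agree on invariants, so
injectivity fails (`isGR_of_injective`). -/

/-- Morphisms from a representable ind-object are sections of the underlying presheaf. -/
def yonedaHomEquiv (X : D) (F : Ind D) :
    (Ind.yoneda.obj X ⟶ F) ≃ ((Ind.inclusion D).obj F).obj (op X) :=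
  (Ind.inclusion.fullyFaithful.homEquiv.trans
    ((Ind.yonedaCompInclusion.app X).homFromEquiv)).trans yonedaEquiv

lemma yonedaHomEquiv_comp {X : D} {F G : Ind D} (f : Ind.yoneda.obj X ⟶ F) (g : F ⟶ G) :
    yonedaHomEquiv X G (f ≫ g) =
      ((Ind.inclusion D).map g).app (op X) (yonedaHomEquiv X F f) := by
  change yonedaEquiv ((Ind.yonedaCompInclusion.app X).inv ≫ (Ind.inclusion D).map (f ≫ g)) = _
  rw [Functor.map_comp, ← Category.assoc]
  rfl

/-- Representable ind-objects corepresent evaluation. -/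
def coyonedaYonedaIso (X : D) :
    coyoneda.obj (op (Ind.yoneda.obj X)) ≅ Ind.inclusion D ⋙ (evaluation _ _).obj (op X) :=
  NatIso.ofComponents (fun F => (yonedaHomEquiv X F).toIso) (fun f => by
    ext g
    exact yonedaHomEquiv_comp g f)

instance (X : D) (J : Type v) [SmallCategory J] [IsFiltered J] :
    PreservesColimitsOfShape J (coyoneda.obj (op (Ind.yoneda.obj X))) :=
  preservesColimitsOfShape_of_natIso (coyonedaYonedaIso X).symm

lemma exists_presentation_yoneda (A : Ind D) : ∃ (J : Type v) (_ : SmallCategory J)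
    (_ : IsFiltered J) (G : J ⥤ D) (ι : G ⋙ Ind.yoneda ⟶ (Functor.const J).obj A),
    Nonempty (IsColimit (Cocone.mk A ι)) := by
  refine ⟨A.presentation.I, A.presentation.ℐ, A.presentation.hI, A.presentation.F,
    (colimit.cocone (A.presentation.F ⋙ Ind.yoneda)).ι ≫
      (Functor.const _).map (Ind.colimitPresentationCompYoneda A).hom, ⟨?_⟩⟩
  exact (colimit.isColimit _).ofIsoColimit
    (Cocone.ext (Ind.colimitPresentationCompYoneda A) (fun j => rfl))

end

/-! ### Elements of ind-objects and the monoidal structure of the embedding -/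

section
variable {D : Type v} [SmallCategory D] [MonoidalCategory D]
open LawfulDayConvolutionMonoidalCategoryStruct

attribute [local instance] convolution convolution₂ convolution₂' convolutionUnit

/-- The sections of an ind-object `F` over `X`. -/
abbrev Elt (F : Ind D) (X : D) : Type v := (indι.obj F).obj (op X)

/-- Morphisms from a representable ind-object are elements. -/
def eltEquiv (X : D) (F : Ind D) : (Ind.yoneda.obj X ⟶ F) ≃ Elt F X := yonedaHomEquiv X F

lemma eltEquiv_comp {X : D} {F G : Ind D} (f : Ind.yoneda.obj X ⟶ F) (g : F ⟶ G) :
    eltEquiv X G (f ≫ g) = (indι.map g).app (op X) (eltEquiv X F f) :=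
  yonedaHomEquiv_comp f g

lemma eltEquiv_map {X Y : D} {F : Ind D} (a : Y ⟶ X) (f : Ind.yoneda.obj X ⟶ F) :
    eltEquiv Y F (Ind.yoneda.map a ≫ f) = (indι.obj F).map a.op (eltEquiv X F f) := by
  change yonedaEquiv ((Ind.yonedaCompInclusion.app Y).inv ≫
    (Ind.inclusion D).map (Ind.yoneda.map a ≫ f)) = _
  have h : (Ind.yonedaCompInclusion.app Y).inv ≫ (Ind.inclusion D).map (Ind.yoneda.map a) =
      yoneda.map a ≫ (Ind.yonedaCompInclusion.app X).inv :=
    (Ind.yonedaCompInclusion.inv.naturality a).symm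
  rw [Functor.map_comp, ← Category.assoc, h, Category.assoc]
  exact (yonedaEquiv_naturality _ _).symm

/-- The external product of elements. -/
def box {F G : Ind D} {X Y : D} (x : Elt F X) (y : Elt G Y) : Elt (F ⊗ G) (X ⊗ Y) :=
  (convolutionExtensionUnit Dᵒᵖ (Type v) F G).app (op X, op Y) (x, y)

lemma map_box {F G F' G' : Ind D} {X Y : D} (f : F ⟶ F') (g : G ⟶ G') (x : Elt F X) (y : Elt G Y) :
    (indι.map (f ⊗ₘ g)).app (op (X ⊗ Y)) (box x y) =
      box ((indι.map f).app _ x) ((indι.map g).app _ y) :=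
  congr($(convolutionExtensionUnit_comp_ι_map_tensorHom_app Dᵒᵖ (Type v) f g (op X) (op Y)) (x, y))

lemma box_map {F G : Ind D} {X Y X' Y' : D} (a : X' ⟶ X) (b : Y' ⟶ Y) (x : Elt F X) (y : Elt G Y) :
    (indι.obj (F ⊗ G)).map (a ⊗ₘ b).op (box x y) =
      box ((indι.obj F).map a.op x) ((indι.obj G).map b.op y) :=
  (ext_nat (convolutionExtensionUnit Dᵒᵖ (Type v) F G) a.op b.op x y).symm

lemma assoc_box {F G H : Ind D} {X Y Z : D} (x : Elt F X) (y : Elt G Y) (z : Elt H Z) :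
    (indι.map (α_ F G H).hom).app (op ((X ⊗ Y) ⊗ Z)) (box (box x y) z) =
      (indι.obj (F ⊗ G ⊗ H)).map (α_ X Y Z).hom.op (box x (box y z)) :=
  congr($(LawfulDayConvolutionMonoidalCategoryStruct.associator_hom_unit_unit (C := Dᵒᵖ)
    (Type v) F G H (op X) (op Y) (op Z)) ((x, y), z))

/-- The unit element. -/
def eltOne : Elt (𝟙_ (Ind D)) (𝟙_ D) := unitUnit Dᵒᵖ (Type v) (Ind D) PUnit.unit

lemma leftUnitor_box {F : Ind D} {X : D} (x : Elt F X) :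
    (indι.map (λ_ F).hom).app (op (𝟙_ D ⊗ X)) (box eltOne x) =
      (indι.obj F).map (λ_ X).hom.op x :=
  congr($(LawfulDayConvolutionMonoidalCategoryStruct.leftUnitor_hom_unit_app (C := Dᵒᵖ)
    (Type v) F (op X)) (PUnit.unit, x))

lemma rightUnitor_box {F : Ind D} {X : D} (x : Elt F X) :
    (indι.map (ρ_ F).hom).app (op (X ⊗ 𝟙_ D)) (box x eltOne) =
      (indι.obj F).map (ρ_ X).hom.op x :=
  congr($(LawfulDayConvolutionMonoidalCategoryStruct.rightUnitor_hom_unit_app (C := Dᵒᵖ)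
    (Type v) F (op X)) (x, PUnit.unit))

/-- The comparison morphism from a representable to the tensor product of representables. -/
def yonedaδ (X Y : D) : Ind.yoneda.obj (X ⊗ Y) ⟶ Ind.yoneda.obj X ⊗ Ind.yoneda.obj Y :=
  (eltEquiv _ _).symm (box (eltEquiv X _ (𝟙 _)) (eltEquiv Y _ (𝟙 _)))

lemma eltEquiv_yonedaδ (X Y : D) :
    eltEquiv _ _ (yonedaδ X Y) = box (eltEquiv X _ (𝟙 _)) (eltEquiv Y _ (𝟙 _)) :=
  Equiv.apply_symm_apply _ _

lemma eltEquiv_yonedaδ_comp {X Y : D} {F G : Ind D} (f : Ind.yoneda.obj X ⟶ F)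
    (g : Ind.yoneda.obj Y ⟶ G) :
    eltEquiv _ _ (yonedaδ X Y ≫ (f ⊗ₘ g)) = box (eltEquiv X _ f) (eltEquiv Y _ g) := by
  rw [eltEquiv_comp, eltEquiv_yonedaδ, map_box, ← eltEquiv_comp, ← eltEquiv_comp,
    Category.id_comp, Category.id_comp]

lemma yonedaδ_natural {X Y X' Y' : D} (f : X ⟶ X') (g : Y ⟶ Y') :
    yonedaδ X Y ≫ (Ind.yoneda.map f ⊗ₘ Ind.yoneda.map g) =
      Ind.yoneda.map (f ⊗ₘ g) ≫ yonedaδ X' Y' := by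
  apply (eltEquiv _ _).injective
  rw [eltEquiv_yonedaδ_comp, eltEquiv_map, eltEquiv_yonedaδ, box_map, ← eltEquiv_map,
    ← eltEquiv_map, Category.comp_id, Category.comp_id]

/-- The oplax monoidal structure of the embedding into the ind-category. -/
@[reducible]
def yonedaOplax : (Ind.yoneda (C := D)).OplaxMonoidal where
  η := (eltEquiv _ _).symm eltOne
  δ := yonedaδ
  δ_natural_left f X' := by
    have := yonedaδ_natural f (𝟙 X')
    rwa [CategoryTheory.Functor.map_id, tensorHom_id, tensorHom_id] at this
  δ_natural_right X' f := by
    have := yonedaδ_natural (𝟙 X') f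
    rwa [CategoryTheory.Functor.map_id, id_tensorHom, id_tensorHom] at this
  oplax_associativity X Y Z := by
    apply (eltEquiv _ _).injective
    rw [← Category.assoc, ← tensorHom_id, ← id_tensorHom, eltEquiv_comp, eltEquiv_yonedaδ_comp,
      eltEquiv_yonedaδ, assoc_box, eltEquiv_map, eltEquiv_yonedaδ_comp, eltEquiv_yonedaδ]
  oplax_left_unitality X := by
    rw [← cancel_epi (Ind.yoneda.map (λ_ X).hom), ← cancel_mono (λ_ (Ind.yoneda.obj X)).hom]
    apply (eltEquiv _ _).injective
    rw [Category.assoc, Iso.inv_hom_id, eltEquiv_map, ← Functor.map_comp_assoc, Iso.hom_inv_id,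
      CategoryTheory.Functor.map_id, Category.id_comp, eltEquiv_comp, ← tensorHom_id,
      eltEquiv_yonedaδ_comp, Equiv.apply_symm_apply, leftUnitor_box]
  oplax_right_unitality X := by
    rw [← cancel_epi (Ind.yoneda.map (ρ_ X).hom), ← cancel_mono (ρ_ (Ind.yoneda.obj X)).hom]
    apply (eltEquiv _ _).injective
    rw [Category.assoc, Iso.inv_hom_id, eltEquiv_map, ← Functor.map_comp_assoc, Iso.hom_inv_id,
      CategoryTheory.Functor.map_id, Category.id_comp, eltEquiv_comp, ← id_tensorHom,
      eltEquiv_yonedaδ_comp, Equiv.apply_symm_apply, rightUnitor_box]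

lemma eltEquiv_yonedaUnitIso_hom :
    eltEquiv _ _ (yonedaUnitIso D).hom = eltOne := by
  have : (indι.obj (𝟙_ (Ind D))).IsLeftKanExtension
      (DayConvolutionUnit.φ (indι.obj (𝟙_ (Ind D)))) :=
    (DayConvolutionUnit.isPointwiseLeftKanExtensionCan
      (F := indι.obj (𝟙_ (Ind D)))).isLeftKanExtension
  have h := Functor.descOfIsLeftKanExtension_fac_app _ (repOne D) (indι.obj (𝟙_ (Ind D)))
      (DayConvolutionUnit.φ (indι.obj (𝟙_ (Ind D)))) ⟨⟨⟩⟩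
  have h2 : (Ind.yonedaCompInclusion.app (𝟙_ D)).inv ≫ (Ind.inclusion D).map (yonedaUnitIso D).hom =
      Functor.descOfIsLeftKanExtension _ (repOne D) (indι.obj (𝟙_ (Ind D)))
      (DayConvolutionUnit.φ (indι.obj (𝟙_ (Ind D)))) := by
    rw [Iso.inv_comp_eq]
    exact (Ind.inclusion.fullyFaithful (C := D)).map_preimage _
  change yonedaEquiv ((Ind.yonedaCompInclusion.app (𝟙_ D)).inv ≫
    (Ind.inclusion D).map (yonedaUnitIso D).hom) = _
  rw [h2]
  exact congr($h PUnit.unit)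

-- Both this counit and `yonedaUnitIso` correspond to the unit element `eltOne`.
attribute [local instance] yonedaOplax in
instance : IsIso (Functor.OplaxMonoidal.η (Ind.yoneda (C := D))) := by
  have : Functor.OplaxMonoidal.η (Ind.yoneda (C := D)) = (yonedaUnitIso D).hom := by
    apply (eltEquiv _ _).injective
    rw [eltEquiv_yonedaUnitIso_hom]
    exact Equiv.apply_symm_apply _ _
  rw [this]
  infer_instance

/-- By the universal property of Day convolution, a morphism out of `F ⊗ G` is a natural
transformation out of the external product, so its values on boxes determine it. -/
lemma tensor_hom_ext {F G H : Ind D} {φ ψ : F ⊗ G ⟶ H}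
    (h : ∀ (X Y : D) (x : Elt F X) (y : Elt G Y), (indι.map φ).app (op (X ⊗ Y)) (box x y) =
      (indι.map ψ).app (op (X ⊗ Y)) (box x y)) : φ = ψ := by
  apply indι.map_injective
  apply (DayConvolution.corepresentableBy (indι.obj F) (indι.obj G)).homEquiv.injective
  refine NatTrans.ext (funext fun ⟨P, Q⟩ => ?_)
  ext ⟨x, y⟩
  exact h P.unop Q.unop x y

lemma elt_yoneda_eq {X P : D} (x : Elt (Ind.yoneda.obj X) P) :
    ∃ f : P ⟶ X, x = (indι.obj (Ind.yoneda.obj X)).map f.op (eltEquiv X _ (𝟙 _)) := by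
  obtain ⟨g, rfl⟩ := (eltEquiv _ _).surjective x
  obtain ⟨f, rfl⟩ := Ind.yoneda.map_surjective g
  exact ⟨f, by rw [← eltEquiv_map, Category.comp_id]⟩

/-- Every box over two representables is a restriction of the box of the universal elements, to
which `yonedaδ` corresponds. -/
instance (X Y : D) : Epi (yonedaδ X Y) where
  left_cancellation {Z} φ ψ h := by
    apply tensor_hom_ext
    intro P Q x y
    obtain ⟨f, rfl⟩ := elt_yoneda_eq x
    obtain ⟨g, rfl⟩ := elt_yoneda_eq y
    have h2 := congrArg (eltEquiv _ _) h
    rw [eltEquiv_comp, eltEquiv_comp, eltEquiv_yonedaδ] at h2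
    rw [← box_map]
    have n1 := congr($((indι.map φ).naturality (f ⊗ₘ g).op)
      (box (eltEquiv X _ (𝟙 _)) (eltEquiv Y _ (𝟙 _))))
    have n2 := congr($((indι.map ψ).naturality (f ⊗ₘ g).op)
      (box (eltEquiv X _ (𝟙 _)) (eltEquiv Y _ (𝟙 _))))
    exact n1.trans ((congrArg _ h2).trans n2.symm)

/-- The assignment `(p, q) ↦ p ⊗ₘ q` on hom-presheaves induces, by Day convolution, a retraction; it
sends the box of the identities to the identity. -/
instance (X Y : D) : IsSplitMono (yonedaδ X Y) := by
  let α : indι.obj (Ind.yoneda.obj X) ⊠ indι.obj (Ind.yoneda.obj Y) ⟶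
      tensor Dᵒᵖ ⋙ indι.obj (Ind.yoneda.obj (X ⊗ Y)) :=
    (externalProductBifunctor Dᵒᵖ Dᵒᵖ (Type v)).map
      (Prod.mkHom (Ind.yonedaCompInclusion.hom.app X) (Ind.yonedaCompInclusion.hom.app Y)) ≫
      repUnit X Y ≫ Functor.whiskerLeft (tensor Dᵒᵖ) (Ind.yonedaCompInclusion.inv.app (X ⊗ Y))
  let r := (Functor.FullyFaithful.ofFullyFaithful indι).preimage
    ((DayConvolution.corepresentableBy (indι.obj (Ind.yoneda.obj X))
      (indι.obj (Ind.yoneda.obj Y))).homEquiv.symm α)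
  refine ⟨⟨⟨r, ?_⟩⟩⟩
  apply (eltEquiv _ _).injective
  have h1 : (DayConvolution.corepresentableBy (indι.obj (Ind.yoneda.obj X))
      (indι.obj (Ind.yoneda.obj Y))).homEquiv (indι.map r) = α := by
    rw [Functor.FullyFaithful.map_preimage, Equiv.apply_symm_apply]
  have h2 := congr(($h1).app (op X, op Y) (eltEquiv X _ (𝟙 _), eltEquiv Y _ (𝟙 _)))
  rw [eltEquiv_comp, eltEquiv_yonedaδ]
  refine h2.trans ?_
  have h3 (Z : D) : (Ind.yonedaCompInclusion.hom.app Z).app (op Z) (eltEquiv Z _ (𝟙 _)) = 𝟙 Z := by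
    change (Ind.yonedaCompInclusion.hom.app Z).app (op Z)
      (yonedaEquiv ((Ind.yonedaCompInclusion.app Z).inv ≫ (Ind.inclusion D).map (𝟙 _))) = 𝟙 Z
    rw [CategoryTheory.Functor.map_id]
    exact congr(($((Ind.yonedaCompInclusion.app Z).inv_hom_id)).app (op Z) (𝟙 Z))
  have h4 (Z : D) : eltEquiv Z _ (𝟙 _) = (Ind.yonedaCompInclusion.inv.app Z).app (op Z) (𝟙 Z) := by
    change (yonedaEquiv ((Ind.yonedaCompInclusion.app Z).inv ≫ (Ind.inclusion D).map (𝟙 _))) = _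
    rw [CategoryTheory.Functor.map_id]
    rfl
  rw [h4 (X ⊗ Y)]
  change (Ind.yonedaCompInclusion.inv.app (X ⊗ Y)).app (op (X ⊗ Y))
    ((Ind.yonedaCompInclusion.hom.app X).app (op X) (eltEquiv X _ (𝟙 _)) ⊗ₘ
    (Ind.yonedaCompInclusion.hom.app Y).app (op Y) (eltEquiv Y _ (𝟙 _))) = _
  rw [h3, h3, id_tensorHom_id]

instance (X Y : D) : IsIso (yonedaδ X Y) := isIso_of_epi_of_isSplitMono _

attribute [local instance] yonedaOplax in
instance : (Ind.yoneda (C := D)).Monoidal :=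
  have (X Y : D) : IsIso (Functor.OplaxMonoidal.δ (Ind.yoneda (C := D)) X Y) :=
    inferInstanceAs (IsIso (yonedaδ X Y))
  .ofOplaxMonoidal _

end

/-! ### Compatibility of the embedding with the braidings -/

section
variable {D : Type v} [SmallCategory D] [MonoidalCategory D] [SymmetricCategory D]
open LawfulDayConvolutionMonoidalCategoryStruct

attribute [local instance] convolution convolution₂ convolution₂' convolutionUnit

lemma braiding_box {F G : Ind D} {X Y : D} (x : Elt F X) (y : Elt G Y) :
    (indι.map (β_ F G).hom).app (op (X ⊗ Y)) (box x y) =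
      (indι.obj (G ⊗ F)).map (β_ X Y).hom.op (box y x) := by
  have h := DayConvolution.unit_app_braiding_hom_app (indι.obj F) (indι.obj G) (op X) (op Y)
  rw [← indι_map_indBraiding] at h
  have h2 := congr($h (x, y))
  exact h2

instance : (Ind.yoneda (C := D)).Braided where
  braided X Y := by
    have h : Ind.yoneda.map (β_ X Y).hom ≫ yonedaδ Y X =
        yonedaδ X Y ≫ (β_ (Ind.yoneda.obj X) (Ind.yoneda.obj Y)).hom := by
      apply (eltEquiv _ _).injective
      rw [eltEquiv_map, eltEquiv_comp, eltEquiv_yonedaδ, eltEquiv_yonedaδ, braiding_box]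
    rw [← cancel_epi (Functor.OplaxMonoidal.δ (Ind.yoneda (C := D)) X Y),
      ← cancel_mono (Functor.OplaxMonoidal.δ (Ind.yoneda (C := D)) Y X)]
    simp only [Functor.Monoidal.δ_μ_assoc, Category.assoc, Functor.Monoidal.μ_δ, Category.comp_id]
    exact h

end

end IndTensor

/-! ### The properties of the inclusion of `C` in its ind-completion on which the arguments rely -/

namespace TensorAlg

/-- The properties of the embedding of a category in its ind-completion. -/
class IndEmbedding {C : Type u} [Category.{v} C] {E : Type w} [Category.{v} E] (inc : C ⥤ E) :
    Prop where
  exists_presentation (A : E) : ∃ (J : Type v) (_ : SmallCategory J)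
    (_ : IsFiltered J) (G : J ⥤ C) (ι : G ⋙ inc ⟶ (Functor.const J).obj A),
    Nonempty (IsColimit (Cocone.mk A ι))
  compact (inc) (Z : C) (J : Type v) [SmallCategory J] [IsFiltered J] :
    PreservesColimitsOfShape J (coyoneda.obj (op (inc.obj Z)))

section
variable (C : Type u) [Category.{v} C] [EssentiallySmall.{v} C]

instance : (incl C).Full := inferInstanceAs ((IndTensor.toSmall C).functor ⋙ Ind.yoneda).Full

instance : (incl C).Faithful :=
  inferInstanceAs ((IndTensor.toSmall C).functor ⋙ Ind.yoneda).Faithful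

instance : IndEmbedding (incl C) where
  exists_presentation A := by
    obtain ⟨J, _, _, G, ι, ⟨h⟩⟩ := IndTensor.exists_presentation_yoneda A
    let e : (G ⋙ (IndTensor.toSmall C).inverse) ⋙ incl C ≅ G ⋙ Ind.yoneda :=
      Functor.isoWhiskerRight (Functor.isoWhiskerLeft G (IndTensor.toSmall C).counitIso) Ind.yoneda
    exact ⟨J, inferInstance, inferInstance, G ⋙ (IndTensor.toSmall C).inverse, e.hom ≫ ι,
      ⟨(IsColimit.precomposeHomEquiv e _).symm h⟩⟩
  compact Z J _ _ := inferInstanceAs (PreservesColimitsOfShape J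
    (coyoneda.obj (op (Ind.yoneda.obj ((IndTensor.toSmall C).functor.obj Z)))))

instance [HasFiniteColimits C] : PreservesFiniteColimits (incl C) :=
  comp_preservesFiniteColimits (IndTensor.toSmall C).functor Ind.yoneda

instance [Abelian C] : (incl C).Additive := by
  have h0 : (incl C).PreservesZeroMorphisms := Functor.preservesZeroMorphisms_of_map_zero_object
    ((IsInitial.isInitialObj (incl C) _ (isZero_zero _).isInitial).uniqueUpToIso
      (isZero_zero _).isInitial)
  have := preservesBinaryBiproducts_of_preservesBinaryCoproducts (incl C)
  exact Functor.additive_of_preservesBinaryBiproducts _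

instance [MonoidalCategory C] [SymmetricCategory C] : (incl C).Braided :=
  inferInstanceAs
    ((Monoidal.equivalenceTransported (equivSmallModel.{v} C)).functor ⋙ Ind.yoneda).Braided

end

end TensorAlg

namespace TensorAlg

open scoped MonObj

/-! ## Powers of generalized elements of algebras -/

section Pow
variable {E : Type u} [Category.{v} E] [MonoidalCategory E] [SymmetricCategory E]
  {A B : CommMon E}

/-- The `n`-th power of a generalized element of a commutative algebra. -/
def pow {X : E} (x : X ⟶ A.X) : ∀ n : ℕ, tpow X n ⟶ A.X
  | 0 => η
  | n + 1 => (pow x n ⊗ₘ x) ≫ μ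

lemma pow_succ' {X : E} (x : X ⟶ A.X) (n : ℕ) : pow x (n + 1) = (pow x n ⊗ₘ x) ≫ μ := rfl

lemma pow_comp {X Y : E} (f : Y ⟶ X) (x : X ⟶ A.X) (n : ℕ) :
    pow (f ≫ x) n = tpowMap f n ≫ pow x n := by
  induction n with
  | zero => exact (Category.id_comp _).symm
  | succ n ih =>
    rw [pow_succ', pow_succ', ih, ← tensorHom_comp_tensorHom, Category.assoc]
    rfl

lemma mul_mul_eq {M : E} [MonObj M] {X Y Z : E} (x : X ⟶ M) (y : Y ⟶ M) (z : Z ⟶ M) :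
    ((x ⊗ₘ y) ≫ μ ⊗ₘ z) ≫ μ = (α_ X Y Z).hom ≫ (x ⊗ₘ (y ⊗ₘ z) ≫ μ) ≫ μ := by
  have h1 : ((x ⊗ₘ y) ≫ μ ⊗ₘ z) = ((x ⊗ₘ y) ⊗ₘ z) ≫ μ ▷ M := by
    rw [← tensorHom_id, tensorHom_comp_tensorHom, Category.comp_id]
  have h2 : (x ⊗ₘ (y ⊗ₘ z) ≫ μ) = (x ⊗ₘ (y ⊗ₘ z)) ≫ M ◁ μ := by
    rw [← id_tensorHom, tensorHom_comp_tensorHom, Category.comp_id]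
  rw [h1, h2, Category.assoc, MonObj.mul_assoc, associator_naturality_assoc, Category.assoc]

lemma braid_mul {X Y : E} (x : X ⟶ A.X) (y : Y ⟶ A.X) :
    (β_ X Y).hom ≫ (y ⊗ₘ x) ≫ μ = (x ⊗ₘ y) ≫ μ := by
  rw [← BraidedCategory.braiding_naturality_assoc, IsCommMonObj.mul_comm]

/-- The swap of the last two factors is absorbed by commutativity after reassociation; the other
swaps act on a lower power. Hence powers factor through symmetric powers. -/
lemma adjSwap_pow {X : E} (x : X ⟶ A.X) (n i : ℕ) : adjSwap X n i ≫ pow x n = pow x n := by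
  induction n generalizing i with
  | zero => exact Category.id_comp _
  | succ n ih =>
    cases n with
    | zero => exact Category.id_comp _
    | succ n =>
      cases i with
      | zero =>
        change ((α_ (tpow X n) X X).hom ≫ tpow X n ◁ (β_ X X).hom ≫ (α_ (tpow X n) X X).inv) ≫
          ((pow x n ⊗ₘ x) ≫ μ ⊗ₘ x) ≫ μ = ((pow x n ⊗ₘ x) ≫ μ ⊗ₘ x) ≫ μ
        rw [mul_mul_eq, Category.assoc, Category.assoc, Iso.inv_hom_id_assoc, ← id_tensorHom,
          tensorHom_comp_tensorHom_assoc, Category.id_comp, braid_mul]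
      | succ i =>
        change (adjSwap X (n + 1) i ▷ X) ≫ (pow x (n + 1) ⊗ₘ x) ≫ μ = (pow x (n + 1) ⊗ₘ x) ≫ μ
        rw [← tensorHom_id, tensorHom_comp_tensorHom_assoc, ih, Category.id_comp]

lemma tpowMap_comp {X Y Z : E} (f : X ⟶ Y) (g : Y ⟶ Z) (n : ℕ) :
    tpowMap (f ≫ g) n = tpowMap f n ≫ tpowMap g n := by
  induction n with
  | zero => exact (Category.id_comp _).symm
  | succ n ih =>
    change tpowMap (f ≫ g) n ⊗ₘ (f ≫ g) = (tpowMap f n ⊗ₘ f) ≫ (tpowMap g n ⊗ₘ g)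
    rw [ih, tensorHom_comp_tensorHom]

end Pow

section PowAbelian
variable {E : Type u} [Category.{v} E] [Abelian E] [MonoidalCategory E] [SymmetricCategory E]
  {A B : CommMon E}

lemma pow_und {X : E} (x : X ⟶ A.X) (f : A ⟶ B) (n : ℕ) : pow (x ≫ und f) n = pow x n ≫ und f := by
  induction n with
  | zero => exact (und_one f).symm
  | succ n ih =>
    change (pow (x ≫ und f) n ⊗ₘ x ≫ und f) ≫ μ = ((pow x n ⊗ₘ x) ≫ μ) ≫ und f
    rw [ih, Category.assoc, und_mul, tensorHom_comp_tensorHom_assoc]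

lemma adjSwap_symProj (X : E) (n : ℕ) (i : Fin n) :
    adjSwap X n i ≫ symProj X n = symProj X n := by
  have h := (Sigma.ι _ i) ≫= cokernel.condition
    (Sigma.desc fun i : Fin n => adjSwap X n i - 𝟙 (tpow X n))
  rw [Sigma.ι_desc_assoc, comp_zero, Preadditive.sub_comp, Category.id_comp, sub_eq_zero] at h
  exact h

instance (X : E) (n : ℕ) : Epi (symProj X n) := inferInstanceAs (Epi (cokernel.π _))

/-- Invariant morphisms descend to the symmetric power. -/
def symDesc {X Y : E} {n : ℕ} (f : tpow X n ⟶ Y) (h : ∀ i : Fin n, adjSwap X n i ≫ f = f) :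
    symPow X n ⟶ Y :=
  cokernel.desc _ f (by
    apply Sigma.hom_ext
    intro i
    rw [Sigma.ι_desc_assoc, comp_zero, Preadditive.sub_comp, Category.id_comp, h, sub_self])

@[simp]
lemma symProj_symDesc {X Y : E} {n : ℕ} (f : tpow X n ⟶ Y)
    (h : ∀ i : Fin n, adjSwap X n i ≫ f = f) : symProj X n ≫ symDesc f h = f :=
  cokernel.π_desc _ _ _

lemma symProj_symMap {X Y : E} (f : X ⟶ Y) (n : ℕ) :
    symProj X n ≫ symMap f n = tpowMap f n ≫ symProj Y n :=
  cokernel.π_desc _ _ _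

lemma symProj_symUnitIso (n : ℕ) :
    symProj (𝟙_ E) n ≫ (symUnitIso n).hom = (tpowUnitIso n).hom := by
  have h0 : (Limits.Sigma.desc fun i : Fin n => adjSwap (𝟙_ E) n i - 𝟙 (tpow (𝟙_ E) n)) = 0 := by
    ext i
    simp [adjSwap_unit]
  change cokernel.π (Limits.Sigma.desc fun i : Fin n => adjSwap (𝟙_ E) n i - 𝟙 (tpow (𝟙_ E) n)) ≫
    (cokernelIsoOfEq h0).hom ≫ cokernelZeroIsoTarget.hom ≫ (tpowUnitIso n).hom = _
  rw [π_comp_cokernelIsoOfEq_hom_assoc]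
  simp

section
variable [MonoidalPreadditive E]

lemma H0_mul_def (a b : H0 A) : a * b = (λ_ (𝟙_ E)).inv ≫ ((a : 𝟙_ E ⟶ A.X) ⊗ₘ b) ≫ μ := rfl

/-- Needed to identify nilpotence of a generalized element with domain the unit with nilpotence in
the ring `A^0`. -/
lemma tpowUnitIso_inv_pow (a : H0 A) (n : ℕ) :
    (tpowUnitIso n).inv ≫ pow (a : 𝟙_ E ⟶ A.X) n = (a ^ n : H0 A) := by
  induction n with
  | zero =>
    rw [pow_zero]
    exact Category.id_comp _
  | succ n ih =>
    rw [pow_succ, H0_mul_def, ← ih]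
    have key (a : 𝟙_ E ⟶ A.X) : ((tpowUnitIso n).inv ≫ (ρ_ (tpow (𝟙_ E) n)).inv) ≫
        (pow a n ⊗ₘ a) ≫ μ = (λ_ (𝟙_ E)).inv ≫ ((tpowUnitIso n).inv ≫ pow a n ⊗ₘ a) ≫ μ := by
      have h : ((tpowUnitIso n).inv ≫ pow a n ⊗ₘ a) =
          (tpowUnitIso n).inv ▷ 𝟙_ E ≫ (pow a n ⊗ₘ a) := by
        rw [← tensorHom_id, tensorHom_comp_tensorHom, Category.id_comp]
      rw [h, unitors_inv_equal, Category.assoc, Category.assoc, rightUnitor_inv_naturality_assoc]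
    exact key a

end
end PowAbelian

/-! ## Colon ideals -/

section Colon
variable {E : Type u} [Category.{v} E] [Abelian E] [MonoidalCategory E] [SymmetricCategory E]
  [MonoidalPreadditive E] [∀ X : E, (tensorLeft X).IsLeftAdjoint]
  {A : CommMon E}

/-- The largest subobject `U` of `A` with `x U ⊆ P`. -/
def colonSubobject (P : Subobject A.X) {X : E} (x : X ⟶ A.X) : Subobject A.X :=
  kernelSubobject ((Adjunction.ofIsLeftAdjoint (tensorLeft X)).homEquiv _ _
    (x ▷ A.X ≫ μ ≫ cokernel.π P.arrow))

/-- Under the tensor-hom adjunction, vanishing of `x y` modulo `P` becomes vanishing of `y` followed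
by the transpose of multiplication by `x`. -/
lemma colonSubobject_factors_iff (P : Subobject A.X) {X Y : E} (x : X ⟶ A.X) (y : Y ⟶ A.X) :
    (colonSubobject P x).Factors y ↔ P.Factors ((x ⊗ₘ y) ≫ μ) := by
  rw [colonSubobject, kernelSubobject_factors_iff, factors_iff_comp_cokernel,
    ← Adjunction.homEquiv_naturality_left]
  have : (tensorLeft X).map y ≫ x ▷ A.X ≫ μ ≫ cokernel.π P.arrow =
    ((x ⊗ₘ y) ≫ μ) ≫ cokernel.π P.arrow := by
    rw [tensorHom_def', Category.assoc, Category.assoc]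
    rfl
  rw [this, Adjunction.homEquiv_unit]
  constructor
  · intro h
    rw [← Adjunction.homEquiv_unit] at h
    apply ((Adjunction.ofIsLeftAdjoint (tensorLeft X)).homEquiv _ _).injective
    rw [h, Adjunction.homEquiv_unit, Functor.map_zero, comp_zero]
  · intro h
    rw [h, Functor.map_zero, comp_zero]

/-- The colon ideal `(P : x)`. -/
def AlgIdeal.colon (P : AlgIdeal A) {X : E} (x : X ⟶ A.X) : AlgIdeal A where
  carrier := colonSubobject P.carrier x
  mul_mem := by
    rw [colonSubobject_factors_iff]
    set u := (colonSubobject P.carrier x).arrow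
    have hu : P.carrier.Factors ((x ⊗ₘ u) ≫ μ) :=
      (colonSubobject_factors_iff _ _ _).1 (Subobject.factors_self _)
    -- `x (a u) = a (x u)` up to exchanging the domains of `x` and `a`, and the right-hand side lies
    -- in the ideal `P`.
    have h := Subobject.factors_of_factors_right
      ((α_ _ _ _).inv ≫ (β_ _ _).hom ▷ _ ≫ (α_ _ _ _).hom) (P.factors_mul (𝟙 A.X) _ hu)
    convert h using 1
    have e1 : (x ⊗ₘ (A.X ◁ u ≫ μ)) ≫ μ = (α_ _ _ _).inv ≫ ((x ⊗ₘ 𝟙 A.X) ≫ μ ⊗ₘ u) ≫ μ := by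
      rw [mul_mul_eq, id_tensorHom, Iso.inv_hom_id_assoc]
    rw [e1, ← braid_mul x (𝟙 A.X), Category.assoc, Category.assoc, ← mul_mul_eq,
      ← tensorHom_id, tensorHom_comp_tensorHom_assoc, Category.id_comp]

lemma AlgIdeal.colon_factors_iff (P : AlgIdeal A) {X Y : E} (x : X ⟶ A.X) (y : Y ⟶ A.X) :
    (P.colon x).carrier.Factors y ↔ P.carrier.Factors ((x ⊗ₘ y) ≫ μ) :=
  colonSubobject_factors_iff _ _ _

lemma AlgIdeal.factors_mul_comm (P : AlgIdeal A) {X Y : E} (x : X ⟶ A.X) (y : Y ⟶ A.X) :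
    P.carrier.Factors ((x ⊗ₘ y) ≫ μ) ↔ P.carrier.Factors ((y ⊗ₘ x) ≫ μ) := by
  constructor
  · intro h
    rw [← braid_mul]
    exact Subobject.factors_of_factors_right _ h
  · intro h
    rw [← braid_mul]
    exact Subobject.factors_of_factors_right _ h

lemma AlgIdeal.le_colon (P : AlgIdeal A) {X : E} (x : X ⟶ A.X) :
    P.carrier ≤ (P.colon x).carrier := by
  apply Subobject.le_of_factors
  rw [colon_factors_iff]
  exact P.factors_mul _ _ (Subobject.factors_self _)

end Colon

/-! ## Elements of objects of the ind-category -/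

section Elements
variable {C : Type u} [Category.{v} C] {E : Type w} [Category.{v} E] (inc : C ⥤ E)
  [IndEmbedding inc]

lemma exists_factor_of_isColimit {J : Type v} [SmallCategory J] [IsFiltered J] {K : J ⥤ E}
    {c : Cocone K} (hc : IsColimit c) {Z : C} (f : inc.obj Z ⟶ c.pt) :
    ∃ (j : J) (g : inc.obj Z ⟶ K.obj j), g ≫ c.ι.app j = f := by
  have := IndEmbedding.compact inc Z J
  exact Types.jointly_surjective_of_isColimit
    (isColimitOfPreserves (coyoneda.obj (op (inc.obj Z))) hc) f

lemma hom_ext_elements {A B : E} {f g : A ⟶ B}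
    (h : ∀ (Z : C) (z : inc.obj Z ⟶ A), z ≫ f = z ≫ g) : f = g := by
  obtain ⟨J, _, _, G, κ, ⟨hc⟩⟩ := IndEmbedding.exists_presentation (inc := inc) A
  exact hc.hom_ext fun j => h _ _

variable [Abelian E]

lemma le_of_elements [MonoidalCategory E] [SymmetricCategory E] {A : E} {P Q : Subobject A}
    (h : ∀ (Z : C) (z : inc.obj Z ⟶ A), P.Factors z → Q.Factors z) : P ≤ Q := by
  apply Subobject.le_of_factors
  rw [factors_iff_comp_cokernel]
  apply hom_ext_elements inc
  intro Z z
  rw [comp_zero, ← Category.assoc, ← factors_iff_comp_cokernel]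
  exact h _ _ (Subobject.factors_comp_arrow _)

/-- The pullback of `e` along `x` is a filtered colimit of objects of `C`. Their images in `X` are
directed, so one is largest because `X` is noetherian; it is all of `X` because the pullback maps
onto `inc.obj X`. -/
lemma exists_lift_of_epi [Abelian C] [inc.Full] [inc.Faithful] [inc.PreservesZeroMorphisms]
    (hN : ∀ X : C, IsNoetherianObject X)
    {A B : E} (e : B ⟶ A) [Epi e] {X : C} (x : inc.obj X ⟶ A) :
    ∃ (X' : C) (p : X' ⟶ X) (x' : inc.obj X' ⟶ B), Epi p ∧ x' ≫ e = inc.map p ≫ x := by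
  obtain ⟨J, _, _, G, κ, ⟨hc⟩⟩ := IndEmbedding.exists_presentation (inc := inc) (pullback e x)
  have := hN X
  choose q hq using fun j => inc.map_surjective (κ.app j ≫ pullback.snd e x)
  obtain ⟨j, hj⟩ : ∃ j, ∀ j', imageSubobject (q j') ≤ imageSubobject (q j) := by
    have hne : (Set.range fun j => imageSubobject (q j)).Nonempty :=
      let ⟨j⟩ := IsFiltered.nonempty (C := J)
      ⟨_, j, rfl⟩
    obtain ⟨_, ⟨j, rfl⟩, hmax⟩ := WellFounded.has_min
      (wellFounded_gt (α := Subobject X)) _ hne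
    refine ⟨j, fun j' => ?_⟩
    have hle {i i' : J} (a : i ⟶ i') : imageSubobject (q i) ≤ imageSubobject (q i') := by
      have : q i = G.map a ≫ q i' := by
        apply inc.map_injective
        rw [Functor.map_comp, hq, hq, ← Category.assoc]
        exact congrArg (· ≫ _) ((κ.naturality a).trans (Category.comp_id _)).symm
      rw [this]
      exact imageSubobject_comp_le _ _
    have h1 := hle (IsFiltered.leftToMax j j')
    have h2 := hle (IsFiltered.rightToMax j j')
    have h3 : imageSubobject (q j) = imageSubobject (q (IsFiltered.max j j')) := by
      by_contra hne
      exact hmax _ ⟨_, rfl⟩ (lt_of_le_of_ne h1 hne)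
    rwa [← h3] at h2
  -- The projection of the pullback is epi and each stage of the presentation lands in the image of
  -- `q j`.
  have hz : inc.map (cokernel.π (q j)) = 0 := by
    rw [← cancel_epi (pullback.snd e x), comp_zero]
    refine hc.hom_ext fun j' => ?_
    change κ.app j' ≫ _ ≫ _ = κ.app j' ≫ 0
    rw [← Category.assoc, ← hq, ← Functor.map_comp, comp_zero, ← inc.map_zero]
    congr 1
    have h4 := Subobject.factors_of_le (q j') (hj j') (by
      have := imageSubobject_factors_comp_self (f := q j') (𝟙 _)
      rwa [Category.id_comp] at this)
    have h5 : (imageSubobject (q j)).arrow ≫ cokernel.π (q j) = 0 := by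
      rw [← cancel_epi (factorThruImageSubobject (q j)), imageSubobject_arrow_comp_assoc,
        cokernel.condition, comp_zero]
    rw [← Subobject.factorThru_arrow _ _ h4, Category.assoc, h5, comp_zero]
  refine ⟨G.obj j, q j, κ.app j ≫ pullback.fst e x, ?_, ?_⟩
  · apply Abelian.epi_of_cokernel_π_eq_zero
    apply inc.map_injective
    rw [hz, inc.map_zero]
  · rw [hq, Category.assoc, Category.assoc, pullback.condition]

end Elements

/-! ## Existence of prime ideals -/

section Prime
variable {C : Type u} [Category.{v} C] {E : Type w} [Category.{v} E] (inc : C ⥤ E)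
  [IndEmbedding inc] [Abelian E] [IsGrothendieckAbelian.{v} E]

/-- In a Grothendieck abelian category a directed supremum of subobjects is their filtered colimit,
and a morphism from a compact object to that colimit factors through one stage. -/
lemma exists_factors_of_directedOn {A : E} {c : Set (Subobject A)} (hne : c.Nonempty)
    (hc : DirectedOn (· ≤ ·) c) {Z : C} (z : inc.obj Z ⟶ A) (hz : (sSup c).Factors z) :
    ∃ I ∈ c, I.Factors z := by
  have : Nonempty c := hne.to_subtype
  have : IsDirectedOrder c := ⟨fun a b =>
    let ⟨d, hd, h1, h2⟩ := hc a a.2 b b.2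
    ⟨⟨d, hd⟩, h1, h2⟩⟩
  have : IsFiltered (SmallModel.{v} c) := IsFiltered.of_equivalence (equivSmallModel c)
  let F : SmallModel.{v} c ⥤ MonoOver A :=
    (equivSmallModel c).inverse ⋙ (Subtype.mono_coe (· ∈ c)).functor ⋙ Subobject.representative
  let cc := colimit.cocone (F ⋙ MonoOver.forget _ ⋙ Over.forget _)
  let hcc : IsColimit cc := colimit.isColimit _
  let f : cc.pt ⟶ A := hcc.desc (Cocone.mk A
    { app j := (F.obj j).obj.hom
      naturality i j a := by
        exact (MonoOver.w (F.map a)).trans (Category.comp_id _).symm })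
  have hf (j) : cc.ι.app j ≫ f = (F.obj j).obj.hom := hcc.fac _ _
  have := IsGrothendieckAbelian.mono_of_isColimit_monoOver F hcc f hf
  have hs := IsGrothendieckAbelian.subobjectMk_of_isColimit_eq_iSup F hcc f hf
  have hle : sSup c ≤ Subobject.mk f := by
    rw [hs]
    refine sSup_le fun I hI => ?_
    have h1 : (⟨I, hI⟩ : c) ≤ (equivSmallModel c).inverse.obj ((equivSmallModel c).functor.obj ⟨I, hI⟩) :=
      ((equivSmallModel c).unit.app ⟨I, hI⟩).le
    refine le_trans h1 (le_trans (Subobject.mk_arrow _).ge (le_iSup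
      (fun j => Subobject.mk (F.obj j).obj.hom) ((equivSmallModel c).functor.obj ⟨I, hI⟩)))
  have hz2 := Subobject.factors_of_le z hle hz
  rw [Subobject.mk_factors_iff] at hz2
  obtain ⟨z', hz'⟩ := hz2
  obtain ⟨j, g, hg⟩ := exists_factor_of_isColimit inc hcc z'
  refine ⟨_, ((equivSmallModel c).inverse.obj j).2, ?_⟩
  have e : z = g ≫ (F.obj j).obj.hom := by
    rw [← hf j]
    exact hz'.symm.trans ((congrArg (· ≫ f) hg.symm).trans (Category.assoc _ _ _))
  rw [e]
  exact Subobject.factors_comp_arrow _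

section
variable [MonoidalCategory E] [SymmetricCategory E]
  [MonoidalPreadditive E] [∀ X : E, (tensorLeft X).IsLeftAdjoint] {A : CommMon E}

/-- The sum of a family of ideals. -/
def AlgIdeal.sum (s : Set (AlgIdeal A)) : AlgIdeal A where
  carrier := sSup (AlgIdeal.carrier '' s)
  mul_mem := by
    -- Being an ideal is the inequality `U ≤ (U : A)`, which can be tested on each term of the
    -- supremum.
    rw [← id_tensorHom, ← colonSubobject_factors_iff]
    refine Subobject.factors_of_le _ (sSup_le ?_) (Subobject.factors_self _)
    rintro _ ⟨I, hI, rfl⟩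
    apply Subobject.le_of_factors
    rw [colonSubobject_factors_iff]
    exact Subobject.factors_of_le _ (le_sSup ⟨I, hI, rfl⟩)
      (I.factors_mul _ _ (Subobject.factors_self _))

/-- A multiplicative family of generalized elements of `A`: products of members are only contained
in ideals which contain a member. -/
structure IsMultiplicative (S : Set (Σ Z : C, inc.obj Z ⟶ A.X)) : Prop where
  nonempty : S.Nonempty
  mul {z w} : z ∈ S → w ∈ S → ∃ v ∈ S, ∀ J : AlgIdeal A,
    J.carrier.Factors ((z.2 ⊗ₘ w.2) ≫ μ) → J.carrier.Factors v.2

/-- Krull's argument: an ideal maximal among those containing no member of `S` is prime. Zorn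
applies because an element with compact domain contained in the supremum of a chain lies in a member
of the chain. Maximality is recorded since lifting primes from `A^0` needs it. -/
theorem exists_prime {S : Set (Σ Z : C, inc.obj Z ⟶ A.X)} (hS : IsMultiplicative inc S)
    (I : AlgIdeal A) (hI : ∀ z ∈ S, ¬ I.carrier.Factors z.2) :
    ∃ P : Spec inc A, I.carrier ≤ P.ideal.carrier ∧ (∀ z ∈ S, ¬ P.ideal.carrier.Factors z.2) ∧
      ∀ J : AlgIdeal A, P.ideal.carrier ≤ J.carrier → (∀ z ∈ S, ¬ J.carrier.Factors z.2) →
        J.carrier ≤ P.ideal.carrier := by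
  let T : Set (Subobject A.X) :=
    {U | ∃ J : AlgIdeal A, J.carrier = U ∧ ∀ z ∈ S, ¬ J.carrier.Factors z.2}
  obtain ⟨U, hIU, hU⟩ := zorn_le_nonempty₀ T (fun c hcT hc y hy => by
    refine ⟨sSup c, ⟨AlgIdeal.sum {J | J.carrier ∈ c}, ?_, ?_⟩, fun z hz => le_sSup hz⟩
    · refine le_antisymm (sSup_le ?_) (sSup_le fun U hU => ?_)
      · rintro _ ⟨J, hJ, rfl⟩
        exact le_sSup hJ
      · obtain ⟨J, rfl, -⟩ := hcT hU
        exact le_sSup ⟨J, hU, rfl⟩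
    · intro z hz h
      have he : (AlgIdeal.carrier '' {J : AlgIdeal A | J.carrier ∈ c}) = c := by
        ext U
        refine ⟨fun ⟨J, hJ, e⟩ => e ▸ hJ, fun hU => ?_⟩
        obtain ⟨J, rfl, -⟩ := hcT hU
        exact ⟨J, hU, rfl⟩
      change (sSup (AlgIdeal.carrier '' {J : AlgIdeal A | J.carrier ∈ c})).Factors z.2 at h
      rw [he] at h
      obtain ⟨V, hV, hVz⟩ := exists_factors_of_directedOn inc ⟨y, hy⟩ hc.directedOn z.2 h
      obtain ⟨J, rfl, hJ⟩ := hcT hV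
      exact hJ z hz hVz) I.carrier ⟨I, rfl, hI⟩
  obtain ⟨P, rfl, hP⟩ := hU.prop
  have hmax (J : AlgIdeal A) (h : P.carrier ≤ J.carrier) (hJ : ∀ z ∈ S, ¬ J.carrier.Factors z.2) :
      J.carrier ≤ P.carrier := hU.le_of_ge ⟨J, rfl, hJ⟩ h
  have hex {Y : C} (y : inc.obj Y ⟶ A.X) (J : AlgIdeal A) (h : P.carrier ≤ J.carrier)
      (hJ : J.carrier.Factors y) (hy : ¬ P.carrier.Factors y) : ∃ z ∈ S, J.carrier.Factors z.2 := by
    by_contra! hc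
    exact hy (Subobject.factors_of_le _ (hmax J h hc) hJ)
  refine ⟨⟨P, ?_, ?_⟩, hIU, hP, hmax⟩
  · intro h
    obtain ⟨z, hz⟩ := hS.nonempty
    refine hP z hz ?_
    rw [h]
    exact Subobject.top_factors _
  · intro X Y x y hxy
    by_contra! hc
    -- `(P : x)` contains `y`, so it is larger than `P` and contains some `z ∈ S`. Then `(P : z)`
    -- contains `x`, so it contains some `w ∈ S`, and `z w` lies in `P`.
    obtain ⟨z, hz, hxz⟩ := hex y (P.colon x) (P.le_colon x)
      ((P.colon_factors_iff _ _).2 hxy) hc.2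
    rw [AlgIdeal.colon_factors_iff, AlgIdeal.factors_mul_comm] at hxz
    obtain ⟨w, hw, hzw⟩ := hex x (P.colon z.2) (P.le_colon _)
      ((P.colon_factors_iff _ _).2 hxz) hc.1
    rw [AlgIdeal.colon_factors_iff] at hzw
    obtain ⟨t, ht, h⟩ := hS.mul hz hw
    exact hP t ht (h P hzw)

end
end Prime

/-! ## Concatenation of tensor powers -/

section Concat
variable {E : Type u} [Category.{v} E] [MonoidalCategory E]

/-- The concatenation `X^{⊗ m} ⊗ X^{⊗ n} ≅ X^{⊗ (m + n)}`. -/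
def tpowAdd (X : E) (m : ℕ) : ∀ n : ℕ, tpow X m ⊗ tpow X n ≅ tpow X (m + n)
  | 0 => ρ_ (tpow X m)
  | n + 1 => (α_ (tpow X m) (tpow X n) X).symm ≪≫ whiskerRightIso (tpowAdd X m n) X

/-- The identification of tensor powers with equal exponents. -/
def tpowCast (X : E) {m n : ℕ} (h : m = n) : tpow X m ⟶ tpow X n := eqToHom (by rw [h])

lemma tpowCast_succ (X : E) {m n : ℕ} (h : m = n) (h' : m + 1 = n + 1) :
    (tpowCast X h' : tpow X m ⊗ X ⟶ tpow X n ⊗ X) = tpowCast X h ▷ X := by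
  subst h
  exact (id_whiskerRight _ _).symm

lemma tpowAdd_zero_left (X : E) (n : ℕ) :
    (tpowAdd X 0 n).hom = (λ_ (tpow X n)).hom ≫ tpowCast X (zero_add n).symm := by
  induction n with
  | zero =>
    change (ρ_ (𝟙_ E)).hom = (λ_ (𝟙_ E)).hom ≫ 𝟙 _
    rw [Category.comp_id, unitors_equal]
  | succ n ih =>
    -- The coherence identity for arbitrary objects; the inductive step is an instance of it after
    -- unfolding `tpow`.
    have key {P Q : E} (a : 𝟙_ E ⊗ P ⟶ Q) (c : P ⟶ Q) (h : a = (λ_ P).hom ≫ c) :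
        (α_ (𝟙_ E) P X).inv ≫ a ▷ X = (λ_ (P ⊗ X)).hom ≫ c ▷ X := by
      rw [h]
      simp
    exact (key _ _ ih).trans (congrArg ((λ_ (tpow X n ⊗ X)).hom ≫ ·)
      (tpowCast_succ X (zero_add n).symm (zero_add (n + 1)).symm).symm)

lemma tpowAdd_assoc (X : E) (m n p : ℕ) :
    (tpowAdd X m n).hom ▷ tpow X p ≫ (tpowAdd X (m + n) p).hom =
      (α_ _ _ _).hom ≫ tpow X m ◁ (tpowAdd X n p).hom ≫ (tpowAdd X m (n + p)).hom ≫
        tpowCast X (add_assoc m n p).symm := by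
  induction p with
  | zero =>
    change (tpowAdd X m n).hom ▷ 𝟙_ E ≫ (ρ_ (tpow X (m + n))).hom = (α_ _ _ _).hom ≫
      tpow X m ◁ (ρ_ (tpow X n)).hom ≫ (tpowAdd X m n).hom ≫ 𝟙 _
    rw [Category.comp_id, rightUnitor_naturality, rightUnitor_tensor_hom, Category.assoc]
  | succ p ih =>
    have key {M N P MN Q NP R : E} (j₁ : M ⊗ N ⟶ MN) (j₂ : MN ⊗ P ⟶ Q) (j₃ : N ⊗ P ⟶ NP)
        (j₄ : M ⊗ NP ⟶ R) (c : R ⟶ Q) (h : j₁ ▷ P ≫ j₂ = (α_ _ _ _).hom ≫ M ◁ j₃ ≫ j₄ ≫ c) :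
        j₁ ▷ (P ⊗ X) ≫ (α_ MN P X).inv ≫ j₂ ▷ X = (α_ M N (P ⊗ X)).hom ≫
          M ◁ ((α_ N P X).inv ≫ j₃ ▷ X) ≫ ((α_ M NP X).inv ≫ j₄ ▷ X) ≫ c ▷ X := by
      have h2 := congrArg (fun f => f ▷ X) h
      simp only [comp_whiskerRight] at h2
      have h3 : j₁ ▷ (P ⊗ X) ≫ (α_ MN P X).inv = (α_ _ _ _).inv ≫ j₁ ▷ P ▷ X := by simp
      rw [reassoc_of% h3, h2]
      simp
    refine (key _ _ _ _ _ ih).trans ?_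
    exact congrArg (fun t => (α_ (tpow X m) (tpow X n) (tpow X p ⊗ X)).hom ≫
        tpow X m ◁ ((α_ (tpow X n) (tpow X p) X).inv ≫ (tpowAdd X n p).hom ▷ X) ≫
        ((α_ (tpow X m) (tpow X (n + p)) X).inv ≫ (tpowAdd X m (n + p)).hom ▷ X) ≫ t)
      (tpowCast_succ X (add_assoc m n p).symm (add_assoc m n (p + 1)).symm).symm

variable [SymmetricCategory E]

lemma adjSwap_succ (X : E) (n i : ℕ) :
    (adjSwap X (n + 1) (i + 1) : tpow X n ⊗ X ⟶ tpow X n ⊗ X) = adjSwap X n i ▷ X := by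
  cases n with
  | zero => exact (id_whiskerRight _ _).symm
  | succ n => rfl

/-- The swap of index `i` has `i` factors to its right, so it is only nontrivial when there are at
least `i + 2` factors. -/
lemma adjSwap_eq_id (X : E) (n i : ℕ) (h : n ≤ i + 1) : adjSwap X n i = 𝟙 _ := by
  induction n generalizing i with
  | zero => rfl
  | succ n ih =>
    cases i with
    | zero =>
      obtain rfl : n = 0 := by omega
      rfl
    | succ i =>
      refine (adjSwap_succ X n i).trans ?_
      rw [ih i (by omega)]
      exact id_whiskerRight _ _

/-- Indices are counted from the right, so appending `n` factors shifts them by `n`. -/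
lemma adjSwap_tpowAdd_left (X : E) (m n i : ℕ) :
    adjSwap X m i ▷ tpow X n ≫ (tpowAdd X m n).hom =
      (tpowAdd X m n).hom ≫ adjSwap X (m + n) (i + n) := by
  induction n with
  | zero => exact rightUnitor_naturality _
  | succ n ih =>
    have key {M N K : E} (s : M ⟶ M) (j : M ⊗ N ⟶ K) (t : K ⟶ K) (h : s ▷ N ≫ j = j ≫ t) :
        s ▷ (N ⊗ X) ≫ (α_ M N X).inv ≫ j ▷ X = ((α_ M N X).inv ≫ j ▷ X) ≫ t ▷ X := by
      rw [Category.assoc, ← comp_whiskerRight, ← h]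
      simp
    exact (key _ _ _ ih).trans (congrArg
      (((α_ (tpow X m) (tpow X n) X).inv ≫ (tpowAdd X m n).hom ▷ X) ≫ ·)
      (adjSwap_succ X (m + n) (i + n)).symm)

/-- The bound excludes `i + 1 = n`, where the swap is trivial on the right block but would cross the
boundary between the blocks in the concatenation. -/
lemma adjSwap_tpowAdd_right (X : E) (m n i : ℕ) (hi : i + 1 < n) :
    tpow X m ◁ adjSwap X n i ≫ (tpowAdd X m n).hom =
      (tpowAdd X m n).hom ≫ adjSwap X (m + n) i := by
  induction n generalizing i with
  | zero => omega
  | succ n ih =>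
    cases i with
    | zero =>
      obtain ⟨n, rfl⟩ : ∃ k, n = k + 1 := ⟨n - 1, by omega⟩
      change tpow X m ◁ ((α_ (tpow X n) X X).hom ≫ tpow X n ◁ (β_ X X).hom ≫
          (α_ (tpow X n) X X).inv) ≫ (α_ (tpow X m) (tpow X n ⊗ X) X).inv ≫
          ((α_ (tpow X m) (tpow X n) X).inv ≫ (tpowAdd X m n).hom ▷ X) ▷ X =
        ((α_ (tpow X m) (tpow X n ⊗ X) X).inv ≫
          ((α_ (tpow X m) (tpow X n) X).inv ≫ (tpowAdd X m n).hom ▷ X) ▷ X) ≫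
        (α_ (tpow X (m + n)) X X).hom ≫ tpow X (m + n) ◁ (β_ X X).hom ≫
          (α_ (tpow X (m + n)) X X).inv
      have h := swap_natural (tpowAdd X m n).hom (𝟙 X)
      simp only [tensorHom_id] at h
      simp only [comp_whiskerRight, Category.assoc]
      rw [← h]
      monoidal
    | succ i =>
      have key {M N K : E} (s : N ⟶ N) (j : M ⊗ N ⟶ K) (t : K ⟶ K) (h : M ◁ s ≫ j = j ≫ t) :
          M ◁ (s ▷ X) ≫ (α_ M N X).inv ≫ j ▷ X = ((α_ M N X).inv ≫ j ▷ X) ≫ t ▷ X := by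
        rw [Category.assoc, ← comp_whiskerRight, ← h]
        simp
      refine (congrArg (fun t => tpow X m ◁ t ≫ (α_ (tpow X m) (tpow X n) X).inv ≫
        (tpowAdd X m n).hom ▷ X) (adjSwap_succ X n i)).trans ((key _ _ _ (ih i (by omega))).trans ?_)
      exact (congrArg (((α_ (tpow X m) (tpow X n) X).inv ≫ (tpowAdd X m n).hom ▷ X) ≫ ·)
        (adjSwap_succ X (m + n) i).symm)

lemma pow_add' {A : CommMon E} {X : E} (x : X ⟶ A.X) (m n : ℕ) :
    (pow x m ⊗ₘ pow x n) ≫ μ = (tpowAdd X m n).hom ≫ pow x (m + n) := by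
  induction n with
  | zero =>
    change (pow x m ⊗ₘ η) ≫ μ = (ρ_ _).hom ≫ pow x m
    rw [tensorHom_def_assoc, MonObj.mul_one, rightUnitor_naturality]
  | succ n ih =>
    change (pow x m ⊗ₘ (pow x n ⊗ₘ x) ≫ μ) ≫ μ =
      ((α_ _ _ _).inv ≫ (tpowAdd X m n).hom ▷ X) ≫ (pow x (m + n) ⊗ₘ x) ≫ μ
    rw [Category.assoc, ← tensorHom_id, tensorHom_comp_tensorHom_assoc, ← ih, Category.id_comp,
      mul_mul_eq, Iso.inv_hom_id_assoc]

end Concat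

/-! ## Braided functors and tensor powers -/

section BraidedFunctor
variable {C : Type u} [Category.{v} C] [MonoidalCategory C] [SymmetricCategory C]
  {E : Type w} [Category.{v} E] [MonoidalCategory E] [SymmetricCategory E]
  (F : C ⥤ E) [F.Braided]
open Functor.Monoidal Functor.OplaxMonoidal

/-- Monoidal functors commute with tensor powers. -/
def mapTpow (X : C) : ∀ n : ℕ, F.obj (tpow X n) ≅ tpow (F.obj X) n
  | 0 => (εIso F).symm
  | n + 1 => (μIso F _ _).symm ≪≫ whiskerRightIso (mapTpow X n) (F.obj X)

lemma mapTpow_natural {X Y : C} (f : X ⟶ Y) (n : ℕ) :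
    F.map (tpowMap f n) ≫ (mapTpow F Y n).hom = (mapTpow F X n).hom ≫ tpowMap (F.map f) n := by
  induction n with
  | zero =>
    change F.map (𝟙 (𝟙_ C)) ≫ (εIso F).inv = (εIso F).inv ≫ 𝟙 _
    rw [CategoryTheory.Functor.map_id, Category.id_comp, Category.comp_id]
  | succ n ih =>
    change F.map (tpowMap f n ⊗ₘ f) ≫ δ F _ _ ≫ (mapTpow F Y n).hom ▷ F.obj Y =
      (δ F _ _ ≫ (mapTpow F X n).hom ▷ F.obj X) ≫ (tpowMap (F.map f) n ⊗ₘ F.map f)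
    rw [← δ_natural_assoc, Category.assoc, ← tensorHom_id, ← tensorHom_id,
      tensorHom_comp_tensorHom, tensorHom_comp_tensorHom, ih, Category.comp_id, Category.id_comp]

lemma map_swap (P X : C) :
    F.map ((α_ P X X).hom ≫ P ◁ (β_ X X).hom ≫ (α_ P X X).inv) ≫ δ F (P ⊗ X) X ≫
        δ F P X ▷ F.obj X =
      (δ F (P ⊗ X) X ≫ δ F P X ▷ F.obj X) ≫
        (α_ _ _ _).hom ≫ F.obj P ◁ (β_ _ _).hom ≫ (α_ _ _ _).inv := by
  have hb : F.map (β_ X X).hom ≫ δ F X X = δ F X X ≫ (β_ _ _).hom := by simp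
  rw [Functor.map_comp, Functor.map_comp, Category.assoc, Category.assoc, ← associativity_inv,
    ← δ_natural_right_assoc, ← whiskerLeft_comp_assoc, hb, whiskerLeft_comp_assoc, Category.assoc,
    associativity_assoc]

lemma mapTpow_adjSwap (X : C) (n i : ℕ) :
    F.map (adjSwap X n i) ≫ (mapTpow F X n).hom =
      (mapTpow F X n).hom ≫ adjSwap (F.obj X) n i := by
  induction n generalizing i with
  | zero =>
    change F.map (𝟙 _) ≫ _ = _ ≫ 𝟙 _
    rw [CategoryTheory.Functor.map_id, Category.id_comp, Category.comp_id]
  | succ n ih =>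
    cases i with
    | zero =>
      cases n with
      | zero =>
        change F.map (𝟙 _) ≫ _ = _ ≫ 𝟙 _
        rw [CategoryTheory.Functor.map_id, Category.id_comp, Category.comp_id]
      | succ n =>
        change F.map ((α_ (tpow X n) X X).hom ≫ tpow X n ◁ (β_ X X).hom ≫
            (α_ (tpow X n) X X).inv) ≫ δ F _ _ ≫
            (δ F _ _ ≫ (mapTpow F X n).hom ▷ F.obj X) ▷ F.obj X =
          (δ F _ _ ≫ (δ F _ _ ≫ (mapTpow F X n).hom ▷ F.obj X) ▷ F.obj X) ≫
          (α_ (tpow (F.obj X) n) (F.obj X) (F.obj X)).hom ≫ tpow (F.obj X) n ◁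
            (β_ (F.obj X) (F.obj X)).hom ≫ (α_ (tpow (F.obj X) n) (F.obj X) (F.obj X)).inv
        have h := swap_natural (mapTpow F X n).hom (𝟙 (F.obj X))
        simp only [tensorHom_id] at h
        have h2 := map_swap F (tpow X n) X
        simp only [comp_whiskerRight, Category.assoc] at h h2 ⊢
        rw [← h, reassoc_of% h2]
    | succ i =>
      have key {P : C} {Q : E} (s : P ⟶ P) (j : F.obj P ⟶ Q) (t : Q ⟶ Q)
          (h : F.map s ≫ j = j ≫ t) : F.map (s ▷ X) ≫ δ F P X ≫ j ▷ F.obj X =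
          (δ F P X ≫ j ▷ F.obj X) ≫ t ▷ F.obj X := by
        rw [← δ_natural_left_assoc, ← comp_whiskerRight, h, comp_whiskerRight, Category.assoc]
      refine (congrArg (fun t => F.map t ≫ δ F (tpow X n) X ≫ (mapTpow F X n).hom ▷ F.obj X)
        (adjSwap_succ X n i)).trans ((key _ _ _ (ih i)).trans ?_)
      exact congrArg ((δ F (tpow X n) X ≫ (mapTpow F X n).hom ▷ F.obj X) ≫ ·)
        (adjSwap_succ (F.obj X) n i).symm

lemma mapTpow_inv_adjSwap (X : C) (n i : ℕ) :
    adjSwap (F.obj X) n i ≫ (mapTpow F X n).inv =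
      (mapTpow F X n).inv ≫ F.map (adjSwap X n i) := by
  rw [Iso.comp_inv_eq, Category.assoc, mapTpow_adjSwap, Iso.inv_hom_id_assoc]

end BraidedFunctor

/-! ### Symmetric powers under right exact braided functors -/

section BraidedFunctorAbelian
variable {C : Type u} [Category.{v} C] [Abelian C] [MonoidalCategory C] [SymmetricCategory C]
  {E : Type w} [Category.{v} E] [Abelian E] [MonoidalCategory E] [SymmetricCategory E]
  (F : C ⥤ E) [F.Braided]

/-- The comparison morphism from the symmetric power of `F X` to the image of that of `X`. -/
def symComparison (X : C) (n : ℕ) : symPow (F.obj X) n ⟶ F.obj (symPow X n) :=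
  symDesc ((mapTpow F X n).inv ≫ F.map (symProj X n)) fun i => by
    rw [← Category.assoc, mapTpow_inv_adjSwap, Category.assoc, ← Functor.map_comp,
      adjSwap_symProj]

lemma symProj_symComparison (X : C) (n : ℕ) : symProj (F.obj X) n ≫ symComparison F X n =
    (mapTpow F X n).inv ≫ F.map (symProj X n) :=
  symProj_symDesc _ _

variable [F.Additive] [PreservesFiniteColimits F]

/-- As `F` is right exact, `F (Sym^n X)` is still the quotient of `F (X^{⊗ n})` by the differences
`s - 1`, and `x^n` kills these. -/
lemma exists_powSym {A : CommMon E} {X : C} (x : F.obj X ⟶ A.X) (n : ℕ) :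
    ∃ f : F.obj (symPow X n) ⟶ A.X,
      F.map (symProj X n) ≫ f = (mapTpow F X n).hom ≫ pow x n := by
  let d := Limits.Sigma.desc fun i : Fin n => adjSwap X n i - 𝟙 (tpow X n)
  have h : F.map d ≫ (mapTpow F X n).hom ≫ pow x n = 0 := by
    refine (isColimitOfPreserves F (coproductIsCoproduct fun _ : Fin n => tpow X n)).hom_ext ?_
    rintro ⟨i⟩
    change F.map (Sigma.ι _ i) ≫ _ = F.map (Sigma.ι _ i) ≫ 0
    rw [comp_zero, ← Functor.map_comp_assoc, Sigma.ι_desc, Functor.map_sub, Preadditive.sub_comp,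
      ← Category.assoc, mapTpow_adjSwap, Category.assoc, adjSwap_pow,
      CategoryTheory.Functor.map_id, Category.id_comp, sub_self]
  refine ⟨(PreservesCokernel.iso F d).hom ≫ cokernel.desc _ _ h, ?_⟩
  exact (PreservesCokernel.π_iso_hom_assoc F d _).trans (cokernel.π_desc _ _ _)

end BraidedFunctorAbelian

/-! ## The symmetric algebra -/

section SymAlg
variable {E : Type u} [Category.{v} E] [Abelian E] [MonoidalCategory E] [SymmetricCategory E]
  [HasCoproductsOfShape ℕ E]

/-- The coproduct of the symmetric powers. -/
def symObj (V : E) : E := ∐ fun n : ℕ => symPow V n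

/-- The inclusion of a symmetric power into the symmetric algebra. -/
def symIota (V : E) (n : ℕ) : symPow V n ⟶ symObj V := Sigma.ι (fun n : ℕ => symPow V n) n

instance (V : E) (n : ℕ) : Mono (symIota V n) :=
  inferInstanceAs (Mono (Sigma.ι (fun n : ℕ => symPow V n) n))

/-- The canonical morphism from a tensor power to the symmetric algebra. -/
def symQ (V : E) (n : ℕ) : tpow V n ⟶ symObj V := symProj V n ≫ symIota V n

/-- The morphism out of the symmetric algebra given by morphisms on symmetric powers. -/
def symObjDesc {V Z : E} (g : ∀ n, symPow V n ⟶ Z) : symObj V ⟶ Z := Sigma.desc g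

lemma symIota_symObjDesc {V Z : E} (g : ∀ n, symPow V n ⟶ Z) (n : ℕ) :
    symIota V n ≫ symObjDesc g = g n := Sigma.ι_desc _ _

lemma symObj_hom_ext {V Z : E} {f g : symObj V ⟶ Z}
    (h : ∀ n, symIota V n ≫ f = symIota V n ≫ g) : f = g := Sigma.hom_ext _ _ h

lemma adjSwap_symProj' (V : E) (n i : ℕ) : adjSwap V n i ≫ symProj V n = symProj V n := by
  by_cases h : i < n
  · exact adjSwap_symProj V n ⟨i, h⟩
  · rw [adjSwap_eq_id V n i (by omega), Category.id_comp]

lemma adjSwap_symQ (V : E) (n i : ℕ) : adjSwap V n i ≫ symQ V n = symQ V n := by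
  rw [symQ, ← Category.assoc, adjSwap_symProj']

lemma tpowCast_symQ (V : E) {m n : ℕ} (h : m = n) : tpowCast V h ≫ symQ V n = symQ V m := by
  subst h
  exact Category.id_comp _

variable {V : E} (T : E ⥤ E) [T.IsLeftAdjoint] {Z : E}

/-- The morphism out of the image of the symmetric algebra under a left adjoint functor given by
invariant morphisms on the tensor powers. -/
def symHomDesc (g : ∀ n, T.obj (tpow V n) ⟶ Z) (h : ∀ n i, T.map (adjSwap V n i) ≫ g n = g n) :
    T.obj (symObj V) ⟶ Z :=
  -- Transposing to the right adjoint of `T` leaves a morphism out of the symmetric algebra itself,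
  -- a coproduct of coinvariants.
  ((Adjunction.ofIsLeftAdjoint T).homEquiv _ _).symm (symObjDesc fun n =>
    symDesc ((Adjunction.ofIsLeftAdjoint T).homEquiv _ _ (g n)) fun i => by
      rw [← Adjunction.homEquiv_naturality_left, h])

lemma map_symQ_symHomDesc (g : ∀ n, T.obj (tpow V n) ⟶ Z)
    (h : ∀ n i, T.map (adjSwap V n i) ≫ g n = g n) (n : ℕ) :
    T.map (symQ V n) ≫ symHomDesc T g h = g n := by
  rw [symHomDesc, ← Adjunction.homEquiv_naturality_left_symm, Equiv.symm_apply_eq, symQ,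
    Category.assoc, symIota_symObjDesc]
  exact symProj_symDesc _ _

lemma symHom_ext {f g : T.obj (symObj V) ⟶ Z}
    (h : ∀ n, T.map (symQ V n) ≫ f = T.map (symQ V n) ≫ g) : f = g := by
  apply ((Adjunction.ofIsLeftAdjoint T).homEquiv _ _).injective
  refine symObj_hom_ext fun n => ?_
  rw [← cancel_epi (symProj V n), ← Category.assoc, ← Category.assoc]
  change symQ V n ≫ _ = symQ V n ≫ _
  rw [← Adjunction.homEquiv_naturality_left, h, Adjunction.homEquiv_naturality_left]

variable [∀ X : E, (tensorLeft X).IsLeftAdjoint]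

instance (X : E) : (tensorRight X).IsLeftAdjoint :=
  Functor.isLeftAdjoint_of_iso (BraidedCategory.tensorLeftIsoTensorRight X)

lemma symHom_ext₂ {f g : symObj V ⊗ symObj V ⟶ Z}
    (h : ∀ m n, (symQ V m ⊗ₘ symQ V n) ≫ f = (symQ V m ⊗ₘ symQ V n) ≫ g) : f = g := by
  refine symHom_ext (tensorLeft (symObj V)) fun n => ?_
  refine symHom_ext (tensorRight (tpow V n)) fun m => ?_
  have := h m n
  rw [MonoidalCategory.tensorHom_def, Category.assoc, Category.assoc] at this
  exact this

lemma symHom_ext₃ {f g : (symObj V ⊗ symObj V) ⊗ symObj V ⟶ Z}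
    (h : ∀ m n p, ((symQ V m ⊗ₘ symQ V n) ⊗ₘ symQ V p) ≫ f =
      ((symQ V m ⊗ₘ symQ V n) ⊗ₘ symQ V p) ≫ g) : f = g := by
  refine symHom_ext (tensorLeft (symObj V ⊗ symObj V)) fun p => ?_
  refine symHom_ext (tensorLeft (symObj V) ⋙ tensorRight (tpow V p)) fun n => ?_
  refine symHom_ext (tensorRight (tpow V n) ⋙ tensorRight (tpow V p)) fun m => ?_
  have := h m n p
  rw [MonoidalCategory.tensorHom_def, MonoidalCategory.tensorHom_def (symQ V m), Category.assoc, Category.assoc, comp_whiskerRight,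
    Category.assoc, Category.assoc] at this
  exact this

/-- Multiplication of the symmetric algebra with tensor powers. -/
def symMulRight (V : E) (n : ℕ) : symObj V ⊗ tpow V n ⟶ symObj V :=
  symHomDesc (tensorRight (tpow V n)) (fun m => (tpowAdd V m n).hom ≫ symQ V (m + n))
    (fun m i => by
      change adjSwap V m i ▷ tpow V n ≫ _ = _
      rw [← Category.assoc, adjSwap_tpowAdd_left, Category.assoc, adjSwap_symQ])

lemma symQ_symMulRight (m n : ℕ) : symQ V m ▷ tpow V n ≫ symMulRight V n =
    (tpowAdd V m n).hom ≫ symQ V (m + n) :=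
  map_symQ_symHomDesc (tensorRight (tpow V n)) _ _ m

/-- The multiplication of the symmetric algebra. -/
def symMul (V : E) : symObj V ⊗ symObj V ⟶ symObj V :=
  symHomDesc (tensorLeft (symObj V)) (symMulRight V) (fun n i => by
    -- For larger `i` the swap on `n` factors is the identity, so there is nothing to move across
    -- the concatenation.
    by_cases hi : i + 1 < n
    · refine symHom_ext (tensorRight (tpow V n)) fun m => ?_
      change symQ V m ▷ tpow V n ≫ symObj V ◁ adjSwap V n i ≫ _ = symQ V m ▷ tpow V n ≫ _
      rw [← whisker_exchange_assoc, symQ_symMulRight, ← Category.assoc, adjSwap_tpowAdd_right _ _ _ _ hi,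
        Category.assoc, adjSwap_symQ]
    · rw [adjSwap_eq_id V n i (by omega), CategoryTheory.Functor.map_id, Category.id_comp])

lemma symQ_symMul (m n : ℕ) : (symQ V m ⊗ₘ symQ V n) ≫ symMul V =
    (tpowAdd V m n).hom ≫ symQ V (m + n) := by
  rw [MonoidalCategory.tensorHom_def, Category.assoc]
  have h : symObj V ◁ symQ V n ≫ symMul V = symMulRight V n :=
    map_symQ_symHomDesc (tensorLeft (symObj V)) _ _ n
  rw [h, symQ_symMulRight]

/-- The unit of the symmetric algebra. -/
def symUnit (V : E) : 𝟙_ E ⟶ symObj V := symQ V 0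

lemma symUnit_symMul (n : ℕ) : (symUnit V ⊗ₘ symQ V n) ≫ symMul V =
    (λ_ (tpow V n)).hom ≫ symQ V n := by
  have h : (tpowAdd V 0 n).hom ≫ symQ V (0 + n) = (λ_ (tpow V n)).hom ≫ symQ V n := by
    rw [tpowAdd_zero_left]
    exact (Category.assoc _ _ _).trans (congrArg ((λ_ (tpow V n)).hom ≫ ·) (tpowCast_symQ V _))
  exact (symQ_symMul 0 n).trans h

lemma symQ_symMul_symUnit (n : ℕ) : (symQ V n ⊗ₘ symUnit V) ≫ symMul V =
    (ρ_ (tpow V n)).hom ≫ symQ V n :=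
  symQ_symMul n 0

instance : MonObj (symObj V) where
  one := symUnit V
  mul := symMul V
  one_mul := by
    refine symHom_ext (tensorLeft (𝟙_ E)) fun n => ?_
    change 𝟙_ E ◁ symQ V n ≫ symUnit V ▷ symObj V ≫ symMul V = 𝟙_ E ◁ symQ V n ≫ _
    rw [← tensorHom_def'_assoc, symUnit_symMul, leftUnitor_naturality]
  mul_one := by
    refine symHom_ext (tensorRight (𝟙_ E)) fun n => ?_
    change symQ V n ▷ 𝟙_ E ≫ symObj V ◁ symUnit V ≫ symMul V = symQ V n ▷ 𝟙_ E ≫ _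
    rw [← tensorHom_def_assoc, symQ_symMul_symUnit, rightUnitor_naturality]
  mul_assoc := by
    refine symHom_ext₃ fun m n p => ?_
    have h1 : ((symQ V m ⊗ₘ symQ V n) ⊗ₘ symQ V p) ≫ symMul V ▷ symObj V =
        (tpowAdd V m n).hom ▷ tpow V p ≫ (symQ V (m + n) ⊗ₘ symQ V p) := by
      rw [← tensorHom_id, tensorHom_comp_tensorHom, symQ_symMul, ← tensorHom_id,
        tensorHom_comp_tensorHom, Category.id_comp, Category.comp_id]
    have h2 : (symQ V m ⊗ₘ (symQ V n ⊗ₘ symQ V p)) ≫ symObj V ◁ symMul V =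
        tpow V m ◁ (tpowAdd V n p).hom ≫ (symQ V m ⊗ₘ symQ V (n + p)) := by
      rw [← id_tensorHom, tensorHom_comp_tensorHom, symQ_symMul, ← id_tensorHom,
        tensorHom_comp_tensorHom, Category.id_comp, Category.comp_id]
    rw [reassoc_of% h1, symQ_symMul, associator_naturality_assoc, reassoc_of% h2, symQ_symMul,
      ← tpowCast_symQ V (add_assoc m n p).symm, ← Category.assoc, tpowAdd_assoc]
    simp only [Category.assoc]

lemma symQ_mul (m n : ℕ) : (symQ V m ⊗ₘ symQ V n) ≫ μ =
    (tpowAdd V m n).hom ≫ symQ V (m + n) := symQ_symMul m n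

/-- The canonical morphism to the symmetric algebra. -/
def symGen (V : E) : V ⟶ symObj V := (λ_ V).inv ≫ symQ V 1

/-- The symmetric algebra is generated in degree one; inductions on the degree pass through this
identity. -/
lemma symQ_mul_symGen (n : ℕ) : (symQ V n ⊗ₘ symGen V) ≫ μ = symQ V (n + 1) := by
  have key {X Z S : E} (q : X ⟶ S) (r : 𝟙_ E ⊗ V ⟶ S) (m : S ⊗ S ⟶ Z) (t : X ⊗ V ⟶ Z)
      (h : (q ⊗ₘ r) ≫ m = ((α_ X (𝟙_ E) V).inv ≫ (ρ_ X).hom ▷ V) ≫ t) :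
      (q ⊗ₘ (λ_ V).inv ≫ r) ≫ m = t := by
    have e : (q ⊗ₘ (λ_ V).inv ≫ r) = X ◁ (λ_ V).inv ≫ (q ⊗ₘ r) := by
      rw [← id_tensorHom, tensorHom_comp_tensorHom, Category.id_comp]
    rw [e, Category.assoc, h]
    simp
  exact key _ _ _ _ (symQ_mul n 1)

/-! ### Commuting elements and commutativity of the symmetric algebra -/

section
variable {M : E} [MonObj M]

/-- Two generalized elements of a monoid object commute. -/
def Commutes {X Y : E} (x : X ⟶ M) (y : Y ⟶ M) : Prop :=
  (x ⊗ₘ y) ≫ μ = (β_ X Y).hom ≫ (y ⊗ₘ x) ≫ μ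

lemma Commutes.symm {X Y : E} {x : X ⟶ M} {y : Y ⟶ M} (h : Commutes x y) : Commutes y x := by
  rw [Commutes] at h ⊢
  rw [h, SymmetricCategory.symmetry_assoc]

lemma Commutes.comp {X Y Y' : E} {x : X ⟶ M} {y : Y ⟶ M} (h : Commutes x y) (f : Y' ⟶ Y) :
    Commutes x (f ≫ y) := by
  have e : (x ⊗ₘ f ≫ y) = X ◁ f ≫ (x ⊗ₘ y) := by
    rw [← id_tensorHom, tensorHom_comp_tensorHom, Category.id_comp]
  have e' : (f ≫ y ⊗ₘ x) = f ▷ X ≫ (y ⊗ₘ x) := by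
    rw [← tensorHom_id, tensorHom_comp_tensorHom, Category.id_comp]
  rw [Commutes] at h ⊢
  rw [e, e', Category.assoc, h, Category.assoc, BraidedCategory.braiding_naturality_right_assoc]

lemma Commutes.mul {X Y Z : E} {x : X ⟶ M} {y : Y ⟶ M} {z : Z ⟶ M} (hy : Commutes x y)
    (hz : Commutes x z) : Commutes x ((y ⊗ₘ z) ≫ μ) := by
  rw [Commutes] at hy hz ⊢
  have e1 : (x ⊗ₘ (y ⊗ₘ z) ≫ μ) ≫ μ = (α_ _ _ _).inv ≫ ((x ⊗ₘ y) ≫ μ ⊗ₘ z) ≫ μ := by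
    rw [mul_mul_eq, Iso.inv_hom_id_assoc]
  have e2 : ((β_ X Y).hom ≫ (y ⊗ₘ x) ≫ μ ⊗ₘ z) = (β_ X Y).hom ▷ Z ≫ ((y ⊗ₘ x) ≫ μ ⊗ₘ z) := by
    rw [← tensorHom_id, tensorHom_comp_tensorHom, Category.id_comp]
  have e3 : (y ⊗ₘ (β_ X Z).hom ≫ (z ⊗ₘ x) ≫ μ) = Y ◁ (β_ X Z).hom ≫ (y ⊗ₘ (z ⊗ₘ x) ≫ μ) := by
    rw [← id_tensorHom, tensorHom_comp_tensorHom, Category.id_comp]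
  rw [e1, hy, e2, Category.assoc, mul_mul_eq, hz, e3, Category.assoc, mul_mul_eq,
    BraidedCategory.braiding_tensor_right_hom]
  simp

lemma Commutes.one {X : E} (x : X ⟶ M) : Commutes x (η : 𝟙_ E ⟶ M) := by
  rw [Commutes, tensorHom_def_assoc, MonObj.mul_one, tensorHom_def'_assoc, MonObj.one_mul,
    rightUnitor_naturality, leftUnitor_naturality, braiding_tensorUnit_right, Category.assoc,
    Iso.inv_hom_id_assoc]

end

/-- Up to a unitor the product of two generators is `symQ V 2`, which is invariant under the swap.
-/
lemma symGen_commutes : Commutes (symGen V) (symGen V) := by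
  have h2 := symQ_mul_symGen (V := V) 1
  have key {Z S : E} (q : 𝟙_ E ⊗ V ⟶ S) (y : V ⟶ S) (m : S ⊗ S ⟶ Z) (f : (𝟙_ E ⊗ V) ⊗ V ⟶ Z)
      (h : (q ⊗ₘ y) ≫ m = f) (hy : y = (λ_ V).inv ≫ q) (hf : ((α_ (𝟙_ E) V V).hom ≫
        𝟙_ E ◁ (β_ V V).hom ≫ (α_ (𝟙_ E) V V).inv) ≫ f = f) :
      (y ⊗ₘ y) ≫ m = (β_ V V).hom ≫ (y ⊗ₘ y) ≫ m := by
    have e : (y ⊗ₘ y) ≫ m = (λ_ V).inv ▷ V ≫ f := by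
      rw [← h]
      nth_rw 1 [hy]
      rw [← tensorHom_id, tensorHom_comp_tensorHom_assoc, Category.id_comp]
    rw [e]
    conv_lhs => rw [← hf]
    simp
  exact key _ _ _ _ h2 rfl (adjSwap_symQ V 2 0)

/-- The elements commuting with a given one are closed under products, so induction on the degree,
once in each variable, reduces to the generator. -/
lemma symQ_commutes (m n : ℕ) : Commutes (symQ V m) (symQ V n) := by
  have key {X : E} (x : X ⟶ symObj V) (h : Commutes x (symGen V)) (n : ℕ) :
      Commutes x (symQ V n) := by
    induction n with
    | zero => exact Commutes.one x
    | succ n ih =>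
      rw [← symQ_mul_symGen]
      exact ih.mul h
  exact key _ (key _ symGen_commutes m).symm n

instance : IsCommMonObj (symObj V) where
  mul_comm := by
    refine symHom_ext₂ fun m n => ?_
    rw [BraidedCategory.braiding_naturality_assoc]
    exact Eq.symm (symQ_commutes m n)

/-- The symmetric algebra. -/
def symAlg (V : E) : CommMon E := ⟨symObj V⟩

/-- The canonical morphism from a tensor power to the symmetric algebra. -/
def symAlgQ (V : E) (n : ℕ) : tpow V n ⟶ (symAlg V).X := symQ V n

/-- The inclusion of a symmetric power into the symmetric algebra. -/
def symAlgIota (V : E) (n : ℕ) : symPow V n ⟶ (symAlg V).X := symIota V n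

instance (V : E) (n : ℕ) : Mono (symAlgIota V n) := inferInstanceAs (Mono (symIota V n))

lemma symProj_symAlgIota (V : E) (n : ℕ) : symProj V n ≫ symAlgIota V n = symAlgQ V n := rfl

/-- The canonical morphism to the symmetric algebra. -/
def symAlgGen (V : E) : V ⟶ (symAlg V).X := symGen V

lemma pow_symAlgGen (n : ℕ) : pow (symAlgGen V) n = symAlgQ V n := by
  induction n with
  | zero => rfl
  | succ n ih =>
    rw [pow_succ', ih]
    exact symQ_mul_symGen n

/-! ### The universal property of the symmetric algebra -/

section Lift
variable {B : CommMon E} (y : V ⟶ B.X)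

/-- The morphism out of the symmetric algebra extending a morphism to a commutative algebra. -/
def symLiftHom : symObj V ⟶ B.X :=
  symObjDesc fun n => symDesc (pow y n) fun i => adjSwap_pow y n i

lemma symQ_symLiftHom (n : ℕ) : symQ V n ≫ symLiftHom y = pow y n := by
  rw [symQ, Category.assoc, symLiftHom, symIota_symObjDesc]
  exact symProj_symDesc _ _

/-- The morphism of algebras out of the symmetric algebra extending a morphism to a commutative
algebra. -/
def symLift : symAlg V ⟶ B :=
  CommMon.homMk
    { hom := symLiftHom y
      isMonHom_hom :=
        { one_hom := symQ_symLiftHom y 0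
          mul_hom := by
            refine symHom_ext₂ fun m n => ?_
            have h : (symQ V m ⊗ₘ symQ V n) ≫ μ ≫ symLiftHom y =
                (symQ V m ⊗ₘ symQ V n) ≫ (symLiftHom y ⊗ₘ symLiftHom y) ≫ μ := by
              rw [← Category.assoc, symQ_mul, Category.assoc, symQ_symLiftHom,
                tensorHom_comp_tensorHom_assoc, symQ_symLiftHom, symQ_symLiftHom, pow_add']
            exact h } }

lemma symAlgQ_symLift (n : ℕ) : symAlgQ V n ≫ und (symLift y) = pow y n := symQ_symLiftHom y n

lemma symAlgGen_symLift : symAlgGen V ≫ und (symLift y) = y := by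
  have key (q : 𝟙_ E ⊗ V ⟶ B.X) (h : q = (η ⊗ₘ y) ≫ μ) : (λ_ V).inv ≫ q = y := by
    rw [h, tensorHom_def'_assoc, MonObj.one_mul, leftUnitor_naturality, Iso.inv_hom_id_assoc]
  exact (Category.assoc _ _ _).trans (key _ (symAlgQ_symLift y 1))

end Lift

end SymAlg

/-! ## The unit object and morphisms to it -/

section LinearCompactness
variable {k : Type v} [Field k] {J : Type v} [SmallCategory J] [IsFiltered J]
  (V : J → Type v) [∀ j, AddCommGroup (V j)] [∀ j, Module k (V j)] [∀ j, Module.Finite k (V j)]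
  (r : ∀ {i j : J}, (i ⟶ j) → (V j →ₗ[k] V i))

/-- A cofiltered system of finite-dimensional vector spaces with a compatible family of nonzero
linear forms has a compatible family of vectors on which these do not vanish. -/
theorem exists_compatible_family (r_id : ∀ j (x : V j), r (𝟙 j) x = x)
    (r_comp : ∀ {i j l : J} (a : i ⟶ j) (b : j ⟶ l) (x : V l), r (a ≫ b) x = r a (r b x))
    (e : ∀ j, Module.Dual k (V j)) (he : ∀ {i j : J} (a : i ⟶ j) (x : V j), e i (r a x) = e j x)
    (hne : ∀ j, e j ≠ 0) :
    ∃ s : ∀ j, V j, (∀ {i j : J} (a : i ⟶ j), r a (s j) = s i) ∧ ∃ j, e j (s j) ≠ 0 := by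
  -- The filtered system of dual spaces. The forms `e j` have a common class in its colimit, which
  -- is nonzero because no `e j` vanishes.
  let F : J ⥤ ModuleCat.{v} k :=
    { obj j := ModuleCat.of k (Module.Dual k (V j))
      map a := ModuleCat.ofHom (r a).dualMap
      map_id j := by
        ext φ x
        exact congrArg (φ : V j → k) (r_id j x)
      map_comp {i j l} a b := by
        ext φ x
        exact congrArg (φ : V i → k) (r_comp a b x) }
  obtain ⟨j₀⟩ := IsFiltered.nonempty (C := J)
  have h0 : colimit.ι F j₀ (e j₀) ≠ 0 := by
    intro h
    obtain ⟨j, a, h⟩ := Concrete.colimit_rep_eq_zero.{v} k F j₀ (e j₀) h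
    refine hne j (LinearMap.ext fun x => ?_)
    rw [← he a]
    exact LinearMap.congr_fun h x
  obtain ⟨φ, hφ⟩ : ∃ φ : Module.Dual k (colimit F : ModuleCat.{v} k),
      φ (colimit.ι F j₀ (e j₀)) ≠ 0 := by
    by_contra! h
    exact h0 ((Module.forall_dual_apply_eq_zero_iff k _).1 h)
  -- By finite-dimensionality, a linear form on the colimit of the duals is a compatible family of
  -- vectors.
  let s (j : J) : V j := (Module.evalEquiv k (V j)).symm (φ.comp (colimit.ι F j).hom)
  have hs (j : J) (ψ : Module.Dual k (V j)) : ψ (s j) = φ (colimit.ι F j ψ) := by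
    have h : Module.Dual.eval k (V j) (s j) = φ.comp (colimit.ι F j).hom :=
      (Module.evalEquiv k (V j)).apply_symm_apply _
    exact LinearMap.congr_fun h ψ
  refine ⟨s, fun {i j} a => ?_, j₀, by rwa [hs]⟩
  rw [← sub_eq_zero, ← Module.forall_dual_apply_eq_zero_iff k]
  intro ψ
  rw [map_sub, sub_eq_zero, hs]
  change (ψ.comp (r a)) (s j) = _
  rw [hs]
  have h := ConcreteCategory.congr_hom (colimit.w F a) (ψ : F.obj i)
  exact congrArg φ h

end LinearCompactness

/-! ### Simplicity of the unit object -/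

section UnitSimple
variable {C : Type u} [Category.{v} C] [Abelian C] [MonoidalCategory C] [SymmetricCategory C]
  [MonoidalPreadditive C] [RigidCategory C]

instance mono_whiskerRight' {X Y : C} (f : X ⟶ Y) [Mono f] (Z : C) : Mono (f ▷ Z) := by
  have : (tensorRight Z).IsRightAdjoint := (tensorRightAdjunction (ᘁZ) Z).isRightAdjoint
  exact inferInstanceAs (Mono ((tensorRight Z).map f))

/-- A zigzag identity recovers `w` from its transpose. -/
lemma eq_zero_of_coevaluation {X D Z : C} [ExactPairing X D] (w : D ⟶ Z) (h : η_ X D ≫ X ◁ w = 0) :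
    w = 0 := by
  have h2 : w = (ρ_ _).inv ≫ D ◁ (η_ X D ≫ X ◁ w) ≫ (α_ _ _ _).inv ≫ ε_ X D ▷ Z ≫
      (λ_ _).hom := by
    have h3 := ExactPairing.coevaluation_evaluation X D
    rw [MonoidalCategory.whiskerLeft_comp, Category.assoc, associator_inv_naturality_right_assoc,
      whisker_exchange_assoc, reassoc_of% h3]
    simp
  rw [h2, h]
  simp

/-- For a nonzero mono `f : X ⟶ 𝟙` with dual `D`, the transpose `t : 𝟙 ⟶ D` of `f` is epi. It
factors through the mono `m : X ⊗ D ⟶ D`, so `m` is an isomorphism. Following `t` by the inverse of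
`m` and evaluation gives a nonzero, hence invertible, endomorphism of `𝟙`. So `t` is a split mono,
which forces `f` to be epi. -/
theorem simple_unit (h1 : 𝟙 (𝟙_ C) ≠ 0) (hiso : ∀ f : 𝟙_ C ⟶ 𝟙_ C, f ≠ 0 → IsIso f) :
    Simple (𝟙_ C) where
  mono_isIso_iff_nonzero {X} f _ := by
    refine ⟨fun _ h => h1 ?_, fun hf => ?_⟩
    · rw [← IsIso.inv_hom_id f]
      exact (congrArg (inv f ≫ ·) h).trans comp_zero
    let D : C := HasRightDual.rightDual X
    let m : X ⊗ D ⟶ D := f ▷ D ≫ (λ_ _).hom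
    let t : 𝟙_ C ⟶ D := η_ X D ≫ m
    have : Mono m := mono_comp _ _
    have ht : Epi t := by
      refine Preadditive.epi_of_cancel_zero t fun {Z} w hw => eq_zero_of_coevaluation (X := X) w ?_
      rw [← cancel_mono (f ▷ Z), zero_comp, Category.assoc, whisker_exchange]
      rw [← cancel_mono (λ_ Z).hom, zero_comp, Category.assoc, Category.assoc,
        leftUnitor_naturality]
      simpa [t, m] using hw
    have : Epi m := epi_of_epi (η_ X D) m
    have : IsIso m := isIso_of_mono_of_epi m
    have hε : ε_ X D ≠ 0 := by
      intro h
      have h3 := ExactPairing.evaluation_coevaluation X D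
      rw [h] at h3
      have h4 : 𝟙 X = 0 := by
        have h5 : (λ_ X).hom ≫ (ρ_ X).inv = 0 := by
          rw [← h3]
          simp
        rw [← cancel_epi (λ_ X).hom, ← cancel_mono (ρ_ X).inv]
        simpa using h5
      exact hf (by rw [← Category.id_comp f, h4, zero_comp])
    let c : 𝟙_ C ⟶ 𝟙_ C := t ≫ inv m ≫ (β_ _ _).hom ≫ ε_ X D
    have hc : c ≠ 0 := by
      intro h
      apply hε
      rw [← cancel_epi (β_ X D).hom, ← cancel_epi (inv m), ← cancel_epi t, comp_zero, comp_zero,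
        comp_zero]
      exact h
    have := hiso c hc
    have : Epi f := by
      refine Preadditive.epi_of_cancel_zero f fun {Z} g hg => ?_
      have h1 : t ≫ (λ_ _).inv ≫ g ▷ D = 0 := by
        simp only [t, m, Category.assoc, Iso.hom_inv_id_assoc]
        rw [← comp_whiskerRight, hg]
        simp
      have h2 : g ▷ 𝟙_ C ≫ Z ◁ c = 0 := by
        have h3 : g ▷ 𝟙_ C ≫ Z ◁ t = 0 := by
          rw [← whisker_exchange, ← cancel_epi (λ_ (𝟙_ C)).inv, comp_zero, ← h1,
            leftUnitor_inv_naturality_assoc]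
        simp only [c, MonoidalCategory.whiskerLeft_comp]
        rw [reassoc_of% h3, zero_comp]
      have h3 : g ▷ 𝟙_ C = 0 := by
        rw [← cancel_mono (Z ◁ c), zero_comp, h2]
      rw [← cancel_epi (ρ_ (𝟙_ C)).hom, ← rightUnitor_naturality, h3, zero_comp, comp_zero]
    exact isIso_of_mono_of_epi f

end UnitSimple

/-! ### Finite-dimensionality of the spaces of morphisms to the unit -/

section FiniteDimensional
variable {C : Type u} [Category.{v} C] [Abelian C] [MonoidalCategory C] [Simple (𝟙_ C)]

lemma epi_to_unit {X : C} {f : X ⟶ 𝟙_ C} (hf : f ≠ 0) : Epi f := epi_of_nonzero_to_simple hf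

/-- As for linear forms: on the kernel of `u a`, induction writes `f` as a combination `g`. Then `f
- g` vanishes on that kernel, so it is a multiple of `u a`, which is epi unless it is zero. -/
lemma mem_span_of_kernels {I : Type*} (s : Finset I) :
    ∀ {X : C} (u : I → (X ⟶ 𝟙_ C)) (f : X ⟶ 𝟙_ C)
      (_ : ∀ (Z : C) (z : Z ⟶ X), (∀ i ∈ s, z ≫ u i = 0) → z ≫ f = 0),
      f ∈ Submodule.span (End (𝟙_ C)) (u '' s) := by
  classical
  induction s using Finset.induction_on with
  | empty =>
    intro X u f h
    have h2 := h X (𝟙 X) (by simp)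
    rw [Category.id_comp] at h2
    rw [h2]
    exact zero_mem _
  | insert a s ha ih =>
    intro X u f h
    let κ := kernel.ι (u a)
    have h1 := ih (fun i => κ ≫ u i) (κ ≫ f) (fun Z z hz => by
      rw [← Category.assoc]
      refine h Z (z ≫ κ) fun i hi => ?_
      obtain rfl | hi := Finset.mem_insert.1 hi
      · rw [Category.assoc, kernel.condition, comp_zero]
      · rw [Category.assoc, hz i hi])
    let L : (X ⟶ 𝟙_ C) →ₗ[End (𝟙_ C)] (kernel (u a) ⟶ 𝟙_ C) :=
      { toFun g := κ ≫ g
        map_add' _ _ := Preadditive.comp_add _ _ _ _ _ _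
        map_smul' c g := (Category.assoc _ _ _).symm }
    have h2 : (fun i => κ ≫ u i) '' s = L '' (u '' s) := (Set.image_image _ _ _).symm
    rw [h2, Submodule.span_image] at h1
    obtain ⟨g, hg, hgf⟩ := h1
    have h3 : kernel.ι (u a) ≫ (f - g) = 0 := by
      rw [Preadditive.comp_sub, sub_eq_zero]
      exact hgf.symm
    have h4 : f - g ∈ Submodule.span (End (𝟙_ C)) (u '' insert a s) := by
      by_cases hu : u a = 0
      · have : f - g = 0 := by
          have h5 : f - g = kernel.lift (u a) (𝟙 X) (by rw [hu, comp_zero]) ≫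
              kernel.ι (u a) ≫ (f - g) := by
            rw [kernel.lift_ι_assoc, Category.id_comp]
          rw [h5, h3, comp_zero]
        rw [this]
        exact zero_mem _
      · have := epi_to_unit hu
        let c : End (𝟙_ C) := Abelian.epiDesc (u a) (f - g) h3
        have hc : c • u a = f - g := Abelian.comp_epiDesc _ _ _
        rw [← hc]
        exact Submodule.smul_mem _ _ (Submodule.subset_span ⟨a, by simp, rfl⟩)
    rw [← sub_add_cancel f g]
    rw [Finset.coe_insert]
    exact add_mem h4 (Submodule.span_mono (Set.image_mono (Set.subset_insert _ _)) hg)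

/-- A minimal finite intersection of kernels is contained in every kernel, so the finitely many
forms defining it span. -/
lemma finite_hom_unit (X : C) [IsArtinianObject X] :
    Module.Finite (End (𝟙_ C)) (X ⟶ 𝟙_ C) := by
  classical
  let K (s : Finset (X ⟶ 𝟙_ C)) : Subobject X := s.inf fun f => kernelSubobject f
  obtain ⟨_, ⟨s, rfl⟩, hmin⟩ := WellFounded.has_min
    (wellFounded_lt (α := Subobject X)) (Set.range K) ⟨_, ∅, rfl⟩
  refine ⟨⟨s, eq_top_iff.2 fun f _ => ?_⟩⟩
  have h := mem_span_of_kernels s id f fun Z z hz => by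
    have h1 : (K s).Factors z := (Subobject.finset_inf_factors _).2 fun i hi =>
      (kernelSubobject_factors_iff _ _).2 (hz i hi)
    have h2 : K s ≤ K (insert f s) := by
      by_contra h
      exact hmin _ ⟨insert f s, rfl⟩ (lt_of_le_not_ge (Finset.inf_mono (Finset.subset_insert _ _)) h)
    have h3 : K s ≤ kernelSubobject f := h2.trans (Finset.inf_le (Finset.mem_insert_self _ _))
    exact (kernelSubobject_factors_iff _ _).1 (Subobject.factors_of_le _ h3 h1)
  simpa using h

/-- The Eckmann–Hilton argument. -/
lemma comp_unit_comm (a b : 𝟙_ C ⟶ 𝟙_ C) : a ≫ b = b ≫ a := by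
  have h (c : 𝟙_ C ⟶ 𝟙_ C) : 𝟙_ C ◁ c = (ρ_ _).hom ≫ c ≫ (ρ_ _).inv := by
    rw [← unitors_equal, ← leftUnitor_naturality_assoc, unitors_equal, Iso.hom_inv_id,
      Category.comp_id]
  have h1 := whisker_exchange a b
  rw [h, whiskerRight_id] at h1
  simpa using h1.symm

instance : Field (End (𝟙_ C)) :=
  { (inferInstance : DivisionRing (End (𝟙_ C))) with
    mul_comm a b := comp_unit_comm (C := C) b a }

variable [MonoidalPreadditive C] {E : Type w} [Category.{v} E] [Abelian E]
  (inc : C ⥤ E) [inc.Full] [inc.Faithful]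
  [IndEmbedding inc] [inc.Additive]

/-- A morphism from the unit object to an ind-object `B` is nonzero after composition with a
morphism from `B` to the unit object, if its lifts to objects over `B` have this property. -/
theorem exists_comp_unit_ne_zero (hA : ∀ X : C, IsArtinianObject X) {B : E}
    (b : inc.obj (𝟙_ C) ⟶ B)
    (hb : ∀ (X : C) (a : 𝟙_ C ⟶ X) (x : inc.obj X ⟶ B), inc.map a ≫ x = b →
      ∃ f : X ⟶ 𝟙_ C, a ≫ f ≠ 0) :
    ∃ f : B ⟶ inc.obj (𝟙_ C), b ≫ f ≠ 0 := by
  obtain ⟨J, _, _, G, κ, ⟨hc⟩⟩ := IndEmbedding.exists_presentation (inc := inc) B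
  obtain ⟨j₀, a', ha'⟩ := exists_factor_of_isColimit inc hc b
  obtain ⟨a, rfl⟩ : ∃ a : 𝟙_ C ⟶ G.obj j₀, inc.map a = a' := inc.map_surjective a'
  have hκ {i j : J} (t : i ⟶ j) : inc.map (G.map t) ≫ κ.app j = κ.app i :=
    (κ.naturality t).trans (Category.comp_id _)
  -- Below `j₀` the lift `a` of `b` can be pushed forward, and this part of the index category is
  -- final.
  let T := Under.forget j₀
  let st (j : Under j₀) : j₀ ⟶ T.obj j := j.hom
  have hst {i j : Under j₀} (t : i ⟶ j) : st i ≫ T.map t = st j := Under.w t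
  have hfin (j : Under j₀) : Module.Finite (End (𝟙_ C)) (G.obj (T.obj j) ⟶ 𝟙_ C) :=
    have := hA (G.obj (T.obj j))
    finite_hom_unit _
  -- The spaces are `Hom(G j, 𝟙)`, with the linear form given by evaluation along the image of `a`,
  -- nonzero by `hb`. A compatible family in them is a morphism from `B` to the unit.
  obtain ⟨s, hs, j₁, hj₁⟩ := exists_compatible_family (k := End (𝟙_ C)) (J := Under j₀)
    (fun j => G.obj (T.obj j) ⟶ 𝟙_ C)
    (fun {i j} t =>
      { toFun g := G.map (T.map t) ≫ g
        map_add' _ _ := Preadditive.comp_add _ _ _ _ _ _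
        map_smul' c g := (Category.assoc _ _ _).symm })
    (fun j x => by
      change G.map (T.map (𝟙 j)) ≫ x = x
      rw [T.map_id, G.map_id, Category.id_comp])
    (fun {i j l} t t' x => by
      change G.map (T.map (t ≫ t')) ≫ x = G.map (T.map t) ≫
        G.map (T.map t') ≫ x
      rw [T.map_comp, ← Category.assoc, ← G.map_comp])
    (fun j =>
      { toFun g := a ≫ G.map (st j) ≫ g
        map_add' _ _ := by simp [Preadditive.comp_add]
        map_smul' c g := by
          change a ≫ G.map (st j) ≫ g ≫ c = (a ≫ G.map (st j) ≫ g) ≫ c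
          simp only [Category.assoc] })
    (fun {i j} t x => by
      change a ≫ G.map (st i) ≫ G.map (T.map t) ≫ x = a ≫ G.map (st j) ≫ x
      rw [← hst t, G.map_comp, Category.assoc])
    (fun j h => by
      obtain ⟨f, hf⟩ := hb (G.obj (T.obj j)) (a ≫ G.map (st j)) (κ.app (T.obj j)) (by
        rw [← ha', Functor.map_comp, Category.assoc, hκ])
      refine hf ((Category.assoc _ _ _).trans ?_)
      exact LinearMap.congr_fun h f)
  have hc' := (Functor.Final.isColimitWhiskerEquiv (Under.forget j₀) (Cocone.mk B κ)).symm hc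
  let f : B ⟶ inc.obj (𝟙_ C) := hc'.desc (Cocone.mk (inc.obj (𝟙_ C))
    { app j := inc.map (s j)
      naturality i j t := by
        refine ((inc.map_comp _ _).symm.trans (congrArg inc.map (hs t))).trans ?_
        exact (Category.comp_id _).symm })
  have hf : κ.app (T.obj j₁) ≫ f = inc.map (s j₁) := hc'.fac _ j₁
  refine ⟨f, fun h => hj₁ ?_⟩
  apply inc.map_injective
  change inc.map (a ≫ G.map (st j₁) ≫ s j₁) = inc.map 0
  rw [inc.map_zero, Functor.map_comp, Functor.map_comp, ← hf, ← Category.assoc (inc.map (G.map _)),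
    hκ, ← Category.assoc]
  exact (congrArg (· ≫ f) ha').trans h

end FiniteDimensional

/-! ## Quotients and closed embeddings of spectra -/

section IdealLemmas
variable {E : Type u} [Category.{v} E] [Abelian E]

lemma factors_iff_imageSubobject_le {X Y : E} (P : Subobject X) (f : Y ⟶ X) :
    P.Factors f ↔ imageSubobject f ≤ P := by
  constructor
  · intro h
    exact imageSubobject_le f (P.factorThru f h) (P.factorThru_arrow f h)
  · intro h
    refine Subobject.factors_of_le _ h ?_
    have := imageSubobject_factors_comp_self (f := f) (𝟙 _)
    rwa [Category.id_comp] at this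

lemma le_iff_factors_arrow {X : E} (P Q : Subobject X) : P ≤ Q ↔ Q.Factors P.arrow :=
  ⟨fun h => Subobject.factors_of_le _ h (Subobject.factors_self _),
    fun h => Subobject.le_of_factors h⟩

variable [MonoidalCategory E] [SymmetricCategory E] {A B : CommMon E}

/-- The zero ideal. -/
def AlgIdeal.zero (A : CommMon E) [MonoidalPreadditive E] : AlgIdeal A where
  carrier := ⊥
  mul_mem := by
    rw [Subobject.bot_arrow, MonoidalPreadditive.whiskerLeft_zero, zero_comp]
    exact Subobject.factors_zero

variable [MonoidalPreadditive E]

lemma AlgIdeal.zero_factors_iff {X : E} (x : X ⟶ A.X) :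
    (AlgIdeal.zero A).carrier.Factors x ↔ x = 0 :=
  Subobject.bot_factors_iff_zero _

/-- The kernel of a morphism of algebras. -/
def kerIdeal (f : A ⟶ B) : AlgIdeal A := (AlgIdeal.zero B).comap f

lemma kerIdeal_factors_iff (f : A ⟶ B) {X : E} (x : X ⟶ A.X) :
    (kerIdeal f).carrier.Factors x ↔ x ≫ und f = 0 := by
  rw [kerIdeal, AlgIdeal.comap_factors_iff, AlgIdeal.zero_factors_iff]

variable [∀ X : E, PreservesFiniteColimits (tensorLeft X)]

namespace AlgIdeal
variable (I : AlgIdeal A)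

/-- The projection as a morphism to the underlying object of the quotient algebra. -/
def π : A.X ⟶ I.quot.X := I.proj

lemma und_toQuot : und I.toQuot = I.π := rfl

instance : Epi I.π := inferInstanceAs (Epi I.proj)

instance : Epi (und I.toQuot) := inferInstanceAs (Epi I.proj)

lemma factors_iff {X : E} (x : X ⟶ A.X) : I.carrier.Factors x ↔ x ≫ I.π = 0 :=
  factors_iff_comp_cokernel _ _

lemma π_mul : (I.π ⊗ₘ I.π) ≫ μ = μ ≫ I.π := I.proj_quotMul

variable (f : A ⟶ B) (h : I.carrier ≤ (kerIdeal f).carrier)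

/-- The morphism from `A / I` induced by a morphism of algebras which vanishes on `I`. -/
def descHom : I.quot.X ⟶ B.X :=
  cokernel.desc I.carrier.arrow (und f)
    ((kerIdeal_factors_iff _ _).1 ((le_iff_factors_arrow _ _).1 h))

lemma π_descHom : I.π ≫ I.descHom f h = und f := cokernel.π_desc _ _ _

/-- The morphism of algebras from `A / I` induced by a morphism which vanishes on `I`. -/
def desc : I.quot ⟶ B :=
  CommMon.homMk
    { hom := I.descHom f h
      isMonHom_hom :=
        { one_hom := by
            have h1 : (η ≫ I.π) ≫ I.descHom f h = η := by
              rw [Category.assoc, π_descHom, und_one]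
            exact h1
          mul_hom := by
            have h1 : (I.π ⊗ₘ I.π) ≫ μ ≫ I.descHom f h =
                (I.π ⊗ₘ I.π) ≫ (I.descHom f h ⊗ₘ I.descHom f h) ≫ μ := by
              rw [← Category.assoc, π_mul, Category.assoc, π_descHom, und_mul,
                tensorHom_comp_tensorHom_assoc, π_descHom]
            exact (cancel_epi (I.π ⊗ₘ I.π)).1 h1 } }

lemma π_und_desc : I.π ≫ und (I.desc f h) = und f := I.π_descHom f h

end AlgIdeal

/-- The unit of `A` puts `X` inside `A X`, and an ideal absorbs multiplication by `A`. -/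
lemma spanIdeal_le_iff (X : Subobject A.X) (J : AlgIdeal A) :
    (spanIdeal A X).carrier ≤ J.carrier ↔ X ≤ J.carrier := by
  constructor
  · intro h
    refine le_trans ?_ h
    rw [le_iff_factors_arrow, factors_iff_imageSubobject_le]
    have h1 : X.arrow = (λ_ _).inv ≫ η ▷ _ ≫ A.X ◁ X.arrow ≫ μ := by
      rw [← whisker_exchange_assoc, MonObj.one_mul, leftUnitor_naturality, Iso.inv_hom_id_assoc]
    change imageSubobject X.arrow ≤ imageSubobject (A.X ◁ X.arrow ≫ μ)
    have h2 : (imageSubobject (A.X ◁ X.arrow ≫ μ)).Factors (A.X ◁ X.arrow ≫ μ) :=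
      (factors_iff_imageSubobject_le _ _).2 le_rfl
    rw [← factors_iff_imageSubobject_le]
    have h3 := Subobject.factors_of_factors_right ((λ_ (X : E)).inv ≫ η ▷ _) h2
    rwa [Category.assoc, ← h1] at h3
  · intro h
    change imageSubobject (A.X ◁ X.arrow ≫ μ) ≤ _
    rw [← factors_iff_imageSubobject_le, ← id_tensorHom]
    exact J.factors_mul _ _ ((le_iff_factors_arrow _ _).1 h)

end IdealLemmas

/-! ### Spectra of quotient algebras -/

section ClosedEmbedding
variable {C : Type u} [Category.{v} C] [Abelian C] {E : Type w} [Category.{v} E] [Abelian E]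
  [MonoidalCategory E] [SymmetricCategory E] [MonoidalPreadditive E]
  [∀ X : E, PreservesFiniteColimits (tensorLeft X)]
  {inc : C ⥤ E} [inc.Full] [inc.Faithful] [inc.Additive] [PreservesFiniteColimits inc]
  [IndEmbedding inc] {A B : CommMon E}

lemma Spec.isClosed_zeroLocus (J : AlgIdeal A) : IsClosed (Spec.zeroLocus (inc := inc) J) := by
  rw [← isOpen_compl_iff]
  exact TopologicalSpace.isOpen_generateFrom_of_mem ⟨J, rfl⟩

/-- The preimage of `V(J)` is `V` of the ideal generated by the image of `J`. -/
lemma Spec.continuous_map (f : A ⟶ B) : Continuous (Spec.map (inc := inc) f) := by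
  refine continuous_generateFrom_iff.2 ?_
  rintro _ ⟨J, rfl⟩
  rw [Set.preimage_compl, isOpen_compl_iff]
  convert Spec.isClosed_zeroLocus (inc := inc)
    (spanIdeal B (imageSubobject (J.carrier.arrow ≫ und f))) using 1
  ext P
  change J.carrier ≤ (P.ideal.comap f).carrier ↔ (spanIdeal B _).carrier ≤ P.ideal.carrier
  rw [spanIdeal_le_iff, ← factors_iff_imageSubobject_le, le_iff_factors_arrow,
    AlgIdeal.comap_factors_iff]

/-- Elements of `B` lift to `A` after replacing their domain by an epimorphic cover in `C`, and
containment in an ideal can be tested on such a cover. -/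
lemma comap_le_comap_iff (inc : C ⥤ E) [inc.Full] [inc.Faithful] [inc.Additive]
    [PreservesFiniteColimits inc] [IndEmbedding inc] (hN : ∀ X : C, IsNoetherianObject X) (f : A ⟶ B) [Epi (und f)]
    (J K : AlgIdeal B) :
    (J.comap f).carrier ≤ (K.comap f).carrier ↔ J.carrier ≤ K.carrier := by
  constructor
  · intro h
    refine le_of_elements inc fun Z z hz => ?_
    obtain ⟨X, p, x, hp, hx⟩ := exists_lift_of_epi inc hN (und f) z
    have h1 : (J.comap f).carrier.Factors x := by
      rw [AlgIdeal.comap_factors_iff, hx]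
      exact Subobject.factors_of_factors_right _ hz
    have h2 := Subobject.factors_of_le _ h h1
    rw [AlgIdeal.comap_factors_iff, hx] at h2
    exact factors_of_epi _ _ _ h2
  · intro h
    rw [le_iff_factors_arrow, AlgIdeal.comap_factors_iff]
    refine Subobject.factors_of_le _ h ?_
    rw [← AlgIdeal.comap_factors_iff]
    exact Subobject.factors_self _

lemma isPrime_of_comap (hN : ∀ X : C, IsNoetherianObject X) (f : A ⟶ B) [Epi (und f)] (J : AlgIdeal B)
    (h : (J.comap f).IsPrime inc) : J.IsPrime inc where
  ne_top h1 := by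
    apply h.ne_top
    rw [eq_top_iff, le_iff_factors_arrow, AlgIdeal.comap_factors_iff, h1]
    exact Subobject.top_factors _
  mem_or_mem {X Y} x y hxy := by
    obtain ⟨X', p, x', hp, hx⟩ := exists_lift_of_epi inc hN (und f) x
    obtain ⟨Y', q, y', hq, hy⟩ := exists_lift_of_epi inc hN (und f) y
    have h1 := h.mem_or_mem x' y' (by
      rw [AlgIdeal.comap_factors_iff, Category.assoc, und_mul, tensorHom_comp_tensorHom_assoc,
        hx, hy, ← tensorHom_comp_tensorHom, Category.assoc]
      exact Subobject.factors_of_factors_right _ hxy)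
    rw [AlgIdeal.comap_factors_iff, AlgIdeal.comap_factors_iff, hx, hy] at h1
    exact h1.imp (factors_of_epi _ _ _) (factors_of_epi _ _ _)

lemma Spec.isEmbedding_map (hN : ∀ X : C, IsNoetherianObject X) (f : A ⟶ B) [Epi (und f)] : IsEmbedding (Spec.map (inc := inc) f) where
  eq_induced := by
    refine le_antisymm (Spec.continuous_map f).le_induced (le_generateFrom ?_)
    rintro _ ⟨J, rfl⟩
    refine ⟨(Spec.zeroLocus (J.comap f))ᶜ, (Spec.isClosed_zeroLocus _).isOpen_compl, ?_⟩
    ext P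
    exact not_congr (comap_le_comap_iff inc hN f J P.ideal)
  injective P Q h := by
    have h1 : P.ideal.comap f = Q.ideal.comap f := congrArg Spec.ideal h
    ext1
    ext1
    exact le_antisymm ((comap_le_comap_iff inc hN f _ _).1 (by rw [h1]))
      ((comap_le_comap_iff inc hN f _ _).1 (by rw [h1]))

/-- For `P ∈ V(I)` the projection `A ⟶ A / P` factors through `A / I`; the kernel of the
factorization is the required prime. -/
lemma Spec.range_map_toQuot (hN : ∀ X : C, IsNoetherianObject X) (I : AlgIdeal A) :
    Set.range (Spec.map (inc := inc) I.toQuot) = Spec.zeroLocus I := by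
  ext P
  constructor
  · rintro ⟨Q, rfl⟩
    change I.carrier ≤ (Q.ideal.comap I.toQuot).carrier
    rw [le_iff_factors_arrow, AlgIdeal.comap_factors_iff, I.und_toQuot,
      (I.factors_iff _).1 (Subobject.factors_self _)]
    exact Subobject.factors_zero
  · intro h
    have h1 : I.carrier ≤ (kerIdeal P.ideal.toQuot).carrier := by
      refine le_trans h ?_
      rw [le_iff_factors_arrow, kerIdeal_factors_iff, P.ideal.und_toQuot, ← AlgIdeal.factors_iff]
      exact Subobject.factors_self _
    have h2 : (kerIdeal (I.desc P.ideal.toQuot h1)).comap I.toQuot = P.ideal := by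
      ext1
      refine le_antisymm ?_ ?_ <;> refine le_of_elements inc fun Z z => ?_ <;>
      · rw [AlgIdeal.comap_factors_iff, kerIdeal_factors_iff, I.und_toQuot, Category.assoc,
          I.π_und_desc, P.ideal.und_toQuot, ← AlgIdeal.factors_iff]
        exact id
    refine ⟨⟨kerIdeal (I.desc P.ideal.toQuot h1), isPrime_of_comap hN I.toQuot _ ?_⟩, ?_⟩
    · rw [h2]
      exact P.isPrime
    · ext1
      exact h2

/-- The spectrum of `A / I` is the closed subspace `V(I)` of the spectrum of `A`. -/
theorem Spec.isClosedEmbedding_map_toQuot (hN : ∀ X : C, IsNoetherianObject X) (I : AlgIdeal A) :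
    IsClosedEmbedding (Spec.map (inc := inc) I.toQuot) where
  toIsEmbedding := Spec.isEmbedding_map hN I.toQuot
  isClosed_range := by
    rw [Spec.range_map_toQuot hN]
    exact Spec.isClosed_zeroLocus _

/-- The zero ideal in the quotient by a prime ideal is prime. -/
lemma Spec.isPrime_zero (hN : ∀ X : C, IsNoetherianObject X) (P : Spec inc A) : (AlgIdeal.zero P.ideal.quot).IsPrime inc := by
  refine isPrime_of_comap hN P.ideal.toQuot _ ?_
  have h : (AlgIdeal.zero P.ideal.quot).comap P.ideal.toQuot = P.ideal := by
    ext1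
    refine le_antisymm ?_ ?_ <;> refine le_of_elements inc fun Z z => ?_ <;>
    · rw [AlgIdeal.comap_factors_iff, AlgIdeal.zero_factors_iff, P.ideal.und_toQuot,
        ← AlgIdeal.factors_iff]
      exact id
  rw [h]
  exact P.isPrime

end ClosedEmbedding

/-! ### Membership in `tilde`, in `R(A)` and in the kernel of `A^0 → A^0_0` -/

section Tilde
variable {E : Type u} [Category.{v} E] [Abelian E] [MonoidalCategory E] [SymmetricCategory E]
  [WellPowered.{v} E] [HasWidePullbacks.{v} E]

lemma tilde_factors_iff {X Y : E} (x : Y ⟶ X) :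
    (tilde X).Factors x ↔ ∀ f : X ⟶ 𝟙_ E, x ≫ f = 0 := by
  constructor
  · intro h f
    rw [← kernelSubobject_factors_iff]
    refine Subobject.factors_of_le _ ?_ h
    unfold tilde
    exact Subobject.sInf_le _ _ ⟨f, rfl⟩
  · intro h
    rw [factors_iff_imageSubobject_le]
    unfold tilde
    refine Subobject.le_sInf _ _ ?_
    rintro _ ⟨f, rfl⟩
    rw [← factors_iff_imageSubobject_le, kernelSubobject_factors_iff]
    exact h f

variable [MonoidalPreadditive E] [∀ X : E, PreservesFiniteColimits (tensorLeft X)]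

lemma idealR_le_iff {A : CommMon E} (J : AlgIdeal A) :
    (idealR A).carrier ≤ J.carrier ↔ tilde A.X ≤ J.carrier := spanIdeal_le_iff _ _

lemma mem_ker_toA00_iff {A : CommMon E} (a : H0 A) :
    a ∈ RingHom.ker (toA00 A) ↔ (idealR A).carrier.Factors (a : 𝟙_ E ⟶ A.X) := by
  refine Iff.trans ?_ ((idealR A).factors_iff _).symm
  rw [RingHom.mem_ker]
  exact Subtype.ext_iff

end Tilde

/-! ## Nilpotence and prime ideals -/

section Nilpotence
variable {C : Type u} [Category.{v} C] [Abelian C] [MonoidalCategory C] [SymmetricCategory C]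
  {E : Type w} [Category.{v} E] [Abelian E] [MonoidalCategory E] [SymmetricCategory E]
  [MonoidalPreadditive E] [∀ X : E, (tensorLeft X).IsLeftAdjoint]
  [∀ X : E, PreservesFiniteColimits (tensorLeft X)] [IsGrothendieckAbelian.{v} E]
  {inc : C ⥤ E} [inc.Braided] [inc.Full] [inc.Faithful] [inc.Additive]
  [PreservesFiniteColimits inc] [IndEmbedding inc] {A B : CommMon E}

lemma tpowMap_id {D : Type u} [Category.{v} D] [MonoidalCategory D] (X : D) (n : ℕ) :
    tpowMap (𝟙 X) n = 𝟙 (tpow X n) := by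
  induction n with
  | zero => rfl
  | succ n ih =>
    change tpowMap (𝟙 X) n ⊗ₘ 𝟙 X = 𝟙 (tpow X n ⊗ X)
    rw [ih, id_tensorHom_id]

lemma pow_eq_zero_iff_of_iso {X Y : E} (e : X ≅ Y) (a : Y ⟶ A.X) (n : ℕ) :
    pow (e.hom ≫ a) n = 0 ↔ pow a n = 0 := by
  rw [pow_comp]
  have h : tpowMap e.inv n ≫ tpowMap e.hom n = 𝟙 _ := by
    rw [← tpowMap_comp, e.inv_hom_id, tpowMap_id]
  constructor
  · intro h1
    rw [← Category.id_comp (pow a n), ← h, Category.assoc, h1, comp_zero]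
  · intro h1
    rw [h1, comp_zero]

lemma pow_unit_eq_zero_iff (a : H0 A) (n : ℕ) :
    pow (a : 𝟙_ E ⟶ A.X) n = 0 ↔ a ^ n = 0 := by
  rw [← tpowUnitIso_inv_pow]
  constructor
  · intro h
    refine (congrArg ((tpowUnitIso n).inv ≫ ·) h).trans ?_
    exact comp_zero
  · intro h
    refine (cancel_epi (tpowUnitIso n).inv).1 ?_
    rw [comp_zero]
    exact h

lemma pow_one' {X : E} (x : X ⟶ A.X) : pow x 1 = (λ_ X).hom ≫ x := by
  change (η ⊗ₘ x) ≫ μ = _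
  rw [tensorHom_def'_assoc, MonObj.one_mul, leftUnitor_naturality]

/-- The powers of a generalized element. -/
def powers (inc : C ⥤ E) [inc.Braided] {X : C} (x : inc.obj X ⟶ A.X) :
    Set (Σ Z : C, inc.obj Z ⟶ A.X) :=
  Set.range fun n : ℕ => ⟨tpow X n, (mapTpow inc X n).hom ≫ pow x n⟩

lemma isMultiplicative_powers {X : C} (x : inc.obj X ⟶ A.X) :
    IsMultiplicative inc (powers inc x) where
  nonempty := Set.range_nonempty _
  mul := by
    rintro _ _ ⟨m, rfl⟩ ⟨n, rfl⟩
    refine ⟨_, ⟨m + n, rfl⟩, fun J h => ?_⟩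
    dsimp only at h ⊢
    rw [← tensorHom_comp_tensorHom, Category.assoc, pow_add', ← Category.assoc] at h
    exact Subobject.factors_of_factors_right _ (factors_of_epi _ _ _ h)

/-- A generalized element which is not nilpotent is not contained in some prime ideal. -/
theorem exists_prime_not_factors {X : C} (x : inc.obj X ⟶ A.X) (h : ∀ n, pow x n ≠ 0) :
    ∃ P : Spec inc A, ¬ P.ideal.carrier.Factors x := by
  obtain ⟨P, -, hP, -⟩ := exists_prime inc (isMultiplicative_powers x) (AlgIdeal.zero A) (by
    rintro _ ⟨n, rfl⟩ h1
    rw [AlgIdeal.zero_factors_iff] at h1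
    refine h n ((cancel_epi (mapTpow inc X n).hom).1 ?_)
    exact h1.trans comp_zero.symm)
  refine ⟨P, fun h1 => hP _ ⟨1, rfl⟩ ?_⟩
  dsimp only
  rw [pow_one']
  exact Subobject.factors_of_factors_right _ (Subobject.factors_of_factors_right _ h1)

/-- The powers of a generalized element not contained in a prime ideal are not contained in it. -/
lemma AlgIdeal.IsPrime.pow_not_factors {P : AlgIdeal A} (hP : P.IsPrime inc) {X : C}
    {x : inc.obj X ⟶ A.X} (hx : ¬ P.carrier.Factors x) (n : ℕ) :
    ¬ P.carrier.Factors (pow x n) := by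
  induction n with
  | zero => exact fun h => hP.ne_top (P.eq_top_of_one h)
  | succ n ih =>
    intro h
    -- Primality concerns elements with domain in `C`, so the tensor power in `E` is replaced by the
    -- image of the one in `C`.
    have h1 : P.carrier.Factors (((mapTpow inc X n).hom ≫ pow x n ⊗ₘ x) ≫ μ) := by
      have e : ((mapTpow inc X n).hom ≫ pow x n ⊗ₘ x) ≫ μ =
          ((mapTpow inc X n).hom ⊗ₘ 𝟙 _) ≫ (pow x n ⊗ₘ x) ≫ μ := by
        rw [tensorHom_comp_tensorHom_assoc, Category.id_comp]
      rw [e]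
      exact Subobject.factors_of_factors_right _ h
    obtain h2 | h2 := hP.mem_or_mem _ _ h1
    · exact ih (factors_of_epi _ _ _ h2)
    · exact hx h2

/-- A generalized element factors through a quotient of its domain on which it is injective. -/
lemma exists_factor_injective (hN : ∀ X : C, IsNoetherianObject X) {M : E} {X : C}
    (x : inc.obj X ⟶ M) : ∃ (Q : C) (q : X ⟶ Q) (y : inc.obj Q ⟶ M), Epi q ∧
      inc.map q ≫ y = x ∧ ∀ (Z : C) (z : Z ⟶ Q), inc.map z ≫ y = 0 → z = 0 := by
  have := hN X
  obtain ⟨K, hK, hmax⟩ := WellFounded.has_min (wellFounded_gt (α := Subobject X))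
    {K | inc.map K.arrow ≫ x = 0} ⟨⊥, by
      change inc.map _ ≫ x = 0
      rw [Subobject.bot_arrow, inc.map_zero, zero_comp]⟩
  let y : inc.obj (cokernel K.arrow) ⟶ M :=
    (PreservesCokernel.iso inc K.arrow).hom ≫ cokernel.desc _ x hK
  have hy : inc.map (cokernel.π K.arrow) ≫ y = x := by
    rw [← Category.assoc, PreservesCokernel.π_iso_hom, cokernel.π_desc]
  refine ⟨cokernel K.arrow, cokernel.π _, y, inferInstance, hy, fun Z z hz => ?_⟩
  -- The preimage in `X` of the image of `z`. It contains `K` and is killed by `x`, so it equals `K`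
  -- by maximality, which forces `z = 0`.
  let I : Subobject X := imageSubobject (pullback.fst (cokernel.π K.arrow) z)
  have hI : inc.map I.arrow ≫ x = 0 := by
    rw [← cancel_epi (inc.map (factorThruImageSubobject (pullback.fst (cokernel.π K.arrow) z))),
      ← Category.assoc, ← Functor.map_comp, imageSubobject_arrow_comp, comp_zero, ← hy,
      ← Category.assoc, ← Functor.map_comp, pullback.condition, Functor.map_comp, Category.assoc,
      hz, comp_zero]
  have hle : K ≤ I := by
    rw [le_iff_factors_arrow]
    have h : K.arrow = pullback.lift K.arrow 0 (by rw [cokernel.condition, zero_comp]) ≫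
        pullback.fst (cokernel.π K.arrow) z := (pullback.lift_fst _ _ _).symm
    rw [h]
    exact Subobject.factors_of_factors_right _ ((factors_iff_imageSubobject_le _ _).2 le_rfl)
  have hIK : I = K := by
    by_contra h
    exact hmax I hI (lt_of_le_of_ne hle (Ne.symm h))
  have h1 : K.Factors (pullback.fst (cokernel.π K.arrow) z) := by
    rw [factors_iff_imageSubobject_le]
    exact hIK.le
  rw [factors_iff_comp_cokernel, pullback.condition] at h1
  exact (cancel_epi (pullback.snd (cokernel.π K.arrow) z)).1 (h1.trans comp_zero.symm)

/-- A generalized element is nilpotent if its domain has a vanishing symmetric power. -/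
lemma pow_eq_zero_of_symProj {X Y : C} (a : X ⟶ Y) (x : inc.obj Y ⟶ A.X) (n : ℕ)
    (h : tpowMap a n ≫ symProj Y n = 0) : pow (inc.map a ≫ x) n = 0 := by
  obtain ⟨f, hf⟩ := exists_powSym inc x n
  rw [pow_comp, ← cancel_epi (mapTpow inc X n).hom, ← Category.assoc, ← mapTpow_natural,
    Category.assoc, ← hf, ← Category.assoc, ← Functor.map_comp, h, inc.map_zero, zero_comp,
    comp_zero]

variable [HasCoproductsOfShape ℕ E]

/-- `Sym^n` embeds in the symmetric algebra, so the vanishing already holds in `Sym^n` formed in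
`E`; the comparison morphism carries it over to `C`. -/
lemma symProj_eq_zero_of_pow {X Y : C} (a : X ⟶ Y) (n : ℕ)
    (h : pow (inc.map a ≫ symAlgGen (inc.obj Y)) n = 0) : tpowMap a n ≫ symProj Y n = 0 := by
  rw [pow_comp, pow_symAlgGen, ← symProj_symAlgIota, ← Category.assoc] at h
  have h1 : tpowMap (inc.map a) n ≫ symProj (inc.obj Y) n = 0 :=
    (cancel_mono (symAlgIota (inc.obj Y) n)).1 (h.trans zero_comp.symm)
  have h2 := congrArg (· ≫ symComparison inc Y n) h1
  rw [Category.assoc, symProj_symComparison, zero_comp, ← Category.assoc] at h2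
  have h3 : tpowMap (inc.map a) n ≫ (mapTpow inc Y n).inv =
      (mapTpow inc X n).inv ≫ inc.map (tpowMap a n) := by
    rw [Iso.comp_inv_eq, Category.assoc, mapTpow_natural, Iso.inv_hom_id_assoc]
  rw [h3, Category.assoc, ← Functor.map_comp] at h2
  apply inc.map_injective
  rw [inc.map_zero]
  exact (cancel_epi (mapTpow inc X n).inv).1 (h2.trans comp_zero.symm)

end Nilpotence

lemma powFromUnit_eq_zero_iff {C : Type u} [Category.{v} C] [Abelian C] [MonoidalCategory C]
    [SymmetricCategory C] {X : C} (a : 𝟙_ C ⟶ X) (n : ℕ) :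
    powFromUnit a n = 0 ↔ tpowMap a n ≫ symProj X n = 0 := by
  rw [← symProj_symMap, powFromUnit]
  constructor
  · intro h
    have h1 : symMap a n = 0 := (cancel_epi (symUnitIso n).inv).1 (h.trans comp_zero.symm)
    rw [h1, comp_zero]
  · intro h
    have h1 : symMap a n = 0 := (cancel_epi (symProj (𝟙_ C) n)).1 (h.trans comp_zero.symm)
    rw [h1, comp_zero]

/-! ## Maximal nilpotency -/

section MaximalNilpotency
variable {C : Type u} [Category.{v} C] [Abelian C] [MonoidalCategory C] [SymmetricCategory C]
  [MonoidalPreadditive C] [Simple (𝟙_ C)]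
  {E : Type w} [Category.{v} E] [Abelian E] [MonoidalCategory E] [SymmetricCategory E]
  [MonoidalPreadditive E] [∀ X : E, (tensorLeft X).IsLeftAdjoint]
  [∀ X : E, PreservesFiniteColimits (tensorLeft X)] [IsGrothendieckAbelian.{v} E]
  [WellPowered.{v} E] [HasWidePullbacks.{v} E]
  {inc : C ⥤ E} [inc.Braided] [inc.Full] [inc.Faithful] [inc.Additive]
  [PreservesFiniteColimits inc] [IndEmbedding inc]

lemma mono_from_unit {X : C} {a : 𝟙_ C ⟶ X} (ha : a ≠ 0) : Mono a := mono_of_nonzero_from_simple ha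

lemma isSplitMono_of_comp_ne_zero {X : C} {a : 𝟙_ C ⟶ X} {f : X ⟶ 𝟙_ C} (h : a ≫ f ≠ 0) :
    IsSplitMono a := by
  have := isIso_of_hom_simple h
  exact ⟨⟨⟨f ≫ inv (a ≫ f), by rw [← Category.assoc, IsIso.hom_inv_id]⟩⟩⟩

/-- If `x` in `tilde A` were nonzero in the domain `A / P`, a simple subobject of its image would
not be nilpotent, hence would be a copy of `𝟙` by (MN1). By (MN2) and linear compactness some
morphism `A / P ⟶ 𝟙` does not kill this copy, although its composite from `A` kills `x`. -/
theorem idealR_le_of_isMN (hMN : IsMN C) (hN : ∀ X : C, IsNoetherianObject X)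
    (hA : ∀ X : C, IsArtinianObject X) (i : inc.obj (𝟙_ C) ≅ 𝟙_ E) {A : CommMon E}
    (P : Spec inc A) : (idealR A).carrier ≤ P.ideal.carrier := by
  rw [idealR_le_iff]
  refine le_of_elements inc fun X x hx => ?_
  rw [tilde_factors_iff] at hx
  by_contra hxP
  rw [AlgIdeal.factors_iff] at hxP
  have hprime := P.isPrime_zero hN
  have hpow {Y : C} {y : inc.obj Y ⟶ P.ideal.quot.X} (hy : y ≠ 0) (n : ℕ) : pow y n ≠ 0 := by
    have h := hprime.pow_not_factors (x := y) (by rwa [AlgIdeal.zero_factors_iff]) n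
    rwa [AlgIdeal.zero_factors_iff] at h
  -- `Q` is the image of `x` in `A / P`, realized as a quotient of `X` in `C`.
  obtain ⟨Q, q, y, _, hqy, hy⟩ := exists_factor_injective (inc := inc) hN (x ≫ P.ideal.π)
  have hQ : ¬ IsZero Q := by
    intro h
    apply hxP
    rw [← hqy, h.eq_zero_of_tgt q, inc.map_zero, zero_comp]
  have := hA Q
  obtain ⟨L, hL⟩ := exists_simple_subobject hQ
  have hl : inc.map L.arrow ≫ y ≠ 0 := by
    intro h
    have h0 := hy _ _ h
    have : 𝟙 (L : C) = 0 := by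
      rw [← cancel_mono L.arrow, h0, comp_zero, comp_zero]
    exact id_nonzero _ this
  by_cases hL1 : IsEmpty ((L : C) ≅ 𝟙_ C)
  · obtain ⟨n, hn⟩ := hMN.1 _ hL hL1
    refine hpow hl n ?_
    have h := pow_eq_zero_of_symProj (𝟙 (L : C)) (inc.map L.arrow ≫ y) n (hn.eq_zero_of_tgt _)
    rwa [inc.map_id, Category.id_comp] at h
  · rw [not_isEmpty_iff] at hL1
    obtain ⟨e⟩ := hL1
    have hb : inc.map e.inv ≫ inc.map L.arrow ≫ y ≠ 0 := by
      intro h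
      exact hl ((cancel_epi (inc.map e.inv)).1 (h.trans comp_zero.symm))
    obtain ⟨f, hf⟩ := exists_comp_unit_ne_zero inc hA _ (fun Y a z haz => by
      have ha : a ≠ 0 := by
        rintro rfl
        rw [inc.map_zero, zero_comp] at haz
        exact hb haz.symm
      -- A lift that did not split would be nilpotent in the symmetric algebra of `Y` by (MN2), and
      -- so would its image in `A / P`.
      have hsplit : IsSplitMono a := by
        by_contra hns
        obtain ⟨n, hn⟩ := hMN.2 Y a (mono_from_unit ha) hns
        rw [powFromUnit_eq_zero_iff] at hn
        refine hpow hb n ?_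
        rw [← haz]
        exact pow_eq_zero_of_symProj _ _ _ hn
      refine ⟨retraction a, ?_⟩
      rw [IsSplitMono.id]
      exact id_nonzero _)
    apply hf
    -- The morphism `f` composes with `A ⟶ A / P` to a morphism from `A` to the unit, so it kills
    -- `x` and, as `q` is epi, also `y`.
    have h1 := hx (P.ideal.π ≫ f ≫ i.hom)
    have h2 : inc.map q ≫ y ≫ f = 0 := by
      rw [← Category.assoc, hqy, ← cancel_mono i.hom, zero_comp, ← h1]
      simp only [Category.assoc]
    have h3 : y ≫ f = 0 := (cancel_epi (inc.map q)).1 (h2.trans comp_zero.symm)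
    rw [Category.assoc, Category.assoc, h3, comp_zero, comp_zero]

variable [HasCoproductsOfShape ℕ E]

/-- Generalized elements of the symmetric algebra in degree one which are killed by all morphisms
to the unit object. -/
lemma tilde_factors_symAlgGen (i : inc.obj (𝟙_ C) ≅ 𝟙_ E) {X Y : C} (a : X ⟶ Y)
    (h : ∀ f : Y ⟶ 𝟙_ C, a ≫ f = 0) :
    (tilde (symAlg (inc.obj Y)).X).Factors (inc.map a ≫ symAlgGen (inc.obj Y)) := by
  rw [tilde_factors_iff]
  intro f
  obtain ⟨g, hg⟩ := inc.map_surjective (symAlgGen (inc.obj Y) ≫ f ≫ i.inv)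
  rw [← cancel_mono i.inv, zero_comp, Category.assoc, Category.assoc, ← hg, ← Functor.map_comp, h,
    inc.map_zero]

/-- A simple object other than the unit has no nonzero morphism to it, so the generator of its
symmetric algebra lies in `tilde`. -/
lemma isMN1_of_nilpotent (i : inc.obj (𝟙_ C) ≅ 𝟙_ E)
    (h : ∀ (A : CommMon E) (X : C) (x : inc.obj X ⟶ A.X), (tilde A.X).Factors x →
      ∃ n, pow x n = 0) : IsMN1 C := by
  intro L hL hL1
  obtain ⟨n, hn⟩ := h _ _ _ (tilde_factors_symAlgGen i (𝟙 L) fun f => by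
    rw [Category.id_comp]
    by_contra hf
    have := isIso_of_hom_simple hf
    exact hL1.false (asIso f))
  have h1 := symProj_eq_zero_of_pow _ _ hn
  rw [tpowMap_id, Category.id_comp] at h1
  refine ⟨n, (IsZero.iff_id_eq_zero _).2 ?_⟩
  rw [← cancel_epi (symProj L n), h1, zero_comp, zero_comp]

/-- A morphism from the unit that does not split is killed by every morphism to the unit. Only
elements with domain the unit are needed, which is why (MN2) also follows from the statement about
`A^0`. -/
lemma isMN2_of_nilpotent (i : inc.obj (𝟙_ C) ≅ 𝟙_ E)
    (h : ∀ (A : CommMon E) (x : inc.obj (𝟙_ C) ⟶ A.X), (tilde A.X).Factors x →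
      ∃ n, pow x n = 0) : IsMN2 C := by
  intro X a _ ha
  obtain ⟨n, hn⟩ := h _ _ (tilde_factors_symAlgGen i a fun f => by
    by_contra hf
    exact ha (isSplitMono_of_comp_ne_zero hf))
  exact ⟨n, (powFromUnit_eq_zero_iff _ _).2 (symProj_eq_zero_of_pow _ _ hn)⟩

lemma exists_pow_eq_zero_of_idealR_le {A : CommMon E}
    (h : ∀ P : Spec inc A, (idealR A).carrier ≤ P.ideal.carrier) {X : C} (x : inc.obj X ⟶ A.X)
    (hx : (tilde A.X).Factors x) : ∃ n, pow x n = 0 := by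
  by_contra! hn
  obtain ⟨P, hP⟩ := exists_prime_not_factors x hn
  exact hP (Subobject.factors_of_le _ ((idealR_le_iff _).1 (h P)) hx)

theorem isMN_of_idealR_le (i : inc.obj (𝟙_ C) ≅ 𝟙_ E)
    (h : ∀ (A : CommMon E) (P : Spec inc A), (idealR A).carrier ≤ P.ideal.carrier) : IsMN C :=
  ⟨isMN1_of_nilpotent i fun A _ x hx => exists_pow_eq_zero_of_idealR_le (h A) x hx,
    isMN2_of_nilpotent i fun A x hx => exists_pow_eq_zero_of_idealR_le (h A) x hx⟩

lemma isNilpotent_of_idealR_le (i : inc.obj (𝟙_ C) ≅ 𝟙_ E) {A : CommMon E}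
    (h : ∀ P : Spec inc A, (idealR A).carrier ≤ P.ideal.carrier) (a : H0 A)
    (ha : (idealR A).carrier.Factors (a : 𝟙_ E ⟶ A.X)) : IsNilpotent a := by
  by_contra hn
  obtain ⟨P, hP⟩ := exists_prime_not_factors (inc := inc) (i.hom ≫ (a : 𝟙_ E ⟶ A.X)) fun n h0 =>
    hn ⟨n, (pow_unit_eq_zero_iff _ _).1 ((pow_eq_zero_iff_of_iso i _ n).1 h0)⟩
  exact hP (Subobject.factors_of_factors_right _ (Subobject.factors_of_le _ (h P) ha))

theorem isMN2_of_isNilpotent (i : inc.obj (𝟙_ C) ≅ 𝟙_ E)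
    (h : ∀ (A : CommMon E) (a : H0 A), a ∈ RingHom.ker (toA00 A) → IsNilpotent a) : IsMN2 C :=
  isMN2_of_nilpotent i fun A x hx => by
    let a : H0 A := i.inv ≫ x
    obtain ⟨n, hn⟩ := h A a ((mem_ker_toA00_iff a).2 (Subobject.factors_of_le _
      ((idealR_le_iff _).1 le_rfl) (Subobject.factors_of_factors_right i.inv hx)))
    refine ⟨n, ?_⟩
    have h1 := (pow_eq_zero_iff_of_iso i _ n).2 ((pow_unit_eq_zero_iff a n).2 hn)
    have h2 : i.hom ≫ (a : 𝟙_ E ⟶ A.X) = x := i.hom_inv_id_assoc x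
    rwa [h2] at h1

end MaximalNilpotency

/-! ## Geometric reductivity -/

section SymmetricAlgebraElements
variable {C : Type u} [Category.{v} C] {E : Type w} [Category.{v} E] [Abelian E]
  [MonoidalCategory E] [SymmetricCategory E] [IsGrothendieckAbelian.{v} E]
  {inc : C ⥤ E} [IndEmbedding inc] [HasCoproductsOfShape ℕ E] {V : E}

/-- The projection of the symmetric algebra to a symmetric power. -/
def symPi (V : E) (n : ℕ) : symObj V ⟶ symPow V n :=
  symObjDesc fun m => if h : m = n then eqToHom (by rw [h]) else 0

/-- The projection of the symmetric algebra to the sum of its components of degree less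
than `N`. -/
def symTrunc (V : E) (N : ℕ) : symObj V ⟶ symObj V :=
  ∑ n ∈ Finset.range N, symPi V n ≫ symIota V n

lemma symIota_symTrunc (m N : ℕ) :
    symIota V m ≫ symTrunc V N = if m < N then symIota V m else 0 := by
  rw [symTrunc, Preadditive.comp_sum]
  have h (n : ℕ) : symIota V m ≫ symPi V n ≫ symIota V n = if m = n then symIota V m else 0 := by
    rw [symPi, ← Category.assoc, symIota_symObjDesc]
    split_ifs with h
    · subst h
      simp
    · simp
  simp_rw [h]
  simp

lemma symTrunc_comp {M N : ℕ} (h : M ≤ N) : symTrunc V M ≫ symTrunc V N = symTrunc V M := by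
  refine symObj_hom_ext fun m => ?_
  rw [← Category.assoc, symIota_symTrunc]
  split_ifs with h1
  · rw [symIota_symTrunc, if_pos (by omega)]
  · rw [zero_comp]

/-- A generalized element of the symmetric algebra lies in a finite sum of symmetric powers. -/
lemma exists_symTrunc {X : C} (a : inc.obj X ⟶ symObj V) : ∃ N, a ≫ symTrunc V N = a := by
  -- The part of degree less than `N`. These increase and exhaust the symmetric algebra, so
  -- compactness of `inc.obj X` applies.
  let U (N : ℕ) : Subobject (symObj V) := kernelSubobject (symTrunc V N - 𝟙 _)
  have hU {Y : E} (N : ℕ) (y : Y ⟶ symObj V) : (U N).Factors y ↔ y ≫ symTrunc V N = y := by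
    rw [kernelSubobject_factors_iff, Preadditive.comp_sub, sub_eq_zero, Category.comp_id]
  have hmono {M N : ℕ} (h : M ≤ N) : U M ≤ U N := by
    rw [le_iff_factors_arrow, hU]
    have h1 := (hU M _).1 (Subobject.factors_self (U M))
    rw [← h1, Category.assoc, symTrunc_comp h]
  have htop : sSup (Set.range U) = ⊤ := by
    rw [eq_top_iff, le_iff_factors_arrow, factors_iff_comp_cokernel]
    have h : cokernel.π (sSup (Set.range U)).arrow = 0 := by
      refine symObj_hom_ext fun n => ?_
      rw [comp_zero, ← factors_iff_comp_cokernel]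
      refine Subobject.factors_of_le _ (le_sSup ⟨n + 1, rfl⟩) ?_
      rw [hU, symIota_symTrunc, if_pos (by omega)]
    rw [h, comp_zero]
  obtain ⟨_, ⟨N, rfl⟩, hN⟩ := exists_factors_of_directedOn inc (Set.range_nonempty U) (by
    rintro _ ⟨M, rfl⟩ _ ⟨N, rfl⟩
    exact ⟨_, ⟨max M N, rfl⟩, hmono (le_max_left _ _), hmono (le_max_right _ _)⟩) a (by
    rw [htop]
    exact Subobject.top_factors _)
  exact ⟨N, (hU N a).1 hN⟩

/-- By `exists_symTrunc` an element is the finite sum of its homogeneous components. -/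
lemma comp_eq_zero_of_symIota {X : C} {Z : E} (a : inc.obj X ⟶ symObj V) (d : symObj V ⟶ Z)
    (h : ∀ (n : ℕ) (b : inc.obj X ⟶ symPow V n), b ≫ symIota V n ≫ d = 0) : a ≫ d = 0 := by
  obtain ⟨N, hN⟩ := exists_symTrunc a
  rw [← hN, symTrunc, Preadditive.comp_sum, Preadditive.sum_comp]
  refine Finset.sum_eq_zero fun n _ => ?_
  have h1 := h n (a ≫ symPi V n)
  simpa using h1

end SymmetricAlgebraElements

/-! ### Multiplication by invariants -/

section Scalar
variable {E : Type u} [Category.{v} E] [Abelian E] [MonoidalCategory E] [SymmetricCategory E]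
  [MonoidalPreadditive E] {A : CommMon E}

/-- Multiplication by an element of `A^0`. -/
def mulBy (a : 𝟙_ E ⟶ A.X) : A.X ⟶ A.X := (ρ_ A.X).inv ≫ A.X ◁ a ≫ μ

lemma comp_mulBy {X : E} (x : X ⟶ A.X) (a : 𝟙_ E ⟶ A.X) :
    x ≫ mulBy a = (ρ_ X).inv ≫ (x ⊗ₘ a) ≫ μ := by
  rw [mulBy, rightUnitor_inv_naturality_assoc, ← tensorHom_def_assoc]

lemma comp_mulBy_unit (x a : 𝟙_ E ⟶ A.X) : x ≫ mulBy a = H0.mul A x a := by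
  rw [comp_mulBy, ← unitors_inv_equal]
  rfl

lemma mul_mulBy_right {X Y : E} (x : X ⟶ A.X) (y : Y ⟶ A.X) (a : 𝟙_ E ⟶ A.X) :
    (x ⊗ₘ y ≫ mulBy a) ≫ μ = ((x ⊗ₘ y) ≫ μ) ≫ mulBy a := by
  have e : (x ⊗ₘ (ρ_ Y).inv ≫ (y ⊗ₘ a) ≫ μ) = X ◁ (ρ_ Y).inv ≫ (x ⊗ₘ (y ⊗ₘ a) ≫ μ) := by
    rw [← id_tensorHom, tensorHom_comp_tensorHom, Category.id_comp]
  rw [comp_mulBy, comp_mulBy, mul_mul_eq, e]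
  simp

lemma mul_mulBy_left {X Y : E} (x : X ⟶ A.X) (y : Y ⟶ A.X) (a : 𝟙_ E ⟶ A.X) :
    (x ≫ mulBy a ⊗ₘ y) ≫ μ = ((x ⊗ₘ y) ≫ μ) ≫ mulBy a := by
  rw [← braid_mul, mul_mulBy_right, ← braid_mul x y, Category.assoc, Category.assoc,
    Category.assoc]

lemma mulBy_comp (a b : 𝟙_ E ⟶ A.X) : mulBy a ≫ mulBy b = mulBy (H0.mul A a b) := by
  have h := mul_mulBy_right (𝟙 A.X) a b
  rw [id_tensorHom, id_tensorHom, comp_mulBy_unit] at h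
  have e : mulBy (H0.mul A a b) = (ρ_ A.X).inv ≫ A.X ◁ H0.mul A a b ≫ μ := rfl
  rw [e, h]
  simp [mulBy]

lemma pow_mulBy {X : E} (x : X ⟶ A.X) (a : H0 A) (n : ℕ) :
    pow (x ≫ mulBy a) n = pow x n ≫ mulBy (a ^ n : H0 A) := by
  have key (p : 𝟙_ E ⟶ A.X) (a : 𝟙_ E ⟶ A.X) (n : ℕ) (ih : pow (x ≫ mulBy a) n = pow x n ≫ mulBy p) :
      pow (x ≫ mulBy a) (n + 1) = pow x (n + 1) ≫ mulBy (H0.mul A p a) := by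
    rw [pow_succ', ih, pow_succ', ← mulBy_comp, mul_mulBy_right, mul_mulBy_left, Category.assoc]
    rfl
  induction n with
  | zero =>
    change η = η ≫ mulBy η
    rw [comp_mulBy_unit, H0.one_mul']
  | succ n ih =>
    have h : (a ^ (n + 1) : H0 A) = H0.mul A (a ^ n : H0 A) a := pow_succ a n
    exact (key _ _ _ ih).trans (congrArg (fun c => pow x (n + 1) ≫ mulBy c) h.symm)

end Scalar

/-! ### Under (GR), primes containing `R(A)` are controlled by their invariants -/

section Contraction
variable {C : Type u} [Category.{v} C] [Abelian C] [MonoidalCategory C] [SymmetricCategory C]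
  [Simple (𝟙_ C)]
  {E : Type w} [Category.{v} E] [Abelian E] [MonoidalCategory E] [SymmetricCategory E]
  [MonoidalPreadditive E] [∀ X : E, (tensorLeft X).IsLeftAdjoint]
  [∀ X : E, PreservesFiniteColimits (tensorLeft X)] [IsGrothendieckAbelian.{v} E]
  [WellPowered.{v} E] [HasWidePullbacks.{v} E]
  {inc : C ⥤ E} [inc.Braided] [inc.Full] [inc.Faithful] [inc.Additive]
  [PreservesFiniteColimits inc] [IndEmbedding inc] {A B : CommMon E}

/-- If the image of `x` in `B` comes from the unit object along `β`, then so do the morphisms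
induced on symmetric powers. -/
lemma powSym_comp {X : C} (x : inc.obj X ⟶ A.X) (h : A ⟶ B) (β : X ⟶ 𝟙_ C)
    (b : inc.obj (𝟙_ C) ⟶ B.X) (hb : x ≫ und h = inc.map β ≫ b) (n : ℕ)
    (f : inc.obj (symPow X n) ⟶ A.X)
    (hf : inc.map (symProj X n) ≫ f = (mapTpow inc X n).hom ≫ pow x n) :
    f ≫ und h = inc.map (powToUnit β n) ≫ inc.map (tpowUnitIso n).inv ≫
      (mapTpow inc (𝟙_ C) n).hom ≫ pow b n := by
  have h1 : symProj X n ≫ powToUnit β n ≫ (tpowUnitIso n).inv = tpowMap β n := by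
    rw [powToUnit, ← Category.assoc, ← Category.assoc, symProj_symMap, Category.assoc,
      Category.assoc, ← Category.assoc (symProj _ _), symProj_symUnitIso, Iso.hom_inv_id,
      Category.comp_id]
  rw [← cancel_epi (inc.map (symProj X n)), ← Category.assoc, hf, Category.assoc, ← pow_und, hb,
    pow_comp, ← Category.assoc, ← mapTpow_natural, ← h1]
  simp only [Functor.map_comp, Category.assoc]

lemma AlgIdeal.pow_factors (J : AlgIdeal A) {X : E} {x : X ⟶ A.X} (hx : J.carrier.Factors x)
    {n : ℕ} (hn : 0 < n) : J.carrier.Factors (pow x n) := by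
  obtain ⟨m, rfl⟩ := Nat.exists_eq_succ_of_ne_zero hn.ne'
  exact J.factors_mul _ _ hx

/-- In a geometrically reductive category, an ideal is contained in a prime ideal containing the
kernels of the morphisms to the unit object if this holds for the invariants. -/
theorem le_of_contract_le (hGR : IsGR C) (hN : ∀ X : C, IsNoetherianObject X)
    (hA : ∀ X : C, IsArtinianObject X) (i : inc.obj (𝟙_ C) ≅ 𝟙_ E) (Q : Spec inc A)
    (hQ : (idealR A).carrier ≤ Q.ideal.carrier) (J : AlgIdeal A)
    (hJ : ∀ a : 𝟙_ E ⟶ A.X, J.carrier.Factors a → Q.ideal.carrier.Factors a) :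
    J.carrier ≤ Q.ideal.carrier := by
  refine le_of_elements inc fun X₀ x₀ hx₀ => ?_
  by_contra hx₀Q
  have := hA X₀
  -- A minimal subobject of `X₀` not going into `Q`: every strictly smaller one does.
  obtain ⟨Y, hY, hmin⟩ := WellFounded.has_min (wellFounded_lt (α := Subobject X₀))
    {Y | ¬ Q.ideal.carrier.Factors (inc.map Y.arrow ≫ x₀)} ⟨⊤, fun h =>
      hx₀Q (factors_of_epi _ _ _ h)⟩
  let X : C := Y
  let x : inc.obj X ⟶ A.X := inc.map Y.arrow ≫ x₀
  have hxJ : J.carrier.Factors x := Subobject.factors_of_factors_right _ hx₀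
  -- As `Q` contains `tilde A`, some morphism from `A` to the unit is nonzero on `x`; this provides
  -- `β`.
  have hx : ¬ (tilde A.X).Factors x := fun h =>
    hY (Subobject.factors_of_le _ ((idealR_le_iff _).1 hQ) h)
  rw [tilde_factors_iff] at hx
  push Not at hx
  obtain ⟨f, hf⟩ := hx
  obtain ⟨β, hβ⟩ := inc.map_surjective (x ≫ f ≫ i.inv)
  have hβ0 : β ≠ 0 := by
    rintro rfl
    apply hf
    rw [inc.map_zero, ← Category.assoc] at hβ
    exact (cancel_mono i.inv).1 (hβ.symm.trans zero_comp.symm)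
  -- By minimality the kernel of `β` goes into `Q`, so modulo `Q` the element `x` is `β` followed by
  -- some `b` from the unit.
  have hker : inc.map (kernel.ι β) ≫ x ≫ Q.ideal.π = 0 := by
    let K : Subobject X₀ := Subobject.mk (kernel.ι β ≫ Y.arrow)
    have hK : K < Y := by
      refine lt_of_le_not_ge (Subobject.mk_le_of_comm (kernel.ι β) rfl) fun h => hβ0 ?_
      obtain ⟨t, ht⟩ : ∃ t : X ⟶ kernel β, t ≫ kernel.ι β ≫ Y.arrow = Y.arrow := by
        have h1 := (le_iff_factors_arrow _ _).1 h
        rw [Subobject.mk_factors_iff] at h1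
        exact ⟨_, h1.choose_spec⟩
      have h2 : t ≫ kernel.ι β = 𝟙 X := by
        rw [← cancel_mono Y.arrow, Category.assoc, ht]
        exact (Category.id_comp _).symm
      rw [← Category.id_comp β, ← h2, Category.assoc, kernel.condition, comp_zero]
    have h1 : Q.ideal.carrier.Factors (inc.map K.arrow ≫ x₀) := by
      by_contra h
      exact hmin K h hK
    have h2 : kernel.ι β ≫ Y.arrow = (Subobject.underlyingIso (kernel.ι β ≫ Y.arrow)).inv ≫
        K.arrow := (Subobject.underlyingIso_arrow _).symm
    rw [← Category.assoc, ← AlgIdeal.factors_iff]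
    change Q.ideal.carrier.Factors (inc.map (kernel.ι β) ≫ inc.map Y.arrow ≫ x₀)
    rw [← Category.assoc, ← Functor.map_comp, h2, Functor.map_comp, Category.assoc]
    exact Subobject.factors_of_factors_right _ h1
  have := epi_to_unit hβ0
  obtain ⟨b, hb⟩ : ∃ b : inc.obj (𝟙_ C) ⟶ Q.ideal.quot.X,
      inc.map β ≫ b = x ≫ Q.ideal.π := by
    let e : cokernel (kernel.ι β) ≅ 𝟙_ C :=
      IsColimit.coconePointUniqueUpToIso (colimit.isColimit _)
        (Abelian.epiIsCokernelOfKernel _ (limit.isLimit _))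
    have he : cokernel.π (kernel.ι β) ≫ e.hom = β :=
      IsColimit.comp_coconePointUniqueUpToIso_hom (colimit.isColimit _) _ WalkingParallelPair.one
    refine ⟨inc.map e.inv ≫ (PreservesCokernel.iso inc (kernel.ι β)).hom ≫
      cokernel.desc _ (x ≫ Q.ideal.π) hker, ?_⟩
    have he' : β ≫ e.inv = cokernel.π (kernel.ι β) := (Iso.comp_inv_eq e).2 he.symm
    rw [← Category.assoc, ← Functor.map_comp, he', ← Category.assoc,
      PreservesCokernel.π_iso_hom, cokernel.π_desc]
  have hb0 : b ≠ 0 := by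
    rintro rfl
    refine hY ?_
    rw [AlgIdeal.factors_iff]
    exact hb.symm.trans comp_zero
  obtain ⟨n, hn, hsplit⟩ := hGR X β hβ0
  obtain ⟨g, hg⟩ := exists_powSym inc x n
  -- The invariant obtained from a section of `Sym^n β`. It lies in `J` because `n > 0`, hence in
  -- `Q`, while its image in `A / Q` is `b^n` up to canonical isomorphisms, which is nonzero.
  let c : inc.obj (𝟙_ C) ⟶ A.X := inc.map (section_ (powToUnit β n)) ≫ g
  have hcJ : J.carrier.Factors c := by
    refine Subobject.factors_of_factors_right _ (factors_of_epi _ (inc.map (symProj X n)) _ ?_)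
    rw [hg]
    exact Subobject.factors_of_factors_right _ (J.pow_factors hxJ hn)
  have hcQ : c ≫ Q.ideal.π = 0 := by
    rw [← AlgIdeal.factors_iff]
    have h := hJ (i.inv ≫ c) (Subobject.factors_of_factors_right _ hcJ)
    exact factors_of_epi _ _ _ h
  have h1 := powSym_comp x Q.ideal.toQuot β b hb.symm n g hg
  have h2 : c ≫ Q.ideal.π = inc.map (tpowUnitIso n).inv ≫ (mapTpow inc (𝟙_ C) n).hom ≫
      pow b n := by
    refine (Category.assoc _ _ _).trans ((congrArg (inc.map _ ≫ ·) h1).trans ?_)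
    rw [← Category.assoc, ← Functor.map_comp, IsSplitEpi.id, inc.map_id, Category.id_comp]
  rw [hcQ] at h2
  have h3 : pow b n = 0 := by
    rw [← cancel_epi (mapTpow inc (𝟙_ C) n).hom, ← cancel_epi (inc.map (tpowUnitIso n).inv), ← h2,
      comp_zero, comp_zero]
  have h4 := (Q.isPrime_zero hN).pow_not_factors (x := b)
    (by rwa [AlgIdeal.zero_factors_iff]) n
  rw [AlgIdeal.zero_factors_iff] at h4
  exact h4 h3

end Contraction

/-! ## Primes over invariants -/

section Units
variable {E : Type u} [Category.{v} E] [Abelian E] [MonoidalCategory E] [SymmetricCategory E]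
  [MonoidalPreadditive E] {A : CommMon E}

/-- Endomorphisms of the unit act on `A^0` as scalars through the unit of `A`; in particular
automorphisms do not affect membership in ideals. -/
lemma comp_eq_mul (t : 𝟙_ E ⟶ 𝟙_ E) (s : 𝟙_ E ⟶ A.X) : t ≫ s = H0.mul A (t ≫ η) s := by
  have h : (t ≫ η ⊗ₘ s) = t ▷ 𝟙_ E ≫ ((η : 𝟙_ E ⟶ A.X) ⊗ₘ s) := by
    rw [← tensorHom_id, tensorHom_comp_tensorHom, Category.id_comp]
  rw [H0.mul, h, Category.assoc, tensorHom_def'_assoc, MonObj.one_mul, leftUnitor_naturality,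
    unitors_equal, rightUnitor_naturality_assoc, unitors_inv_equal, Iso.inv_hom_id_assoc]

lemma comp_mem_ideal_iff (q : Ideal (H0 A)) (t : 𝟙_ E ⟶ 𝟙_ E) [IsIso t] (s : 𝟙_ E ⟶ A.X) :
    ((t ≫ s : 𝟙_ E ⟶ A.X) : H0 A) ∈ q ↔ (s : H0 A) ∈ q := by
  have key (t : 𝟙_ E ⟶ 𝟙_ E) (s : 𝟙_ E ⟶ A.X) (hs : (s : H0 A) ∈ q) :
      ((t ≫ s : 𝟙_ E ⟶ A.X) : H0 A) ∈ q := by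
    rw [comp_eq_mul]
    exact q.mul_mem_left (t ≫ η : 𝟙_ E ⟶ A.X) hs
  refine ⟨fun h => ?_, key t s⟩
  have h1 := key (inv t) _ h
  rwa [IsIso.inv_hom_id_assoc] at h1

instance {X Y : E} (e : X ⟶ Y) [IsIso e] (n : ℕ) : IsIso (tpowMap e n) :=
  ⟨tpowMap (inv e) n, by rw [← tpowMap_comp, IsIso.hom_inv_id, tpowMap_id],
    by rw [← tpowMap_comp, IsIso.inv_hom_id, tpowMap_id]⟩

end Units

/-! ### Existence of primes over primes of `A^0`, and the homeomorphism -/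

section PrimesOverInvariants
variable {C : Type u} [Category.{v} C] [Abelian C] [MonoidalCategory C] [SymmetricCategory C]
  [Simple (𝟙_ C)]
  {E : Type w} [Category.{v} E] [Abelian E] [MonoidalCategory E] [SymmetricCategory E]
  [MonoidalPreadditive E] [∀ X : E, (tensorLeft X).IsLeftAdjoint]
  [∀ X : E, PreservesFiniteColimits (tensorLeft X)] [IsGrothendieckAbelian.{v} E]
  [WellPowered.{v} E] [HasWidePullbacks.{v} E]
  {inc : C ⥤ E} [inc.Braided] [inc.Full] [inc.Faithful] [inc.Additive]
  [PreservesFiniteColimits inc] [IndEmbedding inc] {A : CommMon E}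

/-- The generalized elements of `A` given by the complement of an ideal of `A^0`. -/
def complement (i : inc.obj (𝟙_ C) ≅ 𝟙_ E) (q : Ideal (H0 A)) : Set (Σ Z : C, inc.obj Z ⟶ A.X) :=
  {z | ∃ s : 𝟙_ E ⟶ A.X, (s : H0 A) ∉ q ∧ z = ⟨𝟙_ C, i.hom ≫ s⟩}

lemma isMultiplicative_complement (i : inc.obj (𝟙_ C) ≅ 𝟙_ E) (q : Ideal (H0 A))
    (hq : q.IsPrime) : IsMultiplicative inc (complement i q) where
  nonempty := ⟨_, (η : 𝟙_ E ⟶ A.X), fun h => hq.ne_top ((Ideal.eq_top_iff_one q).2 h), rfl⟩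
  mul := by
    rintro _ _ ⟨s, hs, rfl⟩ ⟨t, ht, rfl⟩
    refine ⟨_, ⟨H0.mul A s t, fun h => (hq.mem_or_mem h).elim hs ht, rfl⟩, fun J h => ?_⟩
    dsimp only at h ⊢
    rw [← tensorHom_comp_tensorHom, Category.assoc] at h
    exact Subobject.factors_of_factors_right _ (Subobject.factors_of_factors_right _
      (factors_of_epi _ _ _ h))

/-- Elements of the ideal generated by an element of the invariants of a quotient lift to
multiples of this element. -/
lemma exists_mulBy_lift (hN : ∀ X : C, IsNoetherianObject X) (I : AlgIdeal A) (a : 𝟙_ E ⟶ A.X)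
    {Z : C} (z : inc.obj Z ⟶ I.quot.X)
    (hz : (spanIdeal I.quot (imageSubobject (a ≫ I.π))).carrier.Factors z) :
    ∃ (X : C) (p : X ⟶ Z) (x : inc.obj X ⟶ A.X), Epi p ∧
      (x ≫ mulBy a) ≫ I.π = inc.map p ≫ z := by
  let X₀ := imageSubobject (a ≫ I.π)
  let g : I.quot.X ⊗ (X₀ : E) ⟶ I.quot.X := I.quot.X ◁ X₀.arrow ≫ μ
  have hz : (imageSubobject g).Factors z := hz
  -- Two lifts, each after an epimorphic change of domain: first along the surjection onto the
  -- generated ideal, then along the one from `A ⊗ 𝟙`.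
  obtain ⟨X₁, p₁, x₁, _, hx₁⟩ := exists_lift_of_epi inc hN (factorThruImageSubobject g)
    ((imageSubobject g).factorThru z hz)
  have hg : x₁ ≫ g = inc.map p₁ ≫ z := by
    rw [← imageSubobject_arrow_comp g, ← Category.assoc, hx₁, Category.assoc,
      Subobject.factorThru_arrow]
  obtain ⟨X₂, p₂, x₂, _, hx₂⟩ := exists_lift_of_epi inc hN
    (I.π ⊗ₘ factorThruImageSubobject (a ≫ I.π)) x₁
  refine ⟨X₂, p₂ ≫ p₁, x₂ ≫ (ρ_ _).hom, epi_comp _ _, ?_⟩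
  have h1 : (I.π ⊗ₘ factorThruImageSubobject (a ≫ I.π)) ≫ g = A.X ◁ a ≫ μ ≫ I.π := by
    have h2 : (I.π ⊗ₘ factorThruImageSubobject (a ≫ I.π)) ≫ I.quot.X ◁ X₀.arrow =
        (I.π ⊗ₘ a ≫ I.π) := by
      rw [← id_tensorHom, tensorHom_comp_tensorHom, Category.comp_id, imageSubobject_arrow_comp]
    have h3 : A.X ◁ a ≫ (I.π ⊗ₘ I.π) = (I.π ⊗ₘ a ≫ I.π) := by
      rw [← id_tensorHom, tensorHom_comp_tensorHom, Category.id_comp]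
    rw [← Category.assoc, h2, ← h3, Category.assoc, I.π_mul]
  rw [Functor.map_comp, Category.assoc (inc.map p₂), ← hg, ← Category.assoc (inc.map p₂), ← hx₂,
    Category.assoc x₂ (I.π ⊗ₘ _), h1, mulBy]
  simp only [Category.assoc, Iso.hom_inv_id_assoc]

/-- Take `P` maximal among the ideals that contain `R(A)` and no invariant outside `q`. If `a ∈ q`
were not in `P`, then `P + A a` would contain some `s ∉ q`. By (GR) an `n`-th power of the
congruence `x a ≡ s` modulo `P` becomes one between invariants, and gives `s^n ∈ q`. -/
theorem exists_prime_over (hGR : IsGR C) (hN : ∀ X : C, IsNoetherianObject X)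
    (i : inc.obj (𝟙_ C) ≅ 𝟙_ E) (q : Ideal (H0 A)) (hq : q.IsPrime)
    (hR : RingHom.ker (toA00 A) ≤ q) :
    ∃ P : Spec inc A, (idealR A).carrier ≤ P.ideal.carrier ∧
      ∀ a : 𝟙_ E ⟶ A.X, P.ideal.carrier.Factors a ↔ (a : H0 A) ∈ q := by
  obtain ⟨P, hRP, hPS, hmax⟩ := exists_prime inc (isMultiplicative_complement i q hq) (idealR A) (by
    rintro _ ⟨s, hs, rfl⟩ h
    exact hs (hR ((mem_ker_toA00_iff s).2 (factors_of_epi _ _ _ h))))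
  have hPq (a : 𝟙_ E ⟶ A.X) (ha : P.ideal.carrier.Factors a) : (a : H0 A) ∈ q := by
    by_contra h
    exact hPS _ ⟨a, h, rfl⟩ (Subobject.factors_of_factors_right _ ha)
  refine ⟨P, hRP, fun a => ⟨hPq a, fun haq => ?_⟩⟩
  by_contra haP
  let a' : H0 A := a
  -- The ideal `P + A a`, written as a preimage from `A / P`.
  let J := (spanIdeal P.ideal.quot (imageSubobject (a ≫ P.ideal.π))).comap P.ideal.toQuot
  have hPJ : P.ideal.carrier ≤ J.carrier := by
    rw [le_iff_factors_arrow, AlgIdeal.comap_factors_iff, P.ideal.und_toQuot,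
      (P.ideal.factors_iff _).1 (Subobject.factors_self _)]
    exact Subobject.factors_zero
  have haJ : J.carrier.Factors a := by
    rw [AlgIdeal.comap_factors_iff]
    exact Subobject.factors_of_le _ ((spanIdeal_le_iff _ _).1 le_rfl)
      ((factors_iff_imageSubobject_le _ _).2 le_rfl)
  obtain ⟨s, hs, hsJ⟩ : ∃ s : 𝟙_ E ⟶ A.X, (s : H0 A) ∉ q ∧ J.carrier.Factors (i.hom ≫ s) := by
    by_contra! h
    refine haP (Subobject.factors_of_le _ (hmax J hPJ ?_) haJ)
    rintro _ ⟨s, hs, rfl⟩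
    exact h s hs
  rw [AlgIdeal.comap_factors_iff] at hsJ
  -- After the epimorphism `β` onto the unit, `s` becomes congruent to `x a` modulo `P`; the
  -- coefficient `x` need not be an invariant.
  obtain ⟨X, β, x, _, hx⟩ := exists_mulBy_lift hN _ _ _ hsJ
  have hβ : β ≠ 0 := fun h => id_nonzero (𝟙_ C) (by
    rw [← cancel_epi β, h, zero_comp, zero_comp])
  obtain ⟨n, hn, _⟩ := hGR X β hβ
  obtain ⟨gx, hgx⟩ := exists_powSym inc x n
  obtain ⟨gy, hgy⟩ := exists_powSym inc (x ≫ mulBy a) n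
  let an : 𝟙_ E ⟶ A.X := (a' ^ n : H0 A)
  have hpow : pow (x ≫ mulBy a) n = pow x n ≫ mulBy an := pow_mulBy x a' n
  have hg : gy = gx ≫ mulBy an := by
    rw [← cancel_epi (inc.map (symProj X n)), hgy, ← Category.assoc, hgx, hpow, Category.assoc]
  have h1 := powSym_comp (x ≫ mulBy a) P.ideal.toQuot β _ hx n gy hgy
  let σ : 𝟙_ E ⟶ inc.obj (symPow X n) := i.inv ≫ inc.map (section_ (powToUnit β n))
  -- The automorphism of the unit coming from the various identifications of its tensor powers.
  let t : 𝟙_ E ⟶ 𝟙_ E := i.inv ≫ inc.map (tpowUnitIso n).inv ≫ (mapTpow inc (𝟙_ C) n).hom ≫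
    tpowMap i.hom n ≫ (tpowUnitIso n).hom
  have : IsIso t := inferInstance
  let sn : 𝟙_ E ⟶ A.X := (tpowUnitIso n).inv ≫ pow s n
  have h2 : (σ ≫ gy) ≫ P.ideal.π = (t ≫ sn) ≫ P.ideal.π := by
    have h3 : pow ((i.hom ≫ s) ≫ und P.ideal.toQuot) n = tpowMap i.hom n ≫ pow s n ≫ P.ideal.π := by
      rw [pow_und, pow_comp, Category.assoc, P.ideal.und_toQuot]
    rw [h3, P.ideal.und_toQuot] at h1
    have h4 : inc.map (section_ (powToUnit β n)) ≫ inc.map (powToUnit β n) = 𝟙 _ := by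
      rw [← Functor.map_comp, IsSplitEpi.id, inc.map_id]
    simp only [σ, t, sn, Category.assoc, h1, Iso.hom_inv_id_assoc]
    rw [reassoc_of% h4]
  -- This invariant is a multiple of `a^n`, and `n > 0`.
  have h5 : ((σ ≫ gy : 𝟙_ E ⟶ A.X) : H0 A) ∈ q := by
    have h6 : σ ≫ gy = H0.mul A (σ ≫ gx) an := by
      rw [hg, ← Category.assoc]
      exact comp_mulBy_unit _ _
    rw [h6]
    exact q.mul_mem_left (σ ≫ gx : 𝟙_ E ⟶ A.X) (Ideal.pow_mem_of_mem q haq n hn)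
  -- The two invariants differ by an element of `P ∩ A^0`, which is contained in `q`.
  have h7 : ((t ≫ sn : 𝟙_ E ⟶ A.X) : H0 A) ∈ q := by
    have h8 := hPq (σ ≫ gy - t ≫ sn) (by
      rw [AlgIdeal.factors_iff, Preadditive.sub_comp, h2, sub_self])
    have h9 := q.sub_mem h5 h8
    have h10 : (σ ≫ gy) - ((σ ≫ gy) - t ≫ sn) = t ≫ sn := sub_sub_cancel _ _
    exact h10 ▸ h9
  rw [comp_mem_ideal_iff] at h7
  let s' : H0 A := s
  have h11 : sn = (s' ^ n : H0 A) := tpowUnitIso_inv_pow s n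
  rw [h11] at h7
  exact hs (hq.mem_of_pow_mem n h7)

/-- The map `Spec A → Spec A^0` is continuous. -/
lemma continuous_rho (i : inc.obj (𝟙_ C) ≅ 𝟙_ E) (A : CommMon E) :
    Continuous (rho (inc := inc) i A) := by
  refine PrimeSpectrum.isTopologicalBasis_basic_opens.continuous_iff.2 ?_
  rintro _ ⟨a, rfl⟩
  convert (Spec.isClosed_zeroLocus (inc := inc)
    (spanIdeal A (imageSubobject (a : 𝟙_ E ⟶ A.X)))).isOpen_compl using 1
  ext P
  refine not_congr ?_
  change P.ideal.carrier.Factors (a : 𝟙_ E ⟶ A.X) ↔ (spanIdeal A _).carrier ≤ P.ideal.carrier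
  rw [spanIdeal_le_iff]
  exact factors_iff_imageSubobject_le _ _

/-- Surjectivity is `exists_prime_over`. Injectivity and the comparison of topologies both come from
`hle`: containment of an ideal in a prime can be tested on the invariants that lift to `A^0`. -/
theorem isHomeomorph_of_isGR (hGR : IsGR C) (hN : ∀ X : C, IsNoetherianObject X)
    (hA : ∀ X : C, IsArtinianObject X) (i : inc.obj (𝟙_ C) ≅ 𝟙_ E) (A : CommMon E) :
    IsHomeomorph (PrimeSpectrum.comap (inclA00 A) ∘ rho (inc := inc) i (A0 A)) := by
  have hcont : Continuous (PrimeSpectrum.comap (inclA00 A) ∘ rho (inc := inc) i (A0 A)) :=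
    (PrimeSpectrum.continuous_comap _).comp (continuous_rho i _)
  have hmem (P : Spec inc (A0 A)) (a : 𝟙_ E ⟶ A.X) :
      toA00 A (a : H0 A) ∈ ((PrimeSpectrum.comap (inclA00 A) ∘ rho i (A0 A)) P).asIdeal ↔
        P.ideal.carrier.Factors (a ≫ und (toA0 A)) := Iff.rfl
  have hle (P : Spec inc (A0 A)) (J : AlgIdeal (A0 A))
      (h : ∀ a : 𝟙_ E ⟶ A.X, J.carrier.Factors (a ≫ und (toA0 A)) →
        P.ideal.carrier.Factors (a ≫ und (toA0 A))) : J.carrier ≤ P.ideal.carrier := by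
    -- The comparison is made after pulling back to `A`, since `A^0_0` only sees the invariants of
    -- `A_0` that lift to `A^0`.
    have : Epi (und (toA0 A)) := inferInstanceAs (Epi (und (idealR A).toQuot))
    rw [← comap_le_comap_iff inc hN (toA0 A)]
    have hP : Spec.map (toA0 A) P ∈ Spec.zeroLocus (idealR A) := by
      rw [← Spec.range_map_toQuot hN]
      exact ⟨P, rfl⟩
    refine le_of_contract_le hGR hN hA i (Spec.map (toA0 A) P) hP (J.comap (toA0 A)) fun a ha => ?_
    change (P.ideal.comap (toA0 A)).carrier.Factors a
    rw [AlgIdeal.comap_factors_iff] at ha ⊢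
    exact h a ha
  have hinj : Function.Injective (PrimeSpectrum.comap (inclA00 A) ∘ rho (inc := inc) i (A0 A)) := by
    intro P Q h
    ext1
    ext1
    refine le_antisymm (hle Q P.ideal fun a ha => ?_) (hle P Q.ideal fun a ha => ?_)
    · rwa [← hmem, ← h, hmem]
    · rwa [← hmem, h, hmem]
  refine isHomeomorph_iff_isEmbedding_surjective.2 ⟨⟨⟨le_antisymm hcont.le_induced
    (le_generateFrom ?_)⟩, hinj⟩, fun q => ?_⟩
  · rintro _ ⟨J, rfl⟩
    -- `V(J)` is the preimage of the closed set defined by the elements of `A^0_0` that lie in `J`.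
    refine ⟨(PrimeSpectrum.zeroLocus {s | ∃ a : 𝟙_ E ⟶ A.X, toA00 A (a : H0 A) = s ∧
      J.carrier.Factors (a ≫ und (toA0 A))})ᶜ,
      (PrimeSpectrum.isClosed_zeroLocus _).isOpen_compl, ?_⟩
    ext P
    refine not_congr ⟨fun h => hle P J fun a ha => ?_, ?_⟩
    · exact (hmem P a).1 (h ⟨a, rfl, ha⟩)
    · rintro h _ ⟨a, rfl, ha⟩
      exact (hmem P a).2 (Subobject.factors_of_le _ h ha)
  · obtain ⟨P, hRP, hP⟩ := exists_prime_over hGR hN i (q.asIdeal.comap (toA00 A))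
      (q.2.comap _) fun a ha => by
        rw [Ideal.mem_comap, (RingHom.mem_ker).1 ha]
        exact zero_mem _
    obtain ⟨Q, rfl⟩ : P ∈ Set.range (Spec.map (inc := inc) (idealR A).toQuot) := by
      rw [Spec.range_map_toQuot hN]
      exact hRP
    refine ⟨Q, ?_⟩
    ext s
    obtain ⟨a, rfl⟩ := (H0.map (toA0 A)).rangeRestrict_surjective s
    refine (hmem Q a).trans (Iff.trans ?_ (hP a))
    exact (AlgIdeal.comap_factors_iff _ _ _).symm

end PrimesOverInvariants

/-! ## Injectivity implies geometric reductivity -/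

section InjectiveImpliesGR
variable {C : Type u} [Category.{v} C] [Abelian C] [MonoidalCategory C] [SymmetricCategory C]
  [Simple (𝟙_ C)]
  {E : Type w} [Category.{v} E] [Abelian E] [MonoidalCategory E] [SymmetricCategory E]
  [MonoidalPreadditive E] [∀ X : E, (tensorLeft X).IsLeftAdjoint]
  [∀ X : E, PreservesFiniteColimits (tensorLeft X)] [IsGrothendieckAbelian.{v} E]
  [WellPowered.{v} E] [HasWidePullbacks.{v} E] [HasCoproductsOfShape ℕ E]
  {inc : C ⥤ E} [inc.Braided] [inc.Full] [inc.Faithful] [inc.Additive]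
  [PreservesFiniteColimits inc] [IndEmbedding inc]

lemma epi_of_ne_zero (i : inc.obj (𝟙_ C) ≅ 𝟙_ E) {X : C} {x : inc.obj X ⟶ 𝟙_ E} (hx : x ≠ 0) :
    Epi x := by
  obtain ⟨f, hf⟩ := inc.map_surjective (x ≫ i.inv)
  have hf0 : f ≠ 0 := by
    rintro rfl
    rw [inc.map_zero] at hf
    exact hx ((cancel_mono i.inv).1 (hf.symm.trans zero_comp.symm))
  have := epi_to_unit hf0
  have h : x = inc.map f ≫ i.hom := by rw [hf, Category.assoc, Iso.inv_hom_id, Category.comp_id]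
  rw [h]
  exact epi_comp _ _

lemma id_unit_ne_zero (i : inc.obj (𝟙_ C) ≅ 𝟙_ E) : 𝟙 (𝟙_ E) ≠ 0 := by
  intro h
  apply id_nonzero (𝟙_ C)
  apply inc.map_injective
  rw [inc.map_id, inc.map_zero, ← i.hom_inv_id, ← Category.id_comp i.inv, h, zero_comp, comp_zero]

/-- Nonzero morphisms from objects of `C` to the unit are epi, so their tensor product is epi and
therefore nonzero. -/
lemma isPrime_zero_trivial (i : inc.obj (𝟙_ C) ≅ 𝟙_ E) :
    (AlgIdeal.zero (CommMon.trivial E)).IsPrime inc where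
  ne_top h := by
    have h1 : (AlgIdeal.zero (CommMon.trivial E)).carrier.Factors (𝟙 (CommMon.trivial E).X) := by
      rw [h]
      exact Subobject.top_factors _
    rw [AlgIdeal.zero_factors_iff] at h1
    exact id_unit_ne_zero i h1
  mem_or_mem {X Y} x y h := by
    rw [AlgIdeal.zero_factors_iff] at h
    rw [AlgIdeal.zero_factors_iff, AlgIdeal.zero_factors_iff]
    by_contra! hxy
    have key (x : inc.obj X ⟶ 𝟙_ E) (y : inc.obj Y ⟶ 𝟙_ E) (hx : x ≠ 0) (hy : y ≠ 0)
        (h : (x ⊗ₘ y) ≫ (λ_ (𝟙_ E)).hom = 0) : False := by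
      have := epi_of_ne_zero i hx
      have := epi_of_ne_zero i hy
      apply id_unit_ne_zero i
      rw [← cancel_epi (λ_ (𝟙_ E)).hom, ← cancel_epi (x ⊗ₘ y), Category.comp_id, h, comp_zero,
        comp_zero]
    exact key x y hxy.1 hxy.2 h

/-- The kernel of a morphism to the unit algebra as a point of the spectrum. -/
def kerPoint (i : inc.obj (𝟙_ C) ≅ 𝟙_ E) {A : CommMon E} (f : A ⟶ CommMon.trivial E) :
    Spec inc A :=
  Spec.map f ⟨AlgIdeal.zero _, isPrime_zero_trivial i⟩

lemma kerPoint_factors_iff (i : inc.obj (𝟙_ C) ≅ 𝟙_ E) {A : CommMon E}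
    (f : A ⟶ CommMon.trivial E) {X : E} (x : X ⟶ A.X) :
    (kerPoint i f).ideal.carrier.Factors x ↔ x ≫ und f = 0 :=
  kerIdeal_factors_iff f x

/-- The morphism underlying `f` is one of those whose kernels define `tilde A`. -/
lemma idealR_le_kerPoint (i : inc.obj (𝟙_ C) ≅ 𝟙_ E) {A : CommMon E}
    (f : A ⟶ CommMon.trivial E) : (idealR A).carrier ≤ (kerPoint i f).ideal.carrier := by
  rw [idealR_le_iff, le_iff_factors_arrow, kerPoint_factors_iff]
  exact (tilde_factors_iff _).1 (Subobject.factors_self _) (und f)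

/-- Points of the spectrum which are kernels of morphisms to the unit algebra and agree on the
invariants coincide, if the map from `Spec A_0` to `Spec A^0` is injective. -/
lemma kerPoint_eq_of_injective (hN : ∀ X : C, IsNoetherianObject X) (i : inc.obj (𝟙_ C) ≅ 𝟙_ E)
    {A : CommMon E} (hinj : Function.Injective
      (PrimeSpectrum.comap (H0.map (toA0 A)) ∘ rho (inc := inc) i (A0 A)))
    (f g : A ⟶ CommMon.trivial E)
    (h : ∀ a : 𝟙_ E ⟶ A.X, a ≫ und f = 0 ↔ a ≫ und g = 0) :
    kerPoint (inc := inc) i f = kerPoint i g := by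
  have hex (f : A ⟶ CommMon.trivial E) :
      kerPoint (inc := inc) i f ∈ Set.range (Spec.map (inc := inc) (idealR A).toQuot) := by
    rw [Spec.range_map_toQuot hN]
    exact idealR_le_kerPoint i f
  obtain ⟨P, hP⟩ := hex f
  obtain ⟨Q, hQ⟩ := hex g
  have hmem (P : Spec inc (A0 A)) (f : A ⟶ CommMon.trivial E)
      (hP : Spec.map (idealR A).toQuot P = kerPoint i f) (a : H0 A) :
      a ∈ ((PrimeSpectrum.comap (H0.map (toA0 A)) ∘ rho i (A0 A)) P).asIdeal ↔
        (a : 𝟙_ E ⟶ A.X) ≫ und f = 0 := by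
    refine Iff.trans ?_ (kerPoint_factors_iff i f _)
    rw [← hP]
    exact (AlgIdeal.comap_factors_iff _ _ _).symm
  have hPQ : P = Q := by
    apply hinj
    ext a
    rw [hmem P f hP, hmem Q g hQ]
    exact h a
  rw [← hP, ← hQ, hPQ]

lemma pow_zero_left {A : CommMon E} (X : E) {n : ℕ} (hn : 0 < n) :
    pow (0 : X ⟶ A.X) n = 0 := by
  obtain ⟨m, rfl⟩ := Nat.exists_eq_succ_of_ne_zero hn.ne'
  change (pow 0 m ⊗ₘ 0) ≫ μ = 0
  rw [MonoidalPreadditive.tensor_zero]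
  exact zero_comp

/-- If no power of `β` splits, then the morphism from the symmetric algebra to the unit algebra
induced by `β` vanishes on the invariants of positive degree. -/
lemma comp_symLift_eq_zero {X : C} (β : X ⟶ 𝟙_ C)
    (y : inc.obj (𝟙_ C) ⟶ (CommMon.trivial E).X) {n : ℕ} (hβ : ¬ IsSplitEpi (powToUnit β n))
    (b : inc.obj (𝟙_ C) ⟶ symPow (inc.obj X) n) :
    b ≫ symAlgIota (inc.obj X) n ≫ und (symLift (inc.map β ≫ y)) = 0 := by
  have h1 : symAlgIota (inc.obj X) n ≫ und (symLift (inc.map β ≫ y)) =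
      symComparison inc X n ≫ inc.map (powToUnit β n) ≫ inc.map (tpowUnitIso n).inv ≫
        (mapTpow inc (𝟙_ C) n).hom ≫ pow y n := by
    rw [← cancel_epi (symProj (inc.obj X) n), ← Category.assoc, symProj_symAlgIota,
      symAlgQ_symLift, ← Category.assoc (symProj _ _), symProj_symComparison]
    have h2 : symProj X n ≫ powToUnit β n ≫ (tpowUnitIso n).inv = tpowMap β n := by
      rw [powToUnit, ← Category.assoc, ← Category.assoc, symProj_symMap, Category.assoc,
        Category.assoc, ← Category.assoc (symProj _ _), symProj_symUnitIso, Iso.hom_inv_id,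
        Category.comp_id]
    have h3 : inc.map (symProj X n) ≫ inc.map (powToUnit β n) ≫ inc.map (tpowUnitIso n).inv =
        inc.map (tpowMap β n) := by
      rw [← h2, Functor.map_comp, Functor.map_comp]
    rw [Category.assoc, reassoc_of% h3, ← Category.assoc (inc.map _), mapTpow_natural, pow_comp,
      Category.assoc, Iso.inv_hom_id_assoc]
  obtain ⟨b', hb'⟩ := inc.map_surjective (b ≫ symComparison inc X n)
  have h4 : b' ≫ powToUnit β n = 0 := by
    by_contra h
    have := isIso_of_hom_simple h
    exact hβ ⟨⟨⟨inv (b' ≫ powToUnit β n) ≫ b', by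
      rw [Category.assoc, IsIso.inv_hom_id]⟩⟩⟩
  rw [h1, ← Category.assoc, ← hb', ← Category.assoc, ← Functor.map_comp, h4, inc.map_zero,
    zero_comp]

/-- If no `Sym^n β` with `n > 0` splits, the algebra morphisms from `Sym X` to the unit induced by
`β` and by `0` agree on invariants. Injectivity then makes their kernels equal, but only the second
contains the generators, as `β ≠ 0`. -/
theorem isGR_of_injective (hN : ∀ X : C, IsNoetherianObject X) (i : inc.obj (𝟙_ C) ≅ 𝟙_ E)
    (hinj : ∀ A : CommMon E, Function.Injective
      (PrimeSpectrum.comap (H0.map (toA0 A)) ∘ rho (inc := inc) i (A0 A))) : IsGR C := by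
  intro X β hβ
  by_contra! hns
  let y : inc.obj (𝟙_ C) ⟶ (CommMon.trivial E).X := i.hom
  let f := symLift (inc.map β ≫ y)
  let g : symAlg (inc.obj X) ⟶ CommMon.trivial E := symLift 0
  have hfg (a : 𝟙_ E ⟶ (symAlg (inc.obj X)).X) : a ≫ und f = a ≫ und g := by
    -- It suffices to treat homogeneous invariants: in degree zero the two morphisms agree because
    -- both preserve the unit, and in positive degree both vanish.
    have h := comp_eq_zero_of_symIota (inc := inc) (i.hom ≫ a) (und f - und g) fun n b => by
      change b ≫ symAlgIota (inc.obj X) n ≫ (und f - und g) = 0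
      obtain rfl | hn := Nat.eq_zero_or_pos n
      · have h1 : symAlgIota (inc.obj X) 0 ≫ (und f - und g) = 0 := by
          rw [← cancel_epi (symProj (inc.obj X) 0), ← Category.assoc, symProj_symAlgIota,
            Preadditive.comp_sub, comp_zero, sub_eq_zero, symAlgQ_symLift, symAlgQ_symLift]
          rfl
        rw [h1, comp_zero]
      · have h1 : symAlgIota (inc.obj X) n ≫ und g = 0 := by
          rw [← cancel_epi (symProj (inc.obj X) n), ← Category.assoc, symProj_symAlgIota,
            symAlgQ_symLift, pow_zero_left _ hn, comp_zero]
        rw [Preadditive.comp_sub, h1, sub_zero]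
        exact comp_symLift_eq_zero β y (hns n hn) b
    rw [← sub_eq_zero, ← Preadditive.comp_sub, ← cancel_epi i.hom, comp_zero]
    exact (Category.assoc _ _ _).symm.trans h
  have hpt := kerPoint_eq_of_injective hN i (hinj _) f g fun a => by rw [hfg]
  have h1 : (kerPoint (inc := inc) i g).ideal.carrier.Factors (symAlgGen (inc.obj X)) := by
    rw [kerPoint_factors_iff, symAlgGen_symLift]
  rw [← hpt, kerPoint_factors_iff, symAlgGen_symLift] at h1
  apply hβ
  apply inc.map_injective
  rw [inc.map_zero]
  exact (cancel_mono i.hom).1 (h1.trans zero_comp.symm)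

end InjectiveImpliesGR

/-! ## The main theorem -/

/-- Every endomorphism of the unit is a scalar from `k`, so the nonzero ones are invertible. -/
lemma IsPretannakian.simple_unit {k : Type w} [Field k] {C : Type u} [Category.{v} C]
    [Abelian C] [Linear k C] [MonoidalCategory C] [SymmetricCategory C] [MonoidalPreadditive C]
    [RigidCategory C] (hC : IsPretannakian k C) : Simple (𝟙_ C) := by
  have h1 : 𝟙 (𝟙_ C) ≠ 0 := by
    intro h
    refine one_ne_zero (hC.bijective_smul_id.1 (a₁ := 1) (a₂ := 0) ?_)
    simp [h]
  refine TensorAlg.simple_unit h1 fun f hf => ?_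
  obtain ⟨a, rfl⟩ := hC.bijective_smul_id.2 f
  have ha : a ≠ 0 := by
    rintro rfl
    exact hf (zero_smul _ _)
  exact ⟨a⁻¹ • 𝟙 _, by simp [smul_smul, ha], by simp [smul_smul, ha]⟩

/-- The image of the spectrum under a surjection is the zero locus of the kernel, which is
everything exactly when the kernel is nil. -/
lemma range_comap_toA00_eq_univ_iff {E : Type u} [Category.{v} E] [Abelian E]
    [MonoidalCategory E] [SymmetricCategory E] [WellPowered.{v} E] [HasWidePullbacks.{v} E]
    [MonoidalPreadditive E] [∀ X : E, PreservesFiniteColimits (tensorLeft X)] (A : CommMon E) :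
    Set.range (PrimeSpectrum.comap (toA00 A)) = Set.univ ↔
      ∀ a ∈ RingHom.ker (toA00 A), IsNilpotent a := by
  rw [range_comap_of_surjective _ _ (RingHom.rangeRestrict_surjective _),
    PrimeSpectrum.zeroLocus_eq_univ_iff]
  rfl

end TensorAlg

end

theorem mainTheorem5 {k : Type w} [Field k] {C : Type u} [Category.{v} C] [EssentiallySmall.{v} C]
    [Abelian C] [Linear k C] [MonoidalCategory C] [SymmetricCategory C] [MonoidalPreadditive C]
    [MonoidalLinear k C] [RigidCategory C] (hC : TensorAlg.IsPretannakian k C) :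
    (∀ A : TensorAlg.Alg C,
      IsClosedEmbedding (TensorAlg.specA0ToSpec A) ∧
        IsClosedEmbedding (TensorAlg.specA00ToSpecH0 A)) ∧
    (TensorAlg.IsMN C ↔
      ∀ A : TensorAlg.Alg C, Set.range (TensorAlg.specA0ToSpec A) = Set.univ) ∧
    (TensorAlg.IsMN C →
      ∀ A : TensorAlg.Alg C, Set.range (TensorAlg.specA00ToSpecH0 A) = Set.univ) ∧
    ((∀ A : TensorAlg.Alg C, Set.range (TensorAlg.specA00ToSpecH0 A) = Set.univ) →
      TensorAlg.IsMN2 C) ∧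
    List.TFAE [
      ∀ A : TensorAlg.Alg C, Function.Injective (TensorAlg.specA0ToSpecH0 A),
      ∀ A : TensorAlg.Alg C, IsHomeomorph (TensorAlg.specA0ToSpecA00 A),
      TensorAlg.IsGR C] := by
  have := hC.simple_unit
  have hN := hC.noetherian
  have hA := hC.artinian
  have hrange (A : TensorAlg.Alg C) : Set.range (TensorAlg.specA0ToSpec A) = Set.univ ↔
      ∀ P : TensorAlg.Spec (TensorAlg.incl C) A,
        (TensorAlg.idealR A).carrier ≤ P.ideal.carrier := by
    have h : Set.range (TensorAlg.specA0ToSpec A) =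
        TensorAlg.Spec.zeroLocus (TensorAlg.idealR A) := TensorAlg.Spec.range_map_toQuot hN _
    rw [h]
    exact Set.eq_univ_iff_forall
  refine ⟨fun A => ⟨TensorAlg.Spec.isClosedEmbedding_map_toQuot hN _,
    PrimeSpectrum.isClosedEmbedding_comap_of_surjective _ _
      (RingHom.rangeRestrict_surjective _)⟩, ⟨fun h A => ?_, fun h => ?_⟩, fun h A => ?_,
    fun h => ?_, ?_⟩
  · exact (hrange A).2 (TensorAlg.idealR_le_of_isMN h hN hA (TensorAlg.inclUnit C))
  · exact TensorAlg.isMN_of_idealR_le (TensorAlg.inclUnit C) fun A => (hrange A).1 (h A)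
  · refine (TensorAlg.range_comap_toA00_eq_univ_iff A).2 fun a ha => ?_
    exact TensorAlg.isNilpotent_of_idealR_le (TensorAlg.inclUnit C)
      (TensorAlg.idealR_le_of_isMN h hN hA (TensorAlg.inclUnit C)) a
      ((TensorAlg.mem_ker_toA00_iff a).1 ha)
  · exact TensorAlg.isMN2_of_isNilpotent (TensorAlg.inclUnit C) fun A =>
      (TensorAlg.range_comap_toA00_eq_univ_iff A).1 (h A)
  · tfae_have 1 → 3 := fun h =>
      TensorAlg.isGR_of_injective hN (TensorAlg.inclUnit C) h
    tfae_have 3 → 2 := fun h A =>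
      TensorAlg.isHomeomorph_of_isGR h hN hA (TensorAlg.inclUnit C) A
    -- The map to `Spec A^0` is the one to `Spec A^0_0` followed by the injection coming from the
    -- surjection `A^0 → A^0_0`.
    tfae_have 2 → 1 := fun h A =>
      (PrimeSpectrum.comap_injective_of_surjective (TensorAlg.toA00 A)
        (RingHom.rangeRestrict_surjective _)).comp (h A).injective
    tfae_finish
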